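/- Let $n\ge 2$ and let $L=\sum_{l=0}^n P_l(X,Y)$, where each $P_l$ is a complex polynomial, homogeneous of degree $l$, in the non-commuting variables $X,Y$. Assume that $P_n$ is generic: as commutative polynomials in $z$, $P_n(iz,0)=z^n$, and $P_n(iz,1)$ has $n$ distinct complex roots $\gamma_1,\dots,\gamma_n$. For $\mu\in\mathbb C\setminus\{0\}$ put $$\mathcal L_\mu=\sum_{l=0}^n \mu^{-(n-l)}P_l(i\partial_t,t),$$ acting on entire functions of $t\in\mathbb C$, and let $\ker\mathcal L_\mu$ be its kernel in the space of entire functions. Write $P_l(i\partial_t,t)$ with all powers of $t$ to the left of the derivatives; let $d_{l,j}$ be the coefficient of $t^{l-j}\partial_t^j$ and $e_{l,j}$ the coefficient of $t^{l-j-2}\partial_t^j$ (zero if the exponent of $t$ is negative). Define $n\times n$ matrices, with rows and columns indexed by $1,\dots,n$: $V=(\gamma_j^{k-1})_{k,j}$; $V'=((k-1)\gamma_j^{k-1})_{k,j}$; $E_1$ and $E_2$ with all rows but the last equal to $0$ and with last rows $\big(-d_{n-1,k-1}/\mu\big)_k$ and $\big(-(e_{n,k-1}+d_{n-2,k-1}/\mu^2)\big)_k$;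 $D_1=V^{-1}E_1V$; $D_2=V^{-1}E_2V$; $\Gamma=\operatorname{diag}(\gamma_1,\dots,\gamma_n)$; and $A$ with zero diagonal and $A_{ij}=(D_1)_{ij}/(\gamma_j-\gamma_i)$ for $i\ne j$. Put $$\beta_{\mu,k}=(D_1)_{kk},\qquad \rho_{\mu,k}=\big(D_2+[D_1,A]+A[A,\Gamma]-V^{-1}V'\big)_{kk},$$ $$\Phi_k(t,\mu)=\gamma_k\frac{t^2}{2}+\beta_{\mu,k}\,t+\rho_{\mu,k}\ln|t| .$$ **Proposition.** Let $\alpha\in[0,\pi/2]$. There are real numbers $\upsilon_1<0<\upsilon_2$ such that for every compact, simply connected set $\Omega\subset\mathbb C$ at positive distance from $0$ there is a compact set $K\subset\mathbb C$ with non-empty interior such that, with $$\mathfrak U_\alpha^{\pm}=\{z_0+se^{-i\theta}\;:\; z_0\in K,\ \pm s>0,\ \upsilon_1<\theta-\alpha<\upsilon_2\},$$ for each choice of sign $\pm$ there are functions $\psi_1^\pm(t,\mu),\dots,\psi_n^\pm(t,\mu)$ with the following properties: 1. for every $\mu\in\Omega$, the functions $\psi_k^\pm(\cdot,\mu)$,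 $1\le k\le n$, are entire and form a basis of $\ker\mathcal L_\mu$; 2. for every $t\in\mathbb C$, each $\psi_k^\pm(t,\cdot)$ is holomorphic in a neighbourhood of every point of $\Omega$; 3. for all $1\le k\le n$ and all $j\ge 0$ there is a constant $C>0$ such that $$\big|\partial_t^j\psi_k^\pm(t,\mu)\big|\le C\,(1+|t|)^j\,\big|e^{\Phi_k(t,\mu)}\big|\qquad\text{for all }\mu\in\Omega,\ t\in\mathfrak U_\alpha^\pm .$$ -/

import Mathlib

noncomputable section

namespace Heis

/-- The complex vector space of entire functions of one complex variable `t`. -/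
def Entire : Submodule ℂ (ℂ → ℂ) where
  carrier := {f | Differentiable ℂ f}
  add_mem' := fun hf hg => Differentiable.add hf hg
  zero_mem' := differentiable_const (0 : ℂ)
  smul_mem' := fun c _ hf => Differentiable.const_smul hf c

/-- The operator `∂_t` on entire functions. -/
def dOp : Module.End ℂ Entire where
  toFun f := ⟨deriv f.1, fun z => (f.2.analyticAt z).deriv.differentiableAt⟩
  map_add' f g := Subtype.ext (funext fun z => deriv_add (f.2 z) (g.2 z))
  map_smul' c f := Subtype.ext (funext fun z => deriv_const_smul c (f.2 z))

/-- Multiplication by the independent variable `t` on entire functions. -/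
def tOp : Module.End ℂ Entire where
  toFun f := ⟨fun z => z * f.1 z, differentiable_id.mul f.2⟩
  map_add' f g := Subtype.ext (funext fun z => mul_add z (f.1 z) (g.1 z))
  map_smul' c f := Subtype.ext (funext fun z => mul_left_comm z c (f.1 z))

/-- Polynomials in the non-commuting variables `X = ι 0` and `Y = ι 1`. -/
abbrev NC : Type := FreeAlgebra ℂ (Fin 2)

/-- `p` is homogeneous of degree `l` in `X, Y`: a linear combination of words of length `l`. -/
def IsHomog (l : ℕ) (p : NC) : Prop :=
  p ∈ (Submodule.span ℂ (Set.range (FreeAlgebra.ι ℂ : Fin 2 → NC))) ^ l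

/-- The differential operator `p(i∂_t, t)` acting on entire functions. -/
def opOf : NC →ₐ[ℂ] Module.End ℂ Entire :=
  FreeAlgebra.lift ℂ ![Complex.I • dOp, tOp]

/-- The commutative polynomial `p(iz, c)` in the variable `z`. -/
def charPoly (c : ℂ) : NC →ₐ[ℂ] Polynomial ℂ :=
  FreeAlgebra.lift ℂ ![Complex.I • Polynomial.X, Polynomial.C c]

/-- The operator `𝓛_μ = ∑_{l=0}^n μ^{l-n} P_l(i∂_t, t)` on entire functions. -/
def opL (n : ℕ) (P : ℕ → NC) (μ : ℂ) : Module.End ℂ Entire :=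
  ∑ l ∈ Finset.range (n + 1), (μ ^ (n - l))⁻¹ • opOf (P l)

/-- `L = ∑_{l ≤ n} P_l(X, Y)` with `P_l` homogeneous of degree `l` and `P_n` generic:
`P_n(iz, 0) = z^n`, and `γ_1, …, γ_n` are distinct roots of `P_n(iz, 1)`
(a polynomial of degree `n`, so these are all the roots). -/
structure IsGeneric (n : ℕ) (P : ℕ → NC) (γ : Fin n → ℂ) : Prop where
  homog : ∀ l ≤ n, IsHomog l (P l)
  monic : charPoly 0 (P n) = Polynomial.X ^ n
  injective : Function.Injective γ
  root : ∀ j, (charPoly 1 (P n)).eval (γ j) = 0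

/-! ### Normal ordering -/

/-- Left composition with `∂_t` on normally ordered symbols: if `a(T, Z)` (with `T = X 0`,
`Z = X 1`) stands for the operator `∑ a_{p,q} t^p ∂_t^q`, then `∂_t ∘ a` has the symbol
`Z a + ∂a/∂T`. -/
def symD : Module.End ℂ (MvPolynomial (Fin 2) ℂ) :=
  LinearMap.mulLeft ℂ (MvPolynomial.X 1) + (MvPolynomial.pderiv 0).toLinearMap

/-- Left composition with `t` on normally ordered symbols. -/
def symT : Module.End ℂ (MvPolynomial (Fin 2) ℂ) :=
  LinearMap.mulLeft ℂ (MvPolynomial.X 0)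

/-- The normally ordered symbol of `p(i∂_t, t)`. -/
def symbol (p : NC) : MvPolynomial (Fin 2) ℂ :=
  (FreeAlgebra.lift ℂ ![Complex.I • symD, symT] : NC →ₐ[ℂ] _) p 1

/-- The coefficient of `t^a ∂_t^b` when `p(i∂_t, t)` is written with all powers of `t` on the
left. -/
def normCoeff (p : NC) (a b : ℕ) : ℂ :=
  (symbol p).coeff (Finsupp.single 0 a + Finsupp.single 1 b)

/-- `d_{l,j}`: the coefficient of `t^{l-j} ∂_t^j` in `P_l(i∂_t, t)` (zero for `j > l`). -/
def dCoef (P : ℕ → NC) (l j : ℕ) : ℂ :=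
  if j ≤ l then normCoeff (P l) (l - j) j else 0

/-- `e_{l,j}`: the coefficient of `t^{l-j-2} ∂_t^j` in `P_l(i∂_t, t)` (zero for `j + 2 > l`). -/
def eCoef (P : ℕ → NC) (l j : ℕ) : ℂ :=
  if j + 2 ≤ l then normCoeff (P l) (l - j - 2) j else 0

/-! ### The exponents

All the matrices below are indexed from `0`; the last row is the one with `i + 1 = n`. -/

section Exponents

variable {n : ℕ} (P : ℕ → NC) (γ : Fin n → ℂ) (μ : ℂ)

/-- `S₀(1)`, with entries `γ_j ^ k` (row `k`, column `j`). -/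
def S0 : Matrix (Fin n) (Fin n) ℂ := (Matrix.vandermonde γ).transpose

/-- `S₀'(1)`, with entries `k γ_j ^ k`. -/
def dS0 : Matrix (Fin n) (Fin n) ℂ := Matrix.of fun k j => (k : ℂ) * γ j ^ (k : ℕ)

/-- `𝓔₁(1)`: last row `-d_{n-1,k}/μ`, other rows zero. -/
def E1 : Matrix (Fin n) (Fin n) ℂ := Matrix.of fun i k =>
  if (i : ℕ) + 1 = n then -(dCoef P (n - 1) k / μ) else 0

/-- `𝓔₂(1)`: last row `-(e_{n,k} + d_{n-2,k}/μ²)`, other rows zero. -/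
def E2 : Matrix (Fin n) (Fin n) ℂ := Matrix.of fun i k =>
  if (i : ℕ) + 1 = n then -(eCoef P n k + dCoef P (n - 2) k / μ ^ 2) else 0

/-- `𝓓₁ = S₀⁻¹ 𝓔₁ S₀` (independent of `t`). -/
def D1 : Matrix (Fin n) (Fin n) ℂ := (S0 γ)⁻¹ * E1 P μ * S0 γ

/-- `t 𝓓₂ = t S₀⁻¹ 𝓔₂ S₀` (independent of `t`). -/
def D2 : Matrix (Fin n) (Fin n) ℂ := (S0 γ)⁻¹ * E2 P μ * S0 γ

/-- `t 𝓐`: zero diagonal, and `[𝓐, Λ₀] = 𝓓₁` off the diagonal, where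
`Λ₀ = diag(γ_1 t, …, γ_n t)`. -/
def matA : Matrix (Fin n) (Fin n) ℂ := Matrix.of fun i j =>
  if i = j then 0 else D1 P γ μ i j / (γ j - γ i)

/-- `β_{μ,j}`. -/
def beta (j : Fin n) : ℂ := D1 P γ μ j j

/-- `ρ_{μ,j}`: the `j`-th diagonal entry of
`t (𝓓₂ + [𝓓₁, 𝓐] + 𝓐 [𝓐, Λ₀] - S₀⁻¹ S₀')`. -/
def rho (j : Fin n) : ℂ :=
  (D2 P γ μ + (D1 P γ μ * matA P γ μ - matA P γ μ * D1 P γ μ)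
    + matA P γ μ * (matA P γ μ * Matrix.diagonal γ - Matrix.diagonal γ * matA P γ μ)
    - (S0 γ)⁻¹ * dS0 γ) j j

/-- `Φ_j(t, μ) = γ_j t²/2 + β_{μ,j} t + ρ_{μ,j} ln|t|`. -/
def Phi (j : Fin n) (t : ℂ) : ℂ :=
  γ j * (t ^ 2 / 2) + beta P γ μ j * t + rho P γ μ j * (Real.log ‖t‖ : ℂ)

end Exponents

/-- `𝔘_α^±` with `ε = ±1`: the points `z₀ + s e^{-iθ}` with `z₀ ∈ K`, `±s > 0` and
`υ₁ < θ - α < υ₂`. -/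
def sector (K : Set ℂ) (α υ₁ υ₂ ε : ℝ) : Set ℂ :=
  {z | ∃ z₀ ∈ K, ∃ s θ : ℝ, 0 < ε * s ∧ υ₁ < θ - α ∧ θ - α < υ₂ ∧
    z = z₀ + (s : ℂ) * Complex.exp (-(Complex.I * (θ : ℂ)))}

end Heis

end

noncomputable section

namespace Heis

open MvPolynomial (monomial coeff)

/-! ### Normal ordering -/

section NormalOrdering

/-! The equation `𝓛_μ f = 0` is an `n × n` companion system with polynomial coefficients, whose
solutions are all entire; the point is to select solutions with the growth `e^{Φ_k}`, uniformly and
holomorphically in `μ`.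

Asymptotics. On the half-line of direction `p = ±e^{-iα}` put `t = p√w` and `q = 1/t`. After
rescaling by `diag(t^i)` the system becomes `dy/dw = (p²/2) M(q) y` with `M` polynomial in `q`.
`M(0)` is the companion matrix of `P_n(iz, 1)`, diagonalized by the Vandermonde matrix because the
`γ_k` are distinct. Two further steps of formal diagonalization (`normalForm_identities`,
`exists_gauge_remainder`) make the system diagonal up to `O(q³)`, with diagonal terms `γ_k + qβ_k +
q²ρ_k`, that is, the derivatives of the `Φ_k` up to the factor `p²/2`. The error `O(q³) =
O(|w|^{-3/2})` is integrable, so a Levinson-type iteration (`eventually_exists_normalized_solution`)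
yields genuine solutions close to the diagonal ones.

Each iteration step solves scalar equations `v' = (Φ_i - Φ_j)' v + f` on a cone `|Im w| < s (Re w -
x₀)`. If `Re(Φ_i - Φ_j)` grows along some direction of the cone, one integrates from infinity; if it
decays along all of them, from the apex. For small `s` one of the two always happens
(`exists_admissibleSlope`), and `s` fixes the opening of the sector.

Parameter. All of this is done with entries in a commutative Banach algebra. For the closure of the
polynomials on a disc `|ν| ≤ B`, with `ν` the coordinate, one solution contains those for all `μ =
1/ν`: evaluation gives holomorphy in `μ`, and norms in the algebra bound all evaluations at once
(`exists_kernel_basis`).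

Conclusion. The solution on the cone differs from an entire fundamental matrix by a constant
invertible factor, hence extends (`exists_entire_fundamental_matrix`). Its first row is a basis of
the kernel (`kernel_basis`). The sector lies far out in the cone and away from `0`
(`sector_geometry`), and Cauchy's estimate on discs of radius `1/(1+|t|)`, where `Φ_k` varies by
`O(1)`, bounds the derivatives (`exists_norm_iteratedDeriv_le`). -/

lemma dOp_mul_tOp : dOp * tOp = tOp * dOp + 1 := by
  refine LinearMap.ext fun f => Subtype.ext (funext fun z => ?_)
  change deriv (fun z => z * f.1 z) z = z * deriv f.1 z + f.1 z
  have := ((hasDerivAt_id z).mul (f.2 z).hasDerivAt).deriv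
  simp only [id, one_mul] at this
  rw [add_comm]
  exact this

lemma dOp_mul_tOp_pow (k : ℕ) : dOp * tOp ^ k = tOp ^ k * dOp + (k : ℂ) • tOp ^ (k - 1) := by
  induction k with
  | zero => simp
  | succ k ih =>
    rw [pow_succ, ← mul_assoc, ih, add_mul, mul_assoc, dOp_mul_tOp, Nat.add_sub_cancel, mul_add,
      mul_one, ← mul_assoc, add_assoc]
    congr 1
    rcases k with _ | k
    · simp
    · rw [smul_mul_assoc, Nat.add_sub_cancel, ← pow_succ, Nat.cast_succ (k + 1), add_smul, one_smul,
        add_comm]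

/-- The operator with a given normally ordered symbol. -/
def opOfSymbol : MvPolynomial (Fin 2) ℂ →ₗ[ℂ] Module.End ℂ Entire :=
  (MvPolynomial.basisMonomials (Fin 2) ℂ).constr ℂ fun m => tOp ^ m 0 * dOp ^ m 1

lemma opOfSymbol_monomial (m : Fin 2 →₀ ℕ) :
    opOfSymbol (monomial m 1) = tOp ^ m 0 * dOp ^ m 1 := by
  have := (MvPolynomial.basisMonomials (Fin 2) ℂ).constr_basis ℂ
    (fun m => tOp ^ m 0 * dOp ^ m 1) m
  rwa [MvPolynomial.coe_basisMonomials] at this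

lemma symT_monomial (m : Fin 2 →₀ ℕ) :
    symT (monomial m 1) = monomial (Finsupp.single 0 1 + m) 1 := by
  simp [symT, MvPolynomial.X, MvPolynomial.monomial_mul]

lemma symD_monomial (m : Fin 2 →₀ ℕ) :
    symD (monomial m 1) = monomial (Finsupp.single 1 1 + m) 1 +
      (m 0 : ℂ) • monomial (m - Finsupp.single 0 1) 1 := by
  simp [symD, MvPolynomial.X, MvPolynomial.monomial_mul, MvPolynomial.pderiv_monomial,
    MvPolynomial.smul_monomial]

lemma opOfSymbol_symT (s : MvPolynomial (Fin 2) ℂ) : opOfSymbol (symT s) = tOp * opOfSymbol s := by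
  have : opOfSymbol ∘ₗ symT = LinearMap.mulLeft ℂ tOp ∘ₗ opOfSymbol := by
    refine (MvPolynomial.basisMonomials (Fin 2) ℂ).ext fun m => ?_
    simp only [MvPolynomial.coe_basisMonomials, LinearMap.comp_apply, symT_monomial,
      opOfSymbol_monomial, LinearMap.mulLeft_apply]
    simp [pow_add, mul_assoc]
  exact LinearMap.congr_fun this s

lemma opOfSymbol_symD (s : MvPolynomial (Fin 2) ℂ) : opOfSymbol (symD s) = dOp * opOfSymbol s := by
  have : opOfSymbol ∘ₗ symD = LinearMap.mulLeft ℂ dOp ∘ₗ opOfSymbol := by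
    refine (MvPolynomial.basisMonomials (Fin 2) ℂ).ext fun m => ?_
    simp only [MvPolynomial.coe_basisMonomials, LinearMap.comp_apply, symD_monomial, map_add,
      map_smul, opOfSymbol_monomial, LinearMap.mulLeft_apply]
    rw [← mul_assoc, dOp_mul_tOp_pow, add_mul, mul_assoc, ← pow_succ']
    simp [add_comm]
  exact LinearMap.congr_fun this s

/-- The action of non-commutative polynomials on symbols. -/
def symAct : NC →ₐ[ℂ] Module.End ℂ (MvPolynomial (Fin 2) ℂ) :=
  FreeAlgebra.lift ℂ ![Complex.I • symD, symT]

lemma symbol_eq (p : NC) : symbol p = symAct p 1 := rfl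

lemma symbol_mul (p q : NC) : symbol (p * q) = symAct p (symbol q) := by
  rw [symbol_eq, map_mul]; rfl

/-- Quantifying over `s` inside the induction makes the product case immediate; only the case `s =
1` is used, to see that `symbol` really computes the normal form. -/
lemma opOfSymbol_symAct (p : NC) : ∀ s, opOfSymbol (symAct p s) = opOf p * opOfSymbol s := by
  induction p using FreeAlgebra.induction with
  | grade0 r => intro s; simp [Algebra.algebraMap_eq_smul_one]
  | grade1 x =>
    intro s
    fin_cases x
    · simp [symAct, opOf, opOfSymbol_symD]
    · simp [symAct, opOf, opOfSymbol_symT]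
  | mul a b ha hb => intro s; rw [map_mul, map_mul, Module.End.mul_apply, ha, hb, mul_assoc]
  | add a b ha hb => intro s; rw [map_add, map_add, LinearMap.add_apply, map_add, ha, hb, add_mul]

lemma opOf_eq_opOfSymbol (p : NC) : opOf p = opOfSymbol (symbol p) := by
  rw [symbol_eq, opOfSymbol_symAct, show (1 : MvPolynomial (Fin 2) ℂ) = monomial 0 1 from rfl,
    opOfSymbol_monomial]
  simp

/-- The symbols supported in degrees `l, l - 2, l - 4, …`. -/
def parSym (l : ℕ) : Submodule ℂ (MvPolynomial (Fin 2) ℂ) :=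
  MvPolynomial.restrictSupport ℂ {m | ∃ k, m 0 + m 1 + 2 * k = l}

lemma parSym_le {l : ℕ} {S : Submodule ℂ (MvPolynomial (Fin 2) ℂ)}
    (h : ∀ m : Fin 2 →₀ ℕ, ∀ k, m 0 + m 1 + 2 * k = l → monomial m (1 : ℂ) ∈ S) : parSym l ≤ S := by
  rw [parSym, MvPolynomial.restrictSupport_eq_span, Submodule.span_le]
  rintro _ ⟨m, ⟨k, hk⟩, rfl⟩
  exact h m k hk

lemma monomial_mem_parSym {l : ℕ} {m : Fin 2 →₀ ℕ} {k : ℕ} (h : m 0 + m 1 + 2 * k = l) :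
    monomial m (1 : ℂ) ∈ parSym l :=
  (MvPolynomial.monomial_mem_restrictSupport ℂ).2 (Or.inl ⟨k, h⟩)

lemma symT_mem_parSym {l : ℕ} {s : MvPolynomial (Fin 2) ℂ} (hs : s ∈ parSym l) :
    symT s ∈ parSym (l + 1) := by
  refine parSym_le (S := (parSym (l + 1)).comap symT) (fun m k h => ?_) hs
  rw [Submodule.mem_comap, symT_monomial]
  refine monomial_mem_parSym (k := k) ?_
  simp
  omega

/-- Commuting `∂` past `t` removes one `t` and one `∂`, so normal ordering lowers the degree in
steps of two. This is why only the `d` and `e` coefficients enter down to degree `n - 2`. -/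
lemma symD_mem_parSym {l : ℕ} {s : MvPolynomial (Fin 2) ℂ} (hs : s ∈ parSym l) :
    symD s ∈ parSym (l + 1) := by
  refine parSym_le (S := (parSym (l + 1)).comap symD) (fun m k h => ?_) hs
  rw [Submodule.mem_comap, symD_monomial]
  refine add_mem (monomial_mem_parSym (k := k) ?_) ?_
  · simp
    omega
  · rcases Nat.eq_zero_or_pos (m 0) with h0 | h0
    · simp [h0]
    · refine Submodule.smul_mem _ _ (monomial_mem_parSym (k := k + 1) ?_)
      simp
      omega

/-- The part of degree `l` of a symbol, specialized to a polynomial in one variable. -/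
def leadPoly (c : ℂ) (l : ℕ) : MvPolynomial (Fin 2) ℂ →ₗ[ℂ] Polynomial ℂ :=
  (MvPolynomial.basisMonomials (Fin 2) ℂ).constr ℂ fun m =>
    if m 0 + m 1 = l then Polynomial.C (c ^ m 0) * Polynomial.X ^ m 1 else 0

lemma leadPoly_monomial (c : ℂ) (l : ℕ) (m : Fin 2 →₀ ℕ) : leadPoly c l (monomial m 1) =
    if m 0 + m 1 = l then Polynomial.C (c ^ m 0) * Polynomial.X ^ m 1 else 0 := by
  have := (MvPolynomial.basisMonomials (Fin 2) ℂ).constr_basis ℂ (fun m =>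
    if m 0 + m 1 = l then Polynomial.C (c ^ m 0) * Polynomial.X ^ m 1 else 0) m
  rwa [MvPolynomial.coe_basisMonomials] at this

lemma leadPoly_symT (c : ℂ) {l : ℕ} {s : MvPolynomial (Fin 2) ℂ} (hs : s ∈ parSym l) :
    leadPoly c (l + 1) (symT s) = Polynomial.C c * leadPoly c l s := by
  suffices h : parSym l ≤ LinearMap.eqLocus (leadPoly c (l + 1) ∘ₗ symT)
      (LinearMap.mulLeft ℂ (Polynomial.C c) ∘ₗ leadPoly c l) from
    LinearMap.mem_eqLocus.1 (h hs)
  refine parSym_le fun m k h => ?_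
  simp only [LinearMap.mem_eqLocus, LinearMap.comp_apply, LinearMap.mulLeft_apply, symT_monomial,
    leadPoly_monomial]
  have e : (Finsupp.single 0 1 + m : Fin 2 →₀ ℕ) 0 = m 0 + 1 := by simp [add_comm]
  have e' : (Finsupp.single 0 1 + m : Fin 2 →₀ ℕ) 1 = m 1 := by simp
  rw [e, e']
  by_cases h' : m 0 + m 1 = l
  · rw [if_pos h', if_pos (by omega), pow_succ, map_mul]
    ring
  · rw [if_neg h', if_neg (by omega), mul_zero]

/-- The term `∂a/∂T` has degree at most `l - 1` and does not reach degree `l + 1`; on leading parts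
`∂` is multiplication by the variable. -/
lemma leadPoly_symD (c : ℂ) {l : ℕ} {s : MvPolynomial (Fin 2) ℂ} (hs : s ∈ parSym l) :
    leadPoly c (l + 1) (symD s) = Polynomial.X * leadPoly c l s := by
  suffices h : parSym l ≤ LinearMap.eqLocus (leadPoly c (l + 1) ∘ₗ symD)
      (LinearMap.mulLeft ℂ (Polynomial.X : Polynomial ℂ) ∘ₗ leadPoly c l) from
    LinearMap.mem_eqLocus.1 (h hs)
  refine parSym_le fun m k h => ?_
  simp only [LinearMap.mem_eqLocus, LinearMap.comp_apply, LinearMap.mulLeft_apply, symD_monomial,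
    map_add, map_smul, leadPoly_monomial]
  have e : (Finsupp.single 1 1 + m : Fin 2 →₀ ℕ) 0 = m 0 := by simp
  have e' : (Finsupp.single 1 1 + m : Fin 2 →₀ ℕ) 1 = m 1 + 1 := by simp [add_comm]
  have f : (m - Finsupp.single 0 1 : Fin 2 →₀ ℕ) 0 = m 0 - 1 := by simp
  have f' : (m - Finsupp.single 0 1 : Fin 2 →₀ ℕ) 1 = m 1 := by simp
  rw [e, e', f, f', if_neg (by omega : ¬(m 0 - 1 + m 1 = l + 1)), smul_zero, add_zero]
  by_cases h' : m 0 + m 1 = l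
  · rw [if_pos h', if_pos (by omega), pow_succ]
    ring
  · rw [if_neg h', if_neg (by omega), mul_zero]

lemma coeff_eq_zero_of_mem_parSym {l : ℕ} {s : MvPolynomial (Fin 2) ℂ} (hs : s ∈ parSym l)
    {m : Fin 2 →₀ ℕ} (hm : ¬∃ k, m 0 + m 1 + 2 * k = l) : coeff m s = 0 := by
  by_contra h
  exact hm ((MvPolynomial.mem_restrictSupport_iff ℂ).1 hs
    (Finset.mem_coe.2 (MvPolynomial.mem_support_iff.2 h)))

lemma fin_two_finsupp (m : Fin 2 →₀ ℕ) : Finsupp.single 0 (m 0) + Finsupp.single 1 (m 1) = m := by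
  ext i
  fin_cases i <;> simp

/-- A symbol of bounded degree as a double sum of monomials. -/
lemma symbol_eq_sum {l N : ℕ} (hl : l ≤ N) {s : MvPolynomial (Fin 2) ℂ} (hs : s ∈ parSym l) :
    s = ∑ b ∈ Finset.range (N + 1), ∑ a ∈ Finset.range (N + 1),
      coeff (Finsupp.single 0 a + Finsupp.single 1 b) s •
        monomial (Finsupp.single 0 a + Finsupp.single 1 b) (1 : ℂ) := by
  classical
  ext m
  simp only [MvPolynomial.coeff_sum, MvPolynomial.coeff_smul, MvPolynomial.coeff_monomial]
  have e : ∀ a b : ℕ, (Finsupp.single 0 a + Finsupp.single 1 b : Fin 2 →₀ ℕ) = m ↔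
      (m 1 = b ∧ m 0 = a) := by
    intro a b
    constructor
    · rintro rfl; simp
    · rintro ⟨rfl, rfl⟩; exact fin_two_finsupp m
  simp only [e, smul_eq_mul]
  by_cases h : m 0 < N + 1 ∧ m 1 < N + 1
  · rw [Finset.sum_eq_single (m 1), Finset.sum_eq_single (m 0)]
    · simp [fin_two_finsupp]
    · exact fun a _ ha => by simp [Ne.symm ha]
    · exact fun ha => absurd (Finset.mem_range.2 h.1) ha
    · exact fun b _ hb => by simp [Ne.symm hb]
    · exact fun hb => absurd (Finset.mem_range.2 h.2) hb
  · rw [coeff_eq_zero_of_mem_parSym hs (by rintro ⟨k, hk⟩; omega)]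
    refine (Finset.sum_eq_zero fun b hb => Finset.sum_eq_zero fun a ha => ?_).symm
    have := Finset.mem_range.1 hb
    have := Finset.mem_range.1 ha
    rw [if_neg (by omega), mul_zero]

/-- Symbols of homogeneous polynomials. -/
lemma symbol_mem_and_leadPoly {l : ℕ} {p : NC} (hp : IsHomog l p) :
    symbol p ∈ parSym l ∧ ∀ c, leadPoly c l (symbol p) = charPoly c p := by
  induction hp using Submodule.pow_induction_on_left' with
  | algebraMap r =>
    have e : symbol (algebraMap ℂ NC r) = r • monomial 0 1 := by
      rw [symbol_eq, AlgHom.commutes, Module.algebraMap_end_apply]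
      rfl
    rw [e]
    refine ⟨Submodule.smul_mem _ _ (monomial_mem_parSym (k := 0) (by simp)), fun c => ?_⟩
    rw [map_smul, leadPoly_monomial, AlgHom.commutes]
    simp [Polynomial.algebraMap_eq, Polynomial.smul_eq_C_mul]
  | add x y i hx hy ihx ihy =>
    rw [symbol_eq, map_add, LinearMap.add_apply, ← symbol_eq, ← symbol_eq]
    exact ⟨add_mem ihx.1 ihy.1, fun c => by rw [map_add, map_add, ihx.2, ihy.2]⟩
  | mem_mul m hm i x hx ih =>
    rw [symbol_mul]
    obtain ⟨h1, h2⟩ := ih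
    simp only [map_mul, ← h2]
    clear h2
    induction hm using Submodule.span_induction with
    | mem y hy =>
      obtain ⟨j, rfl⟩ := hy
      fin_cases j
      · have e : symAct (FreeAlgebra.ι ℂ (0 : Fin 2)) = Complex.I • symD := by simp [symAct]
        have e' : ∀ c, charPoly c (FreeAlgebra.ι ℂ (0 : Fin 2)) = Complex.I • Polynomial.X :=
          fun c => by simp [charPoly]
        simp only [Fin.zero_eta, e, e', LinearMap.smul_apply, map_smul]
        exact ⟨Submodule.smul_mem _ _ (symD_mem_parSym h1), fun c => by
          rw [leadPoly_symD c h1, smul_mul_assoc]⟩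
      · have e : symAct (FreeAlgebra.ι ℂ (1 : Fin 2)) = symT := by simp [symAct]
        have e' : ∀ c, charPoly c (FreeAlgebra.ι ℂ (1 : Fin 2)) = Polynomial.C c :=
          fun c => by simp [charPoly]
        simp only [Fin.mk_one, e, e']
        exact ⟨symT_mem_parSym h1, fun c => leadPoly_symT c h1⟩
    | zero => simp
    | add y z _ _ hy hz =>
      simp only [map_add, LinearMap.add_apply, add_mul]
      exact ⟨add_mem hy.1 hz.1, fun c => by rw [hy.2, hz.2]⟩
    | smul r y _ hy =>
      simp only [map_smul, LinearMap.smul_apply, smul_mul_assoc]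
      exact ⟨Submodule.smul_mem _ _ hy.1, fun c => by rw [hy.2]⟩

lemma normCoeff_eq_zero {l : ℕ} {p : NC} (hp : IsHomog l p) {a b : ℕ}
    (h : ¬∃ k, a + b + 2 * k = l) : normCoeff p a b = 0 :=
  coeff_eq_zero_of_mem_parSym (symbol_mem_and_leadPoly hp).1 (by simpa using h)

lemma opOf_eq_sum {l N : ℕ} (hl : l ≤ N) {p : NC} (hp : IsHomog l p) :
    opOf p = ∑ b ∈ Finset.range (N + 1), ∑ a ∈ Finset.range (N + 1),
      normCoeff p a b • (tOp ^ a * dOp ^ b) := by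
  rw [opOf_eq_opOfSymbol, symbol_eq_sum hl (symbol_mem_and_leadPoly hp).1]
  simp only [map_sum, map_smul, opOfSymbol_monomial]
  simp [normCoeff]

/-- This turns the genericity hypotheses, stated for commutative polynomials, into statements on the
normally ordered coefficients. -/
lemma charPoly_eq_sum {l : ℕ} {p : NC} (hp : IsHomog l p) (c : ℂ) :
    charPoly c p = ∑ j ∈ Finset.range (l + 1),
      Polynomial.C (normCoeff p (l - j) j * c ^ (l - j)) * Polynomial.X ^ j := by
  rw [← (symbol_mem_and_leadPoly hp).2 c, symbol_eq_sum le_rfl (symbol_mem_and_leadPoly hp).1]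
  simp only [map_sum, map_smul, leadPoly_monomial]
  refine Finset.sum_congr rfl fun j hj => ?_
  have hj' := Finset.mem_range.1 hj
  rw [Finset.sum_eq_single (l - j)]
  · simp only [Finsupp.coe_add, Pi.add_apply, Finsupp.single_apply]
    rw [if_pos (by simp; omega), normCoeff, Polynomial.smul_eq_C_mul]
    simp [mul_assoc]
  · intro a _ ha
    rw [if_neg (by simp; omega), smul_zero]
  · intro h
    simp at h

end NormalOrdering

end Heis

end

noncomputable section

namespace Heis

open Filter Topology

/-! ### Entire solutions of linear equations with polynomial coefficients -/

section EntireODE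

variable {E : Type*} [NormedAddCommGroup E] [NormedSpace ℂ E]

/-- Taylor coefficients at `0` of the solution of `x' = ∑ r, t ^ r • T r x`, `x 0 = x₀`. -/
def taylorCoeff (T : ℕ → E →L[ℂ] E) (x₀ : E) : ℕ → E
  | 0 => x₀
  | m + 1 => ((m : ℂ) + 1)⁻¹ • ∑ r : Fin (m + 1), T r (taylorCoeff T x₀ (m - r))
termination_by m => m
decreasing_by omega

lemma taylorCoeff_succ (T : ℕ → E →L[ℂ] E) (x₀ : E) (m : ℕ) :
    ((m : ℂ) + 1) • taylorCoeff T x₀ (m + 1) =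
      ∑ r ∈ Finset.range (m + 1), T r (taylorCoeff T x₀ (m - r)) := by
  rw [taylorCoeff, smul_inv_smul₀ (by exact_mod_cast Nat.succ_ne_zero m), Finset.sum_range]

lemma exists_norm_taylorCoeff_le {T : ℕ → E →L[ℂ] E} {N : ℕ} (hT : ∀ r, N ≤ r → T r = 0) (x₀ : E)
    {ε : ℝ} (hε : 0 < ε) : ∃ C, ∀ m, ‖taylorCoeff T x₀ m‖ ≤ C * ε ^ m := by
  -- The recursion divides by `m + 1`, so the bound `C ε^m` reproduces itself once `m + 1 ≥ a`; `C`
  -- is chosen to cover the finitely many earlier coefficients.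
  set a : ℝ := ∑ r ∈ Finset.range N, ‖T r‖ * (ε ^ (r + 1))⁻¹ with ha
  obtain ⟨M, hM⟩ := exists_nat_ge a
  set C : ℝ := ∑ m ∈ Finset.range (M + 1), ‖taylorCoeff T x₀ m‖ * (ε ^ m)⁻¹ with hC
  have hC0 : 0 ≤ C := Finset.sum_nonneg fun _ _ => by positivity
  refine ⟨C, fun m => ?_⟩
  induction m using Nat.strong_induction_on with
  | _ m ih =>
    rcases lt_or_ge m (M + 1) with hm | hm
    · have : ‖taylorCoeff T x₀ m‖ * (ε ^ m)⁻¹ ≤ C :=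
        Finset.single_le_sum (f := fun m => ‖taylorCoeff T x₀ m‖ * (ε ^ m)⁻¹)
          (fun _ _ => by positivity) (Finset.mem_range.2 hm)
      rwa [mul_inv_le_iff₀ (by positivity)] at this
    · obtain ⟨m, rfl⟩ : ∃ k, m = k + 1 := ⟨m - 1, by omega⟩
      have h1 : ((m : ℝ) + 1) * ‖taylorCoeff T x₀ (m + 1)‖ ≤ a * (C * ε ^ (m + 1)) := by
        have e : ((m : ℝ) + 1) * ‖taylorCoeff T x₀ (m + 1)‖
            = ‖((m : ℂ) + 1) • taylorCoeff T x₀ (m + 1)‖ := by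
          rw [norm_smul]
          congr 1
          exact_mod_cast (Complex.norm_natCast (m + 1)).symm
        rw [e, taylorCoeff_succ]
        have hterm : ∀ r ∈ Finset.range (m + 1), ‖T r (taylorCoeff T x₀ (m - r))‖
            ≤ ‖T r‖ * (ε ^ (r + 1))⁻¹ * (C * ε ^ (m + 1)) := by
          intro r hr
          have hr' : r ≤ m := Nat.lt_succ_iff.1 (Finset.mem_range.1 hr)
          refine ((T r).le_opNorm _).trans ?_
          rw [mul_assoc]
          refine mul_le_mul_of_nonneg_left ((ih (m - r) (by omega)).trans (le_of_eq ?_))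
            (norm_nonneg _)
          have : ε ^ (m + 1) = ε ^ (m - r) * ε ^ (r + 1) := by
            rw [← pow_add]; congr 1; omega
          rw [this]
          field_simp
        refine (norm_sum_le_of_le _ hterm).trans ?_
        rw [← Finset.sum_mul]
        refine mul_le_mul_of_nonneg_right ?_ (by positivity)
        calc ∑ r ∈ Finset.range (m + 1), ‖T r‖ * (ε ^ (r + 1))⁻¹
            ≤ ∑ r ∈ Finset.range (max N (m + 1)), ‖T r‖ * (ε ^ (r + 1))⁻¹ :=
              Finset.sum_le_sum_of_subset_of_nonneg
                (Finset.range_mono (le_max_right _ _)) fun _ _ _ => by positivity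
          _ = a := by
              refine (Finset.sum_subset (Finset.range_mono (le_max_left _ _)) ?_).symm
              intro r _ hr
              rw [hT r (by simpa using hr)]
              simp
      have h2 : a ≤ (m : ℝ) + 1 := hM.trans (by exact_mod_cast (by omega : M ≤ m + 1))
      have h3 : a * (C * ε ^ (m + 1)) ≤ ((m : ℝ) + 1) * (C * ε ^ (m + 1)) :=
        mul_le_mul_of_nonneg_right h2 (by positivity)
      exact le_of_mul_le_mul_left (h1.trans h3) (by positivity)

/-- A linear equation with polynomial coefficients has an entire solution for every initial
value. -/
theorem exists_entire_solution [CompleteSpace E] {T : ℕ → E →L[ℂ] E} {N : ℕ}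
    (hT : ∀ r, N ≤ r → T r = 0) (x₀ : E) :
    ∃ x : ℂ → E, x 0 = x₀ ∧
      ∀ t, HasDerivAt x (∑ r ∈ Finset.range N, t ^ r • T r (x t)) t := by
  set c := taylorCoeff T x₀ with hc
  have hsum : ∀ R : ℝ, 0 < R → Summable fun m => ‖c m‖ * R ^ m := by
    intro R hR
    -- Decay at rate `1/(2R)` leaves a geometric series of ratio `1/2` at radius `R`.
    obtain ⟨C, hC⟩ := exists_norm_taylorCoeff_le hT x₀ (ε := (2 * R)⁻¹) (by positivity)
    refine Summable.of_nonneg_of_le (fun m => by positivity) (fun m => ?_)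
      ((summable_geometric_of_lt_one (r := (1 / 2 : ℝ)) (by norm_num) (by norm_num)).mul_left C)
    calc ‖c m‖ * R ^ m ≤ C * (2 * R)⁻¹ ^ m * R ^ m :=
          mul_le_mul_of_nonneg_right (hC m) (by positivity)
      _ = C * (1 / 2) ^ m := by
          rw [mul_assoc, ← mul_pow]; congr 2; field_simp
  have hsumm : ∀ t : ℂ, Summable fun m => t ^ m • c m := fun t => by
    refine Summable.of_norm_bounded (hsum (‖t‖ + 1) (by positivity)) fun m => ?_
    rw [norm_smul, norm_pow, mul_comm]
    gcongr
    linarith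
  have hsum' : ∀ R : ℝ, 0 < R → Summable fun m : ℕ => (m : ℝ) * R ^ (m - 1) * ‖c m‖ := by
    intro R hR
    refine Summable.of_nonneg_of_le (fun m => by positivity) (fun m => ?_)
      ((hsum (2 * R) (by positivity)).mul_left R⁻¹)
    rcases m with _ | m
    · simp; positivity
    · have h2 : ((m + 1 : ℕ) : ℝ) ≤ 2 ^ (m + 1) := by
        exact_mod_cast (Nat.lt_two_pow_self (n := m + 1)).le
      have e : R⁻¹ * (‖c (m + 1)‖ * (2 * R) ^ (m + 1)) = 2 ^ (m + 1) * R ^ m * ‖c (m + 1)‖ := by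
        rw [mul_pow, pow_succ R]; field_simp
      rw [e, Nat.add_sub_cancel]
      gcongr
  have hder : ∀ t : ℂ, HasDerivAt (fun z : ℂ => ∑' m, z ^ m • c m)
      (∑' m : ℕ, ((m : ℂ) * t ^ (m - 1)) • c m) t := by
    intro t
    refine hasDerivAt_tsum_of_isPreconnected (g := fun m z => z ^ m • c m)
      (g' := fun m z => ((m : ℂ) * z ^ (m - 1)) • c m) (t := Metric.ball 0 (‖t‖ + 1)) (y₀ := 0)
      (hsum' (‖t‖ + 1) (by positivity)) Metric.isOpen_ball
      (convex_ball (0 : ℂ) (‖t‖ + 1)).isPreconnected (fun m y _ => ?_) (fun m y hy => ?_)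
      (Metric.mem_ball_self (by positivity)) (hsumm 0) (by simp)
    · exact (hasDerivAt_pow m y).smul_const (c m)
    · rw [norm_smul, norm_mul, norm_pow, Complex.norm_natCast]
      have : ‖y‖ ≤ ‖t‖ + 1 := by simpa using (Metric.mem_ball.1 hy).le
      gcongr
  refine ⟨fun t => ∑' m, t ^ m • c m, ?_, fun t => ?_⟩
  · change ∑' m : ℕ, (0 : ℂ) ^ m • c m = x₀
    rw [tsum_eq_single 0 (fun m hm => by simp [hm])]
    simp [hc, taylorCoeff]
  -- Multiplication by `t^r` shifts the series by `r`; summed over `r`, the shifted series match the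
  -- recursion for the coefficients term by term.
  · have hS : ∀ r, HasSum (fun m => if r ≤ m then t ^ m • T r (c (m - r)) else 0)
        (t ^ r • T r (∑' m, t ^ m • c m)) := by
      intro r
      refine ((add_left_injective r).hasSum_iff (f := fun m => if r ≤ m then t ^ m • T r (c (m - r))
        else 0) fun m hm => ?_).1 ?_
      · refine if_neg fun h => hm ⟨m - r, Nat.sub_add_cancel h⟩
      · have := ((T r).hasSum (hsumm t).hasSum).const_smul (t ^ r)
        convert this using 2 with m
        simp [pow_add, smul_smul, mul_comm]
    have hF := hasSum_sum (s := Finset.range N) fun r _ => hS r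
    have hG : HasSum (fun m : ℕ => ((m : ℂ) * t ^ (m - 1)) • c m)
        (∑' m : ℕ, ((m : ℂ) * t ^ (m - 1)) • c m) := by
      refine (Summable.of_norm_bounded (hsum' (‖t‖ + 1) (by positivity)) fun m => ?_).hasSum
      rw [norm_smul, norm_mul, norm_pow, Complex.norm_natCast]
      gcongr
      linarith
    have hG' := (hasSum_nat_add_iff' 1).2 hG
    have e : (fun m => ∑ r ∈ Finset.range N, if r ≤ m then t ^ m • T r (c (m - r)) else 0)
        = fun m => (((m + 1 : ℕ) : ℂ) * t ^ (m + 1 - 1)) • c (m + 1) := by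
      funext m
      rw [Nat.add_sub_cancel, mul_comm, mul_smul, Nat.cast_add, Nat.cast_one, taylorCoeff_succ,
        Finset.smul_sum, ← Finset.sum_filter]
      refine Finset.sum_subset_zero_on_sdiff (fun r hr => ?_) (fun r hr => ?_) fun _ _ => rfl
      · simp only [Finset.mem_filter, Finset.mem_range] at hr ⊢
        omega
      · simp only [Finset.mem_sdiff, Finset.mem_filter, Finset.mem_range] at hr
        rw [hT r (by omega)]
        simp
    rw [e] at hF
    rw [hF.unique hG']
    simpa using hder t

end EntireODE

/-! ### Fundamental matrices over a commutative Banach algebra -/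

section Fundamental

open scoped Matrix.Norms.Operator

set_option linter.unusedSectionVars false

variable {A : Type*} [NormedCommRing A] [NormedAlgebra ℂ A] [CompleteSpace A] {n : ℕ}

instance completeSpace_matrix : @CompleteSpace (Matrix (Fin n) (Fin n) A)
    (PseudoMetricSpace.toUniformSpace (α := Matrix (Fin n) (Fin n) A)) :=
  inferInstanceAs (CompleteSpace (Fin n → Fin n → A))

lemma hasDerivAt_matrix {F : ℂ → Matrix (Fin n) (Fin n) A} {F' : Matrix (Fin n) (Fin n) A} {z : ℂ} :
    HasDerivAt F F' z ↔ ∀ i j, HasDerivAt (fun w => F w i j) (F' i j) z := by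
  have h1 : HasDerivAt F F' z ↔ ∀ i, HasDerivAt (fun w => F w i) (F' i) z :=
    hasDerivAt_pi (𝕜 := ℂ) (φ := fun w i => F w i) (φ' := fun i => F' i)
  rw [h1]
  exact forall_congr' fun i => hasDerivAt_pi (𝕜 := ℂ)

lemma norm_entry_le (M : Matrix (Fin n) (Fin n) A) (i j : Fin n) : ‖M i j‖ ≤ ‖M‖ := by
  rw [Matrix.linfty_opNorm_def]
  refine le_trans ?_ (NNReal.coe_le_coe.2 (Finset.le_sup (Finset.mem_univ i)))
  rw [NNReal.coe_sum]
  exact Finset.single_le_sum (f := fun j => ((‖M i j‖₊ : NNReal) : ℝ)) (fun _ _ => NNReal.coe_nonneg _)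
    (Finset.mem_univ j)

lemma norm_matrix_le {M : Matrix (Fin n) (Fin n) A} {c : ℝ} (hc : 0 ≤ c) (h : ∀ i j, ‖M i j‖ ≤ c) :
    ‖M‖ ≤ n * c := by
  lift c to NNReal using hc
  rw [Matrix.linfty_opNorm_def, ← NNReal.coe_natCast, ← NNReal.coe_mul, NNReal.coe_le_coe]
  refine Finset.sup_le fun i _ => (Finset.sum_le_card_nsmul _ _ c fun j _ => h i j).trans ?_
  simp

/-- An entire fundamental matrix of a linear system with polynomial coefficients, and its
inverse. -/
theorem exists_fundamental_matrix {C : ℕ → Matrix (Fin n) (Fin n) A} {N : ℕ}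
    (hC : ∀ r, N ≤ r → C r = 0) :
    ∃ Y Z : ℂ → Matrix (Fin n) (Fin n) A,
      (∀ t, HasDerivAt Y ((∑ r ∈ Finset.range N, t ^ r • C r) * Y t) t) ∧
      (∀ t, HasDerivAt Z (-(Z t * ∑ r ∈ Finset.range N, t ^ r • C r)) t) ∧
      ∀ t, Y t * Z t = 1 ∧ Z t * Y t = 1 := by
  obtain ⟨Y, hY0, hY⟩ := exists_entire_solution
    (T := fun r => ContinuousLinearMap.mul ℂ (Matrix (Fin n) (Fin n) A) (C r)) (N := N)
    (fun r hr => by rw [hC r hr, map_zero]) 1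
  obtain ⟨Z, hZ0, hZ⟩ := exists_entire_solution
    (T := fun r => (ContinuousLinearMap.mul ℂ (Matrix (Fin n) (Fin n) A)).flip (-C r)) (N := N)
    (fun r hr => by rw [hC r hr, neg_zero, map_zero]) 1
  have hY' : ∀ t, HasDerivAt Y ((∑ r ∈ Finset.range N, t ^ r • C r) * Y t) t := fun t => by
    convert! hY t using 1
    simp [Finset.sum_mul]
  have hZ' : ∀ t, HasDerivAt Z (-(Z t * ∑ r ∈ Finset.range N, t ^ r • C r)) t := fun t => by
    convert! hZ t using 1
    simp [Finset.mul_sum]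
  -- `(ZY)' = -ZCY + ZCY = 0`. The other order follows because one-sided inverses of square matrices
  -- over a commutative ring are two-sided.
  have hconst : ∀ t, Z t * Y t = 1 := fun t => by
    have hd : ∀ t, HasDerivAt (fun t => Z t * Y t) 0 t := fun t => by
      convert! (hZ' t).mul (hY' t) using 1
      noncomm_ring
    have := is_const_of_deriv_eq_zero (fun t => (hd t).differentiableAt)
      (fun t => (hd t).deriv) t 0
    simpa [hY0, hZ0] using this
  exact ⟨Y, Z, hY', hZ', fun t => ⟨mul_eq_one_comm.1 (hconst t), hconst t⟩⟩

end Fundamental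

end Heis

end

noncomputable section

namespace Heis

open MeasureTheory Set Filter Topology

/-! ### Cones and first-order linear equations on them -/

/-- The open cone with apex `x₀` and slope `s` around the positive real direction. -/
def cone (s x₀ : ℝ) : Set ℂ := {w | |w.im| < s * (w.re - x₀)}

lemma isOpen_cone (s x₀ : ℝ) : IsOpen (cone s x₀) :=
  isOpen_lt (by fun_prop) (by fun_prop)

lemma convex_cone (s x₀ : ℝ) : Convex ℝ (cone s x₀) := by
  intro z hz w hw a b ha hb hab
  simp only [cone, mem_ofPred_eq, Complex.add_im, Complex.add_re, Complex.real_smul,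
    Complex.mul_im, Complex.mul_re, Complex.ofReal_re, Complex.ofReal_im, zero_mul, add_zero,
    sub_zero] at *
  rcases ha.eq_or_lt with rfl | ha
  · obtain rfl : b = 1 := by linarith
    simpa using hw
  · rw [abs_lt] at *
    have e : s * (a * z.re + b * w.re - x₀) = a * (s * (z.re - x₀)) + b * (s * (w.re - x₀)) := by
      have : x₀ = (a + b) * x₀ := by rw [hab, one_mul]
      linear_combination (-s) * this
    rw [e]
    constructor <;> nlinarith

lemma cone_re {s x₀ : ℝ} (hs : 0 < s) {w : ℂ} (hw : w ∈ cone s x₀) : x₀ < w.re := by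
  have h : 0 < s * (w.re - x₀) := (abs_nonneg _).trans_lt hw
  have := pos_of_mul_pos_right h hs.le
  linarith

/-- Keeps the rays used for integration from infinity inside the cone. -/
lemma cone_add {s x₀ η σ : ℝ} (hη : |η| ≤ s) (hσ : 0 ≤ σ) {w : ℂ} (hw : w ∈ cone s x₀) :
    w + σ * (1 + η * Complex.I) ∈ cone s x₀ := by
  simp only [cone, mem_ofPred_eq] at *
  simp only [Complex.add_im, Complex.add_re, Complex.mul_im, Complex.mul_re, Complex.ofReal_re,
    Complex.ofReal_im, Complex.I_re, Complex.I_im, Complex.one_re, Complex.one_im]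
  rw [abs_lt] at *
  rw [abs_le] at hη
  constructor <;> nlinarith

/-- Keeps the segments used for integration from the apex inside the cone; the apex itself (`σ = 0`)
is excluded. -/
lemma cone_tip {s x₀ σ : ℝ} (hσ : 0 < σ) {w : ℂ} (hw : w ∈ cone s x₀) :
    (x₀ : ℂ) + σ * (w - x₀) ∈ cone s x₀ := by
  simp only [cone, mem_ofPred_eq] at *
  simp only [Complex.add_im, Complex.add_re, Complex.mul_im, Complex.mul_re, Complex.ofReal_re,
    Complex.ofReal_im, Complex.sub_re, Complex.sub_im]
  have e : s * (x₀ + (σ * (w.re - x₀) - 0 * (w.im - 0)) - x₀) = σ * (s * (w.re - x₀)) := by ring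
  rw [e, show 0 + (σ * (w.im - 0) + 0 * (w.re - x₀)) = σ * w.im by ring, abs_mul, abs_of_pos hσ]
  exact mul_lt_mul_of_pos_left hw hσ

lemma cone_norm_sub_le {s x₀ : ℝ} (hs : 0 < s) (hs1 : s ≤ 1) {w : ℂ} (hw : w ∈ cone s x₀) :
    ‖w - x₀‖ ≤ 2 * (w.re - x₀) := by
  have h1 := Complex.norm_le_abs_re_add_abs_im (w - x₀)
  have h2 := cone_re hs hw
  simp only [cone, mem_ofPred_eq] at hw
  simp only [Complex.sub_re, Complex.ofReal_re, Complex.sub_im, Complex.ofReal_im, sub_zero] at h1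
  rw [abs_of_pos (by linarith : 0 < w.re - x₀)] at h1
  nlinarith

/-- A dominated parameter integral of holomorphic functions is holomorphic. -/
lemma hasDerivAt_integral_of_bounded {E : Type*} [NormedAddCommGroup E] [NormedSpace ℂ E]
    [CompleteSpace E] {μ : Measure ℝ} {W : Set ℂ} (hW : IsOpen W) {k k' : ℂ → ℝ → E}
    {b : ℝ → ℝ} (hb : Integrable b μ) (hk : ∀ w ∈ W, AEStronglyMeasurable (k w) μ)
    (hk' : ∀ w ∈ W, AEStronglyMeasurable (k' w) μ)
    (hder : ∀ᵐ σ ∂μ, ∀ w ∈ W, HasDerivAt (fun z => k z σ) (k' w σ) w)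
    (hbd : ∀ᵐ σ ∂μ, ∀ w ∈ W, ‖k w σ‖ ≤ b σ) {w : ℂ} (hw : w ∈ W) :
    Integrable (k' w) μ ∧ HasDerivAt (fun z => ∫ σ, k z σ ∂μ) (∫ σ, k' w σ ∂μ) w := by
  obtain ⟨r, hr, hrW⟩ := Metric.isOpen_iff.1 hW w hw
  have hr2 : 0 < r / 2 := by positivity
  have hsub : ∀ z ∈ Metric.ball w (r / 2), Metric.closedBall z (r / 4) ⊆ W := fun z hz y hy =>
    hrW (by
      rw [Metric.mem_ball] at *
      rw [Metric.mem_closedBall] at hy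
      linarith [dist_triangle y z w])
  refine hasDerivAt_integral_of_dominated_loc_of_deriv_le (s := Metric.ball w (r / 2))
    (bound := fun σ => b σ / (r / 4)) (Metric.ball_mem_nhds _ hr2) ?_ ?_ (hk' w hw) ?_
    (hb.div_const _) ?_
  · filter_upwards [hW.mem_nhds hw] with z hz using hk z hz
  · exact hb.mono' (hk w hw) (by filter_upwards [hbd] with σ h using h w hw)
  -- Cauchy's estimate on circles of radius `r / 4` dominates `k'` by the bound on `k`, so none on
  -- `k'` has to be supplied.
  · filter_upwards [hder, hbd] with σ h1 h2 z hz
    have hz' := hsub z hz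
    rw [← (h1 z (hz' (Metric.mem_closedBall_self (by positivity)))).deriv]
    refine Complex.norm_deriv_le_of_forall_mem_sphere_norm_le (by positivity) ?_ ?_
    · refine DifferentiableOn.diffContOnCl fun y hy => ?_
      rw [closure_ball _ (by positivity)] at hy
      exact (h1 y (hz' hy)).differentiableAt.differentiableWithinAt
    · exact fun y hy => h2 y (hz' (Metric.sphere_subset_closedBall hy))
  · filter_upwards [hder] with σ h z hz
    exact h z (hsub z hz (Metric.mem_closedBall_self (by positivity)))

/-! ### Scalar equations on a cone with values in a Banach algebra -/

section Solve

variable {A : Type*} [NormedCommRing A] [NormedAlgebra ℂ A] [CompleteSpace A]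

open NormedSpace (exp)

lemma hasDerivAt_exp_comp {G : ℂ → A} {g : A} {w : ℂ} (h : HasDerivAt G g w) :
    HasDerivAt (fun z => exp (G z)) (exp (G w) * g) w := by
  simpa [Function.comp_def] using (hasFDerivAt_exp (𝕂 := ℂ) (x := G w)).comp_hasDerivAt w h

lemma exp_sub_of_complex (a b : A) : exp (a - b) = exp a * exp (-b) := by
  let _ : NormedAlgebra ℚ A := NormedAlgebra.restrictScalars ℚ ℂ A
  rw [sub_eq_add_neg, NormedSpace.exp_add]

lemma exp_mul_exp_neg (a : A) : exp a * exp (-a) = 1 := by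
  let _ : NormedAlgebra ℚ A := NormedAlgebra.restrictScalars ℚ ℂ A
  rw [← exp_sub_of_complex, sub_self, NormedSpace.exp_zero]

lemma hasDerivAt_exp_comp_real {G : ℝ → A} {g : A} {w : ℝ} (h : HasDerivAt G g w) :
    HasDerivAt (fun z => exp (G z)) (exp (G w) * g) w := by
  let _ : NormedAlgebra ℝ A := NormedAlgebra.restrictScalars ℝ ℂ A
  simpa [Function.comp_def] using (hasFDerivAt_exp (𝕂 := ℝ) (x := G w)).comp_hasDerivAt w h

/-- The exponential of a small perturbation of a scalar with sufficiently negative real part. -/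
lemma norm_exp_le_one [NormOneClass A] {z : ℂ} {a : A} {c : ℝ} (hz : z.re ≤ -c)
    (ha : ‖a - algebraMap ℂ A z‖ ≤ c) : ‖exp a‖ ≤ 1 := by
  let _ : NormedAlgebra ℚ A := NormedAlgebra.restrictScalars ℚ ℂ A
  have e : a = algebraMap ℂ A z + (a - algebraMap ℂ A z) := by ring
  have hsum : ‖exp (a - algebraMap ℂ A z)‖ ≤ Real.exp ‖a - algebraMap ℂ A z‖ := by
    rw [NormedSpace.exp_eq_tsum ℂ, Real.exp_eq_exp_ℝ, NormedSpace.exp_eq_tsum ℝ]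
    refine tsum_of_norm_bounded (NormedSpace.expSeries_summable' (𝕂 := ℝ) _).hasSum fun i => ?_
    rw [norm_smul]
    simp only [norm_inv, Complex.norm_natCast, smul_eq_mul]
    exact mul_le_mul_of_nonneg_left (norm_pow_le _ _) (by positivity)
  rw [e, NormedSpace.exp_add, ← NormedSpace.algebraMap_exp_comm (𝕂 := ℂ), ← Complex.exp_eq_exp_ℂ]
  refine (norm_mul_le _ _).trans ?_
  rw [norm_algebraMap', Complex.norm_exp]
  calc Real.exp z.re * ‖exp (a - algebraMap ℂ A z)‖ ≤ Real.exp (-c) * Real.exp c :=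
        mul_le_mul (Real.exp_le_exp.2 hz) (hsum.trans (Real.exp_le_exp.2 ha)) (norm_nonneg _)
          (Real.exp_pos _).le
    _ = 1 := by rw [← Real.exp_add]; simp

variable {s x₀ : ℝ} {G g f : ℂ → A} {M : ℝ}

/-- The equation `v' = g v + f` on a cone, integrated from infinity. -/
lemma exists_solution_of_ray (hs : 0 < s) (hs1 : s ≤ 1) (hx₀ : 0 < x₀) {η : ℝ} (hη : |η| ≤ s)
    (hG : ∀ w ∈ cone s x₀, HasDerivAt G (g w) w) (hg : DifferentiableOn ℂ g (cone s x₀))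
    (hf : DifferentiableOn ℂ f (cone s x₀)) (hM : 0 ≤ M)
    (hfM : ∀ w ∈ cone s x₀, ‖f w‖ ≤ M * w.re ^ (-(3 / 2) : ℝ))
    (hexp : ∀ w ∈ cone s x₀, ∀ σ : ℝ, 0 ≤ σ → ‖exp (G w - G (w + σ * (1 + η * Complex.I)))‖ ≤ 1) :
    ∃ v : ℂ → A, (∀ w ∈ cone s x₀, HasDerivAt v (g w * v w + f w) w) ∧
      ∀ w ∈ cone s x₀, ‖v w‖ ≤ 4 * M * x₀ ^ (-(1 / 2) : ℝ) := by
  set d : ℂ := 1 + η * Complex.I with hd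
  have hdre : ∀ (w : ℂ) (σ : ℝ), (w + σ * d).re = w.re + σ := by intro w σ; simp [hd]
  have hmem : ∀ w ∈ cone s x₀, ∀ σ : ℝ, 0 ≤ σ → w + σ * d ∈ cone s x₀ := fun w hw σ hσ =>
    cone_add hη hσ hw
  -- Variation of constants along the ray gives `v = -d ∫ k`. With this `m`, `∂k/∂w = g k + m` and
  -- `∂k/∂σ = d m`, so `d ∫ m = -k(w, 0) = -f(w)` and `v' = g v + f`.
  set m : ℂ → ℝ → A := fun w σ => exp (G w - G (w + σ * d)) *
    (deriv f (w + σ * d) - g (w + σ * d) * f (w + σ * d)) with hm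
  set k : ℂ → ℝ → A := fun w σ => exp (G w - G (w + σ * d)) * f (w + σ * d) with hk
  have hopen := isOpen_cone s x₀
  have hf' : ∀ w ∈ cone s x₀, HasDerivAt f (deriv f w) w := fun w hw =>
    (hf.differentiableAt (hopen.mem_nhds hw)).hasDerivAt
  have hline : ∀ (w : ℂ) (σ : ℝ), HasDerivAt (fun τ : ℝ => w + τ * d) d σ := fun w σ => by
    simpa using ((Complex.ofRealCLM.hasDerivAt (x := σ)).mul_const d).const_add w
  have hkw : ∀ w ∈ cone s x₀, ∀ σ : ℝ, 0 ≤ σ →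
      HasDerivAt (fun z => k z σ) (g w * k w σ + m w σ) w := by
    intro w hw σ hσ
    have hsh : HasDerivAt (fun z : ℂ => z + σ * d) 1 w := (hasDerivAt_id w).add_const _
    have h1 := (hG _ (hmem w hw σ hσ)).scomp w hsh
    have h2 := (hf' _ (hmem w hw σ hσ)).scomp w hsh
    have h3 := (hasDerivAt_exp_comp ((hG w hw).sub h1)).mul h2
    convert! h3 using 1
    simp only [hk, hm, Function.comp_apply, Pi.sub_apply, one_smul]
    ring
  have hkσ : ∀ w ∈ cone s x₀, ∀ σ : ℝ, 0 ≤ σ → HasDerivAt (k w) (d • m w σ) σ := by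
    intro w hw σ hσ
    have h1 := (hG _ (hmem w hw σ hσ)).scomp σ (hline w σ)
    have h2 := (hf' _ (hmem w hw σ hσ)).scomp σ (hline w σ)
    have h3 := (hasDerivAt_exp_comp_real (h1.const_sub (G w))).mul h2
    convert! h3 using 1
    simp only [hm, Function.comp_apply, Algebra.smul_def]
    ring
  have hmcont : ∀ w ∈ cone s x₀, ContinuousOn (m w) (Ici 0) := by
    intro w hw σ hσ
    have hl : ContinuousAt (fun τ : ℝ => w + τ * d) σ := (hline w σ).continuousAt
    have hn := hopen.mem_nhds (hmem w hw σ hσ)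
    have c1 : ContinuousAt (fun τ : ℝ => G (w + τ * d)) σ :=
      ContinuousAt.comp (g := G) (hG _ (hmem w hw σ hσ)).continuousAt hl
    have c2 : ContinuousAt (fun τ : ℝ => f (w + τ * d)) σ :=
      ContinuousAt.comp (g := f) (hf' _ (hmem w hw σ hσ)).continuousAt hl
    have c3 : ContinuousAt (fun τ : ℝ => g (w + τ * d)) σ :=
      ContinuousAt.comp (g := g) (hg.differentiableAt hn).continuousAt hl
    have c4 : ContinuousAt (fun τ : ℝ => deriv f (w + τ * d)) σ :=
      ContinuousAt.comp (g := deriv f)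
        ((hf.deriv hopen).differentiableAt hn).continuousAt hl
    have c5 : ContinuousAt (fun τ : ℝ => exp (G w - G (w + τ * d))) σ :=
      ContinuousAt.comp (g := fun x : A => exp x)
        (hasFDerivAt_exp (𝕂 := ℂ)).continuousAt (continuousAt_const.sub c1)
    exact (c5.mul (c4.sub (c3.mul c2))).continuousWithinAt
  have hkcont : ∀ w ∈ cone s x₀, ContinuousOn (k w) (Ici 0) := fun w hw σ hσ =>
    (hkσ w hw σ hσ).continuousAt.continuousWithinAt
  set b : ℝ → ℝ := fun σ => M * (x₀ + σ) ^ (-(3 / 2) : ℝ) with hbdef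
  have hkb : ∀ w ∈ cone s x₀, ∀ σ : ℝ, 0 ≤ σ → ‖k w σ‖ ≤ b σ := by
    intro w hw σ hσ
    calc ‖k w σ‖ ≤ 1 * ‖f (w + σ * d)‖ :=
          (norm_mul_le _ _).trans (mul_le_mul_of_nonneg_right (hexp w hw σ hσ) (norm_nonneg _))
      _ ≤ M * (w.re + σ) ^ (-(3 / 2) : ℝ) := by
          rw [one_mul, ← hdre]; exact hfM _ (hmem w hw σ hσ)
      _ ≤ b σ := by
          have := cone_re hs hw
          exact mul_le_mul_of_nonneg_left
            (Real.rpow_le_rpow_of_nonpos (by linarith) (by linarith) (by norm_num)) hM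
  have hint : Integrable b (volume.restrict (Ioi 0)) ∧
      ∫ σ in Ioi 0, b σ = M * (2 * x₀ ^ (-(1 / 2) : ℝ)) := by
    have e1 : ∀ σ ∈ Ici (0 : ℝ),
        HasDerivAt (fun σ => M * (-2 * (x₀ + σ) ^ (-(1 / 2) : ℝ))) (b σ) σ := by
      intro σ hσ
      have hσ' : 0 ≤ σ := hσ
      have := (((hasDerivAt_id σ).const_add x₀).rpow_const (p := (-(1 / 2) : ℝ))
        (Or.inl (by simp; positivity))).const_mul (-2 : ℝ) |>.const_mul M
      convert! this using 1
      simp only [hbdef, id]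
      rw [show (-(3 / 2) : ℝ) = -(1 / 2) - 1 by norm_num]
      ring
    have e2 : Tendsto (fun σ => M * (-2 * (x₀ + σ) ^ (-(1 / 2) : ℝ))) atTop
        (𝓝 (M * (-2 * 0))) := by
      refine ((Tendsto.const_mul (-2 : ℝ) ?_).const_mul M)
      exact (tendsto_rpow_neg_atTop (by norm_num : (0 : ℝ) < 1 / 2)).comp
        (tendsto_atTop_add_const_left _ _ tendsto_id)
    have e3 : ∀ σ ∈ Ioi (0 : ℝ), 0 ≤ b σ := fun σ hσ =>
      mul_nonneg hM (Real.rpow_nonneg (by linarith [mem_Ioi.1 hσ]) _)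
    refine ⟨integrableOn_Ioi_deriv_of_nonneg' e1 e3 e2, ?_⟩
    rw [integral_Ioi_of_hasDerivAt_of_nonneg' e1 e3 e2]
    simp
  have hpar : ∀ w ∈ cone s x₀, Integrable (fun σ => g w * k w σ + m w σ) (volume.restrict (Ioi 0)) ∧
      HasDerivAt (fun z => ∫ σ in Ioi 0, k z σ) (∫ σ in Ioi 0, (g w * k w σ + m w σ)) w := by
    intro w hw
    refine hasDerivAt_integral_of_bounded hopen (k' := fun w σ => g w * k w σ + m w σ) hint.1
      ?_ ?_ ?_ ?_ hw
    · exact fun z hz => ((hkcont z hz).mono Ioi_subset_Ici_self).aestronglyMeasurable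
        measurableSet_Ioi
    · exact fun z hz => (((continuousOn_const.mul (hkcont z hz)).add (hmcont z hz)).mono
        Ioi_subset_Ici_self).aestronglyMeasurable measurableSet_Ioi
    · filter_upwards [ae_restrict_mem measurableSet_Ioi] with σ hσ z hz
      exact hkw z hz σ (le_of_lt hσ)
    · filter_upwards [ae_restrict_mem measurableSet_Ioi] with σ hσ z hz
      exact hkb z hz σ (le_of_lt hσ)
  have hkint : ∀ w ∈ cone s x₀, Integrable (k w) (volume.restrict (Ioi 0)) := fun w hw =>
    hint.1.mono' (((hkcont w hw).mono Ioi_subset_Ici_self).aestronglyMeasurable measurableSet_Ioi)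
      (by filter_upwards [ae_restrict_mem measurableSet_Ioi] with σ hσ using hkb w hw σ (le_of_lt hσ))
  refine ⟨fun w => -(d • ∫ σ in Ioi 0, k w σ), fun w hw => ?_, fun w hw => ?_⟩
  · obtain ⟨h1, h2⟩ := hpar w hw
    have hmint : Integrable (m w) (volume.restrict (Ioi 0)) := by
      have := h1.sub ((hkint w hw).const_mul (g w))
      refine this.congr (Eventually.of_forall fun σ => ?_)
      simp
    have hlim : Tendsto (k w) atTop (𝓝 0) := by
      refine squeeze_zero_norm' (a := b) ?_ ?_
      · filter_upwards [eventually_ge_atTop 0] with σ hσ using hkb w hw σ hσ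
      · rw [← mul_zero M]
        exact Tendsto.const_mul M ((tendsto_rpow_neg_atTop (by norm_num : (0 : ℝ) < 3 / 2)).comp
          (tendsto_atTop_add_const_left _ _ tendsto_id))
    have hFT := integral_Ioi_of_hasDerivAt_of_tendsto (hkcont w hw 0 self_mem_Ici)
      (fun σ hσ => hkσ w hw σ (le_of_lt hσ)) (hmint.smul d) hlim
    have h3 := (h2.const_smul d).neg
    convert! h3 using 1
    rw [integral_add ((hkint w hw).const_mul (g w)) hmint, smul_add, ← integral_smul d (m w), hFT,
      integral_const_mul_of_integrable (hkint w hw)]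
    simp [hk, add_comm]
  · rw [norm_neg, norm_smul]
    -- The constant `4` is this `2` times the `2` from `∫ (x₀ + σ)^{-3/2} = 2 x₀^{-1/2}`.
    have hd2 : ‖d‖ ≤ 2 := by
      refine (norm_add_le _ _).trans ?_
      simp only [norm_one, norm_mul, Complex.norm_real, Complex.norm_I, mul_one, Real.norm_eq_abs]
      linarith
    calc ‖d‖ * ‖∫ σ in Ioi 0, k w σ‖ ≤ 2 * (M * (2 * x₀ ^ (-(1 / 2) : ℝ))) := by
          refine mul_le_mul hd2 ?_ (norm_nonneg _) (by norm_num)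
          rw [← hint.2]
          exact norm_integral_le_of_norm_le hint.1 (by
            filter_upwards [ae_restrict_mem measurableSet_Ioi] with σ hσ
              using hkb w hw σ (le_of_lt hσ))
      _ = _ := by ring

/-- The equation `v' = g v + f` on a cone, integrated from its apex. -/
lemma exists_solution_of_apex (hs : 0 < s) (hs1 : s ≤ 1) (hx₀ : 0 < x₀)
    (hG : ∀ w ∈ cone s x₀, HasDerivAt G (g w) w) (hg : DifferentiableOn ℂ g (cone s x₀))
    (hf : DifferentiableOn ℂ f (cone s x₀)) (hM : 0 ≤ M)
    (hfM : ∀ w ∈ cone s x₀, ‖f w‖ ≤ M * w.re ^ (-(3 / 2) : ℝ))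
    (hexp : ∀ w ∈ cone s x₀, ∀ σ : ℝ, 0 < σ → σ ≤ 1 → ‖exp (G w - G (x₀ + σ * (w - x₀)))‖ ≤ 1) :
    ∃ v : ℂ → A, (∀ w ∈ cone s x₀, HasDerivAt v (g w * v w + f w) w) ∧
      ∀ w ∈ cone s x₀, ‖v w‖ ≤ 4 * M * x₀ ^ (-(1 / 2) : ℝ) := by
  have hre : ∀ (w : ℂ) (σ : ℝ), ((x₀ : ℂ) + σ * (w - x₀)).re = x₀ + σ * (w.re - x₀) := by
    intro w σ; simp
  have hmem : ∀ w ∈ cone s x₀, ∀ σ : ℝ, 0 < σ → (x₀ : ℂ) + σ * (w - x₀) ∈ cone s x₀ :=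
    fun w hw σ hσ => cone_tip hσ hw
  -- Here `v = (w - x₀) ∫₀¹ k`, with `∂k/∂w = g k + σ m` and `∂k/∂σ = (w - x₀) m`. Hence `∂(σ k)/∂σ
  -- = k + (w - x₀) σ m` integrates to `k(w, 1) = f(w)`, which is the inhomogeneous term of `v'`.
  set m : ℂ → ℝ → A := fun w σ => exp (G w - G (x₀ + σ * (w - x₀))) *
    (deriv f (x₀ + σ * (w - x₀)) - g (x₀ + σ * (w - x₀)) * f (x₀ + σ * (w - x₀))) with hm
  set k : ℂ → ℝ → A := fun w σ => exp (G w - G (x₀ + σ * (w - x₀))) * f (x₀ + σ * (w - x₀)) with hk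
  have hopen := isOpen_cone s x₀
  have hf' : ∀ w ∈ cone s x₀, HasDerivAt f (deriv f w) w := fun w hw =>
    (hf.differentiableAt (hopen.mem_nhds hw)).hasDerivAt
  have hline : ∀ (w : ℂ) (σ : ℝ),
      HasDerivAt (fun τ : ℝ => (x₀ : ℂ) + τ * (w - x₀)) (w - x₀) σ := fun w σ => by
    simpa using ((Complex.ofRealCLM.hasDerivAt (x := σ)).mul_const (w - x₀)).const_add (x₀ : ℂ)
  have hkw : ∀ w ∈ cone s x₀, ∀ σ : ℝ, 0 < σ →
      HasDerivAt (fun z => k z σ) (g w * k w σ + (σ : ℂ) • m w σ) w := by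
    intro w hw σ hσ
    have hsh : HasDerivAt (fun z : ℂ => (x₀ : ℂ) + σ * (z - x₀)) σ w := by
      simpa using (((hasDerivAt_id w).sub_const (x₀ : ℂ)).const_mul (σ : ℂ)).const_add (x₀ : ℂ)
    have h1 := (hG _ (hmem w hw σ hσ)).scomp w hsh
    have h2 := (hf' _ (hmem w hw σ hσ)).scomp w hsh
    have h3 := (hasDerivAt_exp_comp ((hG w hw).sub h1)).mul h2
    convert! h3 using 1
    simp only [hk, hm, Function.comp_apply, Pi.sub_apply]
    simp only [Algebra.smul_def]
    ring
  have hkσ : ∀ w ∈ cone s x₀, ∀ σ : ℝ, 0 < σ → HasDerivAt (k w) ((w - x₀) • m w σ) σ := by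
    intro w hw σ hσ
    have h1 := (hG _ (hmem w hw σ hσ)).scomp σ (hline w σ)
    have h2 := (hf' _ (hmem w hw σ hσ)).scomp σ (hline w σ)
    have h3 := (hasDerivAt_exp_comp_real (h1.const_sub (G w))).mul h2
    convert! h3 using 1
    simp only [hm, Function.comp_apply, Algebra.smul_def]
    ring
  have hmcont : ∀ w ∈ cone s x₀, ContinuousOn (m w) (Ioi 0) := by
    intro w hw σ hσ
    have hl : ContinuousAt (fun τ : ℝ => (x₀ : ℂ) + τ * (w - x₀)) σ := (hline w σ).continuousAt
    have hn := hopen.mem_nhds (hmem w hw σ hσ)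
    have c1 : ContinuousAt (fun τ : ℝ => G (x₀ + τ * (w - x₀))) σ :=
      ContinuousAt.comp (g := G) (hG _ (hmem w hw σ hσ)).continuousAt hl
    have c2 : ContinuousAt (fun τ : ℝ => f (x₀ + τ * (w - x₀))) σ :=
      ContinuousAt.comp (g := f) (hf' _ (hmem w hw σ hσ)).continuousAt hl
    have c3 : ContinuousAt (fun τ : ℝ => g (x₀ + τ * (w - x₀))) σ :=
      ContinuousAt.comp (g := g) (hg.differentiableAt hn).continuousAt hl
    have c4 : ContinuousAt (fun τ : ℝ => deriv f (x₀ + τ * (w - x₀))) σ :=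
      ContinuousAt.comp (g := deriv f)
        ((hf.deriv hopen).differentiableAt hn).continuousAt hl
    have c5 : ContinuousAt (fun τ : ℝ => exp (G w - G (x₀ + τ * (w - x₀)))) σ :=
      ContinuousAt.comp (g := fun x : A => exp x)
        (hasFDerivAt_exp (𝕂 := ℂ)).continuousAt (continuousAt_const.sub c1)
    exact (c5.mul (c4.sub (c3.mul c2))).continuousWithinAt
  have hkcont : ∀ w ∈ cone s x₀, ContinuousOn (k w) (Ioi 0) := fun w hw σ hσ =>
    (hkσ w hw σ hσ).continuousAt.continuousWithinAt
  have hkb : ∀ w ∈ cone s x₀, ∀ σ : ℝ, 0 < σ → σ ≤ 1 →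
      ‖k w σ‖ ≤ M * (x₀ + σ * (w.re - x₀)) ^ (-(3 / 2) : ℝ) := by
    intro w hw σ hσ hσ1
    calc ‖k w σ‖ ≤ 1 * ‖f (x₀ + σ * (w - x₀))‖ :=
          (norm_mul_le _ _).trans (mul_le_mul_of_nonneg_right (hexp w hw σ hσ hσ1) (norm_nonneg _))
      _ ≤ _ := by rw [one_mul, ← hre]; exact hfM _ (hmem w hw σ hσ)
  have hkb' : ∀ w ∈ cone s x₀, ∀ σ : ℝ, 0 < σ → σ ≤ 1 → ‖k w σ‖ ≤ M * x₀ ^ (-(3 / 2) : ℝ) := by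
    intro w hw σ hσ hσ1
    refine (hkb w hw σ hσ hσ1).trans (mul_le_mul_of_nonneg_left ?_ hM)
    have := cone_re hs hw
    exact Real.rpow_le_rpow_of_nonpos hx₀ (by nlinarith) (by norm_num)
  have hIoc : Integrable (fun _ : ℝ => M * x₀ ^ (-(3 / 2) : ℝ)) (volume.restrict (Ioc (0 : ℝ) 1)) :=
    integrable_const _
  have hpos : Ioc (0 : ℝ) 1 ⊆ Ioi 0 := fun σ hσ => hσ.1
  have hpar : ∀ w ∈ cone s x₀,
      Integrable (fun σ : ℝ => g w * k w σ + (σ : ℂ) • m w σ) (volume.restrict (Ioc 0 1)) ∧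
      HasDerivAt (fun z => ∫ σ in Ioc 0 1, k z σ)
        (∫ σ in Ioc (0 : ℝ) 1, (g w * k w σ + (σ : ℂ) • m w σ)) w := by
    intro w hw
    refine hasDerivAt_integral_of_bounded hopen
      (k' := fun w (σ : ℝ) => g w * k w σ + (σ : ℂ) • m w σ) hIoc ?_ ?_ ?_ ?_ hw
    · exact fun z hz => ((hkcont z hz).mono hpos).aestronglyMeasurable measurableSet_Ioc
    · exact fun z hz => (((continuousOn_const.mul (hkcont z hz)).add
        (Complex.continuous_ofReal.continuousOn.smul (hmcont z hz))).mono
        hpos).aestronglyMeasurable measurableSet_Ioc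
    · filter_upwards [ae_restrict_mem measurableSet_Ioc] with σ hσ z hz
      exact hkw z hz σ hσ.1
    · filter_upwards [ae_restrict_mem measurableSet_Ioc] with σ hσ z hz
      exact hkb' z hz σ hσ.1 hσ.2
  have hkint : ∀ w ∈ cone s x₀, Integrable (k w) (volume.restrict (Ioc 0 1)) := fun w hw =>
    hIoc.mono' (((hkcont w hw).mono hpos).aestronglyMeasurable measurableSet_Ioc)
      (by filter_upwards [ae_restrict_mem measurableSet_Ioc] with σ hσ using hkb' w hw σ hσ.1 hσ.2)
  refine ⟨fun w => (w - x₀) • ∫ σ in Ioc (0 : ℝ) 1, k w σ, fun w hw => ?_, fun w hw => ?_⟩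
  · obtain ⟨h1, h2⟩ := hpar w hw
    have hmint : Integrable (fun σ : ℝ => (σ : ℂ) • m w σ) (volume.restrict (Ioc 0 1)) := by
      have := h1.sub ((hkint w hw).const_mul (g w))
      refine this.congr (Eventually.of_forall fun σ => ?_)
      simp
    have hder : ∀ σ ∈ Ioo (0 : ℝ) 1, HasDerivAt (fun σ : ℝ => (σ : ℂ) • k w σ)
        (k w σ + (w - x₀) • ((σ : ℂ) • m w σ)) σ := by
      intro σ hσ
      have := (Complex.ofRealCLM.hasDerivAt (x := σ)).smul (hkσ w hw σ hσ.1)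
      convert! this using 1
      simp only [Complex.ofRealCLM_apply, Complex.ofReal_one, one_smul, smul_smul, mul_comm, add_comm]
    -- At `σ = 0` the point is the apex, where nothing is assumed about `G` or `f`; the factor `σ`
    -- and the bound on `k` still give continuity.
    have hcont : ContinuousOn (fun σ : ℝ => (σ : ℂ) • k w σ) (Icc 0 1) := by
      intro σ hσ
      rcases hσ.1.eq_or_lt with rfl | h0
      · rw [ContinuousWithinAt, Complex.ofReal_zero, zero_smul]
        refine squeeze_zero_norm' (a := fun σ : ℝ => |σ| * (M * x₀ ^ (-(3 / 2) : ℝ))) ?_ ?_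
        · filter_upwards [self_mem_nhdsWithin] with σ hσ
          rw [norm_smul, Complex.norm_real, Real.norm_eq_abs]
          rcases hσ.1.eq_or_lt with rfl | h0
          · simp
          · exact mul_le_mul_of_nonneg_left (hkb' w hw σ h0 hσ.2) (abs_nonneg _)
        · have : Continuous fun σ : ℝ => |σ| * (M * x₀ ^ (-(3 / 2) : ℝ)) := by fun_prop
          simpa using (this.tendsto 0).mono_left nhdsWithin_le_nhds
      · exact (Complex.continuous_ofReal.continuousAt.smul
          (hkσ w hw σ h0).continuousAt).continuousWithinAt
    have hint2 : Integrable (fun σ : ℝ => k w σ + (w - x₀) • ((σ : ℂ) • m w σ))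
        (volume.restrict (Ioc 0 1)) := (hkint w hw).add (hmint.smul (w - x₀ : ℂ))
    have hFT := intervalIntegral.integral_eq_sub_of_hasDerivAt_of_le zero_le_one hcont hder
      ((intervalIntegrable_iff_integrableOn_Ioc_of_le zero_le_one).2 hint2)
    rw [intervalIntegral.integral_of_le zero_le_one,
      integral_add (g := fun σ : ℝ => (w - (x₀ : ℂ)) • ((σ : ℂ) • m w σ)) (hkint w hw)
        (hmint.smul (w - x₀ : ℂ)), integral_smul] at hFT
    have h3 := ((hasDerivAt_id w).sub_const (x₀ : ℂ)).smul h2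
    convert! h3 using 1
    rw [integral_add ((hkint w hw).const_mul (g w)) hmint,
      integral_const_mul_of_integrable (hkint w hw)]
    simp only [id, smul_add, one_smul, mul_smul_comm]
    rw [add_assoc, add_comm ((w - (x₀ : ℂ)) • ∫ σ in Ioc (0 : ℝ) 1, (σ : ℂ) • m w σ), hFT]
    simp [hk]
  · have hw0 := cone_re hs hw
    have ha : 0 < w.re - x₀ := by linarith
    -- The factor `1 / (Re w - x₀)` of the primitive is absorbed by `|w - x₀| ≤ 2 (Re w - x₀)`, so
    -- the final bound does not depend on `w`.
    have e1 : ∀ σ ∈ uIcc (0 : ℝ) 1,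
        HasDerivAt (fun σ => M * (-2 / (w.re - x₀) * (x₀ + σ * (w.re - x₀)) ^ (-(1 / 2) : ℝ)))
          (M * (x₀ + σ * (w.re - x₀)) ^ (-(3 / 2) : ℝ)) σ := by
      intro σ hσ
      rw [uIcc_of_le zero_le_one] at hσ
      have hpos : x₀ + σ * (w.re - x₀) ≠ 0 := by nlinarith [hσ.1, mul_nonneg hσ.1 ha.le]
      have := (((((hasDerivAt_id σ).mul_const (w.re - x₀)).const_add x₀).rpow_const
        (p := (-(1 / 2) : ℝ)) (Or.inl hpos)).const_mul (-2 / (w.re - x₀))).const_mul M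
      convert! this using 1
      simp only [id]
      norm_num
      field_simp
    have e2 : IntervalIntegrable (fun σ : ℝ => M * (x₀ + σ * (w.re - x₀)) ^ (-(3 / 2) : ℝ))
        volume 0 1 := by
      refine ContinuousOn.intervalIntegrable fun σ hσ => ?_
      rw [uIcc_of_le zero_le_one] at hσ
      have hpos : x₀ + σ * (w.re - x₀) ≠ 0 := by nlinarith [hσ.1, mul_nonneg hσ.1 ha.le]
      refine ContinuousAt.continuousWithinAt (continuousAt_const.mul
        (ContinuousAt.rpow_const (by fun_prop) (Or.inl hpos)))
    have e3 := intervalIntegral.integral_eq_sub_of_hasDerivAt e1 e2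
    have e4 : ‖∫ σ in Ioc (0 : ℝ) 1, k w σ‖ ≤ 2 * M * x₀ ^ (-(1 / 2) : ℝ) / (w.re - x₀) := by
      calc ‖∫ σ in Ioc (0 : ℝ) 1, k w σ‖
          ≤ ∫ σ in Ioc (0 : ℝ) 1, M * (x₀ + σ * (w.re - x₀)) ^ (-(3 / 2) : ℝ) :=
            norm_integral_le_of_norm_le
              ((intervalIntegrable_iff_integrableOn_Ioc_of_le zero_le_one).1 e2) (by
              filter_upwards [ae_restrict_mem measurableSet_Ioc] with σ hσ
                using hkb w hw σ hσ.1 hσ.2)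
        _ ≤ _ := by
            rw [← intervalIntegral.integral_of_le zero_le_one, e3]
            have : 0 ≤ M * (2 / (w.re - x₀) * w.re ^ (-(1 / 2) : ℝ)) :=
              mul_nonneg hM (mul_nonneg (by positivity) (Real.rpow_nonneg (by linarith) _))
            have e5 : M * (-2 / (w.re - x₀) * (x₀ + 1 * (w.re - x₀)) ^ (-(1 / 2) : ℝ))
                = -(M * (2 / (w.re - x₀) * w.re ^ (-(1 / 2) : ℝ))) := by
              rw [show x₀ + 1 * (w.re - x₀) = w.re by ring]; ring
            have e6 : M * (-2 / (w.re - x₀) * (x₀ + 0 * (w.re - x₀)) ^ (-(1 / 2) : ℝ))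
                = -(2 * M * x₀ ^ (-(1 / 2) : ℝ) / (w.re - x₀)) := by
              rw [show x₀ + 0 * (w.re - x₀) = x₀ by ring]; ring
            rw [e5, e6]
            linarith
    rw [norm_smul]
    calc ‖w - x₀‖ * ‖∫ σ in Ioc (0 : ℝ) 1, k w σ‖
        ≤ 2 * (w.re - x₀) * (2 * M * x₀ ^ (-(1 / 2) : ℝ) / (w.re - x₀)) :=
          mul_le_mul (cone_norm_sub_le hs hs1 hw) e4 (norm_nonneg _) (by positivity)
      _ = 4 * M * x₀ ^ (-(1 / 2) : ℝ) := by field_simp; ring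

end Solve

end Heis

end

noncomputable section

namespace Heis

open MeasureTheory Set Filter Topology

set_option linter.unusedSectionVars false

/-! ### The square-root coordinate -/

section SqrtCoord

/-- The branch `p √w` of the variable `t` with `t² = p² w`. -/
def tMap (p w : ℂ) : ℂ := p * Complex.exp (Complex.log w / 2)

/-- The inverse of `tMap`. -/
def qMap (p w : ℂ) : ℂ := (tMap p w)⁻¹

variable {p w : ℂ}

lemma tMap_ne_zero (hp : p ≠ 0) : tMap p w ≠ 0 := mul_ne_zero hp (Complex.exp_ne_zero _)

lemma tMap_mul_qMap (hp : p ≠ 0) : tMap p w * qMap p w = 1 := mul_inv_cancel₀ (tMap_ne_zero hp)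

lemma tMap_sq (hw : w ≠ 0) : tMap p w ^ 2 = p ^ 2 * w := by
  rw [tMap, mul_pow, ← Complex.exp_nat_mul]
  congr 1
  rw [show ((2 : ℕ) : ℂ) * (Complex.log w / 2) = Complex.log w by push_cast; ring,
    Complex.exp_log hw]

lemma qMap_sq (hw : w ≠ 0) : qMap p w ^ 2 = (p ^ 2 * w)⁻¹ := by
  rw [qMap, inv_pow, tMap_sq hw]

lemma norm_tMap_sq (hp : ‖p‖ = 1) (hw : w ≠ 0) : ‖tMap p w‖ ^ 2 = ‖w‖ := by
  rw [← norm_pow, tMap_sq hw, norm_mul, norm_pow, hp]; simp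

lemma hasDerivAt_tMap (hp : p ≠ 0) (hw : w ∈ Complex.slitPlane) :
    HasDerivAt (tMap p) (p ^ 2 / 2 * qMap p w) w := by
  have hw0 := Complex.slitPlane_ne_zero hw
  have := ((((Complex.hasDerivAt_log hw).div_const 2).cexp).const_mul p)
  convert! this using 1
  have h1 := tMap_sq (p := p) hw0
  have h2 := tMap_ne_zero (w := w) hp
  rw [qMap, ← div_eq_mul_inv, div_eq_iff h2]
  calc p ^ 2 / 2 = p ^ 2 * w * w⁻¹ / 2 := by field_simp
    _ = tMap p w ^ 2 * w⁻¹ / 2 := by rw [h1]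
    _ = p * (Complex.exp (Complex.log w / 2) * (w⁻¹ / 2)) * tMap p w := by rw [tMap]; ring

/-- Differentiating a function of `q` along `w` produces a factor `q³`, the order of the allowed
error; so the `q`-dependence of the gauge transformation costs nothing. -/
lemma hasDerivAt_qMap (hp : p ≠ 0) (hw : w ∈ Complex.slitPlane) :
    HasDerivAt (qMap p) (-(p ^ 2 / 2) * qMap p w ^ 3) w := by
  have := (hasDerivAt_tMap hp hw).inv (tMap_ne_zero hp)
  convert! this using 1
  rw [qMap]
  have h2 := tMap_ne_zero (w := w) hp
  field_simp

lemma norm_qMap (hp : ‖p‖ = 1) (hw : w ≠ 0) : ‖qMap p w‖ = ‖w‖ ^ (-(1 / 2) : ℝ) := by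
  rw [qMap, norm_inv, Real.rpow_neg (norm_nonneg _), ← Real.sqrt_eq_rpow, ← norm_tMap_sq hp hw,
    Real.sqrt_sq (norm_nonneg _)]

lemma norm_qMap_le (hp : ‖p‖ = 1) {x : ℝ} (hx : 0 < x) (hw : x ≤ w.re) :
    ‖qMap p w‖ ≤ x ^ (-(1 / 2) : ℝ) := by
  have hw0 : w ≠ 0 := by rintro rfl; simp at hw; linarith
  rw [norm_qMap hp hw0]
  exact Real.rpow_le_rpow_of_nonpos hx (hw.trans (Complex.re_le_norm w)) (by norm_num)

lemma norm_qMap_pow_three_le (hp : ‖p‖ = 1) (hw : 0 < w.re) :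
    ‖qMap p w‖ ^ 3 ≤ w.re ^ (-(3 / 2) : ℝ) := by
  refine (pow_le_pow_left₀ (norm_nonneg _) (norm_qMap_le hp hw le_rfl) 3).trans (le_of_eq ?_)
  rw [← Real.rpow_natCast, ← Real.rpow_mul hw.le]
  norm_num

lemma cone_subset_slitPlane {s x₀ : ℝ} (hs : 0 < s) (hx₀ : 0 < x₀) :
    cone s x₀ ⊆ Complex.slitPlane := fun _ hw => Or.inl (hx₀.trans (cone_re hs hw))

lemma cone_ne_zero {s x₀ : ℝ} (hs : 0 < s) (hx₀ : 0 < x₀) {w : ℂ} (hw : w ∈ cone s x₀) :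
    w ≠ 0 := Complex.slitPlane_ne_zero (cone_subset_slitPlane hs hx₀ hw)

end SqrtCoord

/-! ### Admissible slopes -/

/-- For each of the exponents `a`, the real part of `a z` increases strictly along some direction
in the cone of slope `s`, or decreases strictly along all of them. -/
def AdmissibleSlope {ι : Type*} (a : ι → ℂ) (s : ℝ) : Prop :=
  ∀ i, ∃ c > 0, (∃ η : ℝ, |η| ≤ s ∧ c ≤ (a i * (1 + η * Complex.I)).re) ∨
    ∀ z : ℂ, |z.im| ≤ s * z.re → (a i * z).re ≤ -c * ‖z‖

/-- If `Re a > 0` the axis direction works; if `Re a = 0`, tilting by `±s` makes the real part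
positive; if `Re a < 0`, a narrow cone keeps it uniformly negative. -/
lemma eventually_slope {a : ℂ} (ha : a ≠ 0) : ∀ᶠ s : ℝ in 𝓝[>] 0, ∃ c > 0,
    (∃ η : ℝ, |η| ≤ s ∧ c ≤ (a * (1 + η * Complex.I)).re) ∨
      ∀ z : ℂ, |z.im| ≤ s * z.re → (a * z).re ≤ -c * ‖z‖ := by
  have hre : ∀ η : ℝ, (a * (1 + η * Complex.I)).re = a.re - a.im * η := by intro η; simp
  rcases lt_trichotomy a.re 0 with h | h | h
  · have h1 : ∀ᶠ s : ℝ in 𝓝[>] 0, s * |a.im| < -a.re / 2 :=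
      (((continuous_id.mul continuous_const).tendsto' (0 : ℝ) 0 (by simp)).mono_left
        nhdsWithin_le_nhds).eventually_lt_const (by linarith)
    have h2 : ∀ᶠ s : ℝ in 𝓝[>] 0, s < 1 := nhdsWithin_le_nhds (gt_mem_nhds one_pos)
    filter_upwards [h1, h2, self_mem_nhdsWithin] with s hs hs1 hs0
    have hs0 : 0 < s := hs0
    refine ⟨-a.re / 4, by linarith, Or.inr fun z hz => ?_⟩
    have hz0 : 0 ≤ z.re := by
      have := (abs_nonneg _).trans hz
      exact nonneg_of_mul_nonneg_right this hs0
    have hn : ‖z‖ ≤ 2 * z.re := by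
      have := Complex.norm_le_abs_re_add_abs_im z
      rw [abs_of_nonneg hz0] at this
      nlinarith
    have him : -(a.im * z.im) ≤ |a.im| * (s * z.re) := by
      refine (neg_le_abs _).trans ?_
      rw [abs_mul]
      exact mul_le_mul_of_nonneg_left hz (abs_nonneg _)
    rw [Complex.mul_re]
    nlinarith [mul_le_mul_of_nonneg_right hs.le hz0]
  · have him : a.im ≠ 0 := fun h' => ha (Complex.ext h h')
    filter_upwards [self_mem_nhdsWithin] with s hs0
    have hs0 : 0 < s := hs0
    refine ⟨s * |a.im|, mul_pos hs0 (abs_pos.2 him), Or.inl ?_⟩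
    rcases lt_or_gt_of_ne him with h' | h'
    · exact ⟨s, (abs_of_pos hs0).le, by rw [hre, h, abs_of_neg h']; nlinarith⟩
    · exact ⟨-s, by rw [abs_neg, abs_of_pos hs0], by rw [hre, h, abs_of_pos h']; nlinarith⟩
  · filter_upwards [self_mem_nhdsWithin] with s hs0
    exact ⟨a.re, h, Or.inl ⟨0, by simpa using (mem_Ioi.1 hs0).le, by rw [hre]; simp⟩⟩

lemma exists_admissibleSlope {ι : Type*} [Finite ι] {a : ι → ℂ} (ha : ∀ i, a i ≠ 0) :
    ∃ s, 0 < s ∧ s ≤ 1 ∧ AdmissibleSlope a s := by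
  have h1 : ∀ᶠ s : ℝ in 𝓝[>] 0, AdmissibleSlope a s :=
    eventually_all.2 fun i => eventually_slope (ha i)
  have h2 : ∀ᶠ s : ℝ in 𝓝[>] 0, s < 1 := nhdsWithin_le_nhds (gt_mem_nhds one_pos)
  obtain ⟨s, h1, h2, h3⟩ := (h1.and (h2.and self_mem_nhdsWithin)).exists
  exact ⟨s, h3, h2.le, h1⟩

/-! ### Exponents -/

section Exponent

variable {A : Type*} [NormedCommRing A] [NormedAlgebra ℂ A] [CompleteSpace A]

open NormedSpace (exp)

/-- The exponent `γ t²/2 + β t + ρ log √w` in the coordinate `w`, where `t = p √w`. -/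
def expo (p γ : ℂ) (β ρ : A) (w : ℂ) : A :=
  algebraMap ℂ A (p ^ 2 * γ / 2 * w) + (tMap p w • β + (Complex.log w / 2) • ρ)

/-- The derivative of `expo`, as a function of `q = 1/t`. -/
def dExpo (p γ : ℂ) (β ρ : A) (q : ℂ) : A :=
  (p ^ 2 / 2) • (algebraMap ℂ A γ + q • β + q ^ 2 • ρ)

variable {p : ℂ} {s x₀ : ℝ}

lemma hasDerivAt_expo_tail (hp : p ≠ 0) (β ρ : A) {w : ℂ} (hw : w ∈ Complex.slitPlane) :
    HasDerivAt (fun w => tMap p w • β + (Complex.log w / 2) • ρ)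
      ((p ^ 2 / 2) • (qMap p w • β + qMap p w ^ 2 • ρ)) w := by
  have := ((hasDerivAt_tMap hp hw).smul_const β).add
    (((Complex.hasDerivAt_log hw).div_const 2).smul_const ρ)
  convert! this using 1
  have hw0 := Complex.slitPlane_ne_zero hw
  rw [smul_add, smul_smul, smul_smul, qMap_sq hw0]
  congr 2
  field_simp

lemma hasDerivAt_expo (hp : p ≠ 0) (γ : ℂ) (β ρ : A) {w : ℂ} (hw : w ∈ Complex.slitPlane) :
    HasDerivAt (expo p γ β ρ) (dExpo p γ β ρ (qMap p w)) w := by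
  have h1 : HasDerivAt (fun w : ℂ => algebraMap ℂ A (p ^ 2 * γ / 2 * w))
      ((p ^ 2 / 2) • algebraMap ℂ A γ) w := by
    have := ((hasDerivAt_id w).const_mul (p ^ 2 * γ / 2)).smul_const (1 : A)
    simp only [Algebra.algebraMap_eq_smul_one] at *
    convert! this using 1
    rw [smul_smul]; congr 1; ring
  have := h1.add (hasDerivAt_expo_tail hp β ρ hw)
  convert! this using 1
  simp only [dExpo, smul_add, add_assoc]

lemma dExpo_sub (p γ γ' : ℂ) (β β' ρ ρ' : A) (q : ℂ) :
    dExpo p γ β ρ q - dExpo p γ' β' ρ' q = dExpo p (γ - γ') (β - β') (ρ - ρ') q := by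
  simp only [dExpo, Algebra.algebraMap_eq_smul_one]
  module

/-- The `β` and `ρ` terms have derivative `O(|q|) = O(x₀^{-1/2})` on the convex cone. Far out their
Lipschitz constant is therefore beaten by the linear term of the exponent. -/
lemma norm_expo_tail_sub_le (hp : ‖p‖ = 1) (hs : 0 < s) (hx₀ : 0 < x₀) (β ρ : A) {w z : ℂ}
    (hw : w ∈ cone s x₀) (hz : z ∈ cone s x₀) :
    ‖(tMap p w • β + (Complex.log w / 2) • ρ) - (tMap p z • β + (Complex.log z / 2) • ρ)‖ ≤
      (x₀ ^ (-(1 / 2) : ℝ) * ‖β‖ + (x₀ ^ (-(1 / 2) : ℝ)) ^ 2 * ‖ρ‖) * ‖w - z‖ := by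
  have hp0 : p ≠ 0 := by rintro rfl; simp at hp
  refine Convex.norm_image_sub_le_of_norm_hasDerivWithin_le (s := cone s x₀)
    (fun y hy => (hasDerivAt_expo_tail hp0 β ρ
      (cone_subset_slitPlane hs hx₀ hy)).hasDerivWithinAt) (fun y hy => ?_) (convex_cone s x₀) hz hw
  have hq := norm_qMap_le hp hx₀ (cone_re hs hy).le
  rw [norm_smul, norm_div, norm_pow, hp]
  have h1 : ‖qMap p y • β + qMap p y ^ 2 • ρ‖ ≤
      x₀ ^ (-(1 / 2) : ℝ) * ‖β‖ + (x₀ ^ (-(1 / 2) : ℝ)) ^ 2 * ‖ρ‖ := by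
    refine (norm_add_le _ _).trans ?_
    rw [norm_smul, norm_smul, norm_pow]
    gcongr
  have h0 := norm_nonneg (qMap p y • β + qMap p y ^ 2 • ρ)
  simp only [one_pow, Complex.norm_ofNat]
  linarith

variable [NormOneClass A]

/-- Solvability of `v' = Φ' v + f` with bounds on a cone far out, where `Φ` is an exponent which
is zero or has an admissible leading coefficient. -/
lemma eventually_solvable (hp : ‖p‖ = 1) (hs : 0 < s) (hs1 : s ≤ 1) {γ : ℂ} {β ρ : A}
    (h : (γ = 0 ∧ β = 0 ∧ ρ = 0) ∨ ∃ c > 0,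
      (∃ η : ℝ, |η| ≤ s ∧ c ≤ (p ^ 2 * γ / 2 * (1 + η * Complex.I)).re) ∨
        ∀ z : ℂ, |z.im| ≤ s * z.re → (p ^ 2 * γ / 2 * z).re ≤ -c * ‖z‖) :
    ∀ᶠ x₀ : ℝ in atTop, ∀ (f : ℂ → A) (M : ℝ), DifferentiableOn ℂ f (cone s x₀) → 0 ≤ M →
      (∀ w ∈ cone s x₀, ‖f w‖ ≤ M * w.re ^ (-(3 / 2) : ℝ)) →
      ∃ v : ℂ → A, (∀ w ∈ cone s x₀, HasDerivAt v (dExpo p γ β ρ (qMap p w) * v w + f w) w) ∧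
        ∀ w ∈ cone s x₀, ‖v w‖ ≤ 4 * M * x₀ ^ (-(1 / 2) : ℝ) := by
  have hp0 : p ≠ 0 := by rintro rfl; simp at hp
  have hdiff : ∀ x₀ : ℝ, 0 < x₀ →
      DifferentiableOn ℂ (fun w => dExpo p γ β ρ (qMap p w)) (cone s x₀) := by
    intro x₀ hx₀ w hw
    have hq : DifferentiableAt ℂ (qMap p) w :=
      (hasDerivAt_qMap hp0 (cone_subset_slitPlane hs hx₀ hw)).differentiableAt
    unfold dExpo
    exact (((hq.smul_const β).const_add _).add
      ((hq.pow 2).smul_const ρ)).const_smul (p ^ 2 / 2) |>.differentiableWithinAt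
  have hder : ∀ x₀ : ℝ, 0 < x₀ → ∀ w ∈ cone s x₀,
      HasDerivAt (expo p γ β ρ) (dExpo p γ β ρ (qMap p w)) w := fun x₀ hx₀ w hw =>
    hasDerivAt_expo hp0 γ β ρ (cone_subset_slitPlane hs hx₀ hw)
  rcases h with ⟨rfl, rfl, rfl⟩ | ⟨c, hc, h⟩
  · filter_upwards [eventually_gt_atTop 0] with x₀ hx₀ f M hf hM hfM
    refine exists_solution_of_ray hs hs1 hx₀ (η := 0) (by simpa using hs.le) (hder x₀ hx₀)
      (hdiff x₀ hx₀) hf hM hfM fun w _ σ _ => ?_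
    simp [expo]
  -- The factor `2` allows for `|1 + iη| ≤ 2` along the rays; the integration from the apex needs
  -- only half of it.
  have hlim : Tendsto (fun x₀ : ℝ => 2 * (x₀ ^ (-(1 / 2) : ℝ) * ‖β‖ +
      (x₀ ^ (-(1 / 2) : ℝ)) ^ 2 * ‖ρ‖)) atTop (𝓝 (2 * (0 * ‖β‖ + 0 ^ 2 * ‖ρ‖))) := by
    have h0 := tendsto_rpow_neg_atTop (by norm_num : (0 : ℝ) < 1 / 2)
    exact (((h0.mul_const _).add ((h0.pow 2).mul_const _)).const_mul 2)
  have hsplit : ∀ w z : ℂ, expo p γ β ρ w - expo p γ β ρ z - algebraMap ℂ A (p ^ 2 * γ / 2 * (w - z))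
      = (tMap p w • β + (Complex.log w / 2) • ρ) - (tMap p z • β + (Complex.log z / 2) • ρ) := by
    intro w z
    simp only [expo, Algebra.algebraMap_eq_smul_one]
    module
  filter_upwards [eventually_gt_atTop 0, hlim.eventually_le_const (u := c) (by simpa using hc)]
    with x₀ hx₀ hε f M hf hM hfM
  rcases h with ⟨η, hη, hcη⟩ | h
  · refine exists_solution_of_ray hs hs1 hx₀ hη (hder x₀ hx₀) (hdiff x₀ hx₀) hf hM hfM
      fun w hw σ hσ => ?_
    refine norm_exp_le_one (z := p ^ 2 * γ / 2 * (w - (w + σ * (1 + η * Complex.I)))) (c := c * σ)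
      ?_ ?_
    · have : p ^ 2 * γ / 2 * (w - (w + σ * (1 + η * Complex.I))) =
        ((-σ : ℝ) : ℂ) * (p ^ 2 * γ / 2 * (1 + η * Complex.I)) := by push_cast; ring
      rw [this, Complex.re_ofReal_mul]
      nlinarith
    · rw [hsplit]
      refine (norm_expo_tail_sub_le hp hs hx₀ β ρ hw (cone_add hη hσ hw)).trans ?_
      have hd2 : ‖w - (w + σ * (1 + η * Complex.I))‖ ≤ 2 * σ := by
        rw [sub_add_cancel_left, norm_neg, norm_mul, Complex.norm_real, Real.norm_of_nonneg hσ,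
          mul_comm]
        refine mul_le_mul_of_nonneg_right ((norm_add_le _ _).trans ?_) hσ
        simp only [norm_one, norm_mul, Complex.norm_real, Complex.norm_I, mul_one, Real.norm_eq_abs]
        linarith
      refine (mul_le_mul_of_nonneg_left hd2 (by positivity)).trans ?_
      nlinarith
  · refine exists_solution_of_apex hs hs1 hx₀ (hder x₀ hx₀) (hdiff x₀ hx₀) hf hM hfM
      fun w hw σ hσ hσ1 => ?_
    have e : w - (x₀ + σ * (w - x₀)) = ((1 - σ : ℝ) : ℂ) * (w - x₀) := by push_cast; ring
    refine norm_exp_le_one (z := p ^ 2 * γ / 2 * (w - (x₀ + σ * (w - x₀))))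
      (c := c * ‖w - (x₀ + σ * (w - x₀))‖) ?_ ?_
    · rw [← neg_mul]
      refine h _ ?_
      rw [e, Complex.re_ofReal_mul, Complex.im_ofReal_mul, abs_mul, abs_of_nonneg (by linarith)]
      simp only [Complex.sub_re, Complex.ofReal_re, Complex.sub_im, Complex.ofReal_im, sub_zero]
      have : |w.im| ≤ s * (w.re - x₀) := le_of_lt hw
      nlinarith
    · rw [hsplit]
      refine (norm_expo_tail_sub_le hp hs hx₀ β ρ hw (cone_tip hσ hw)).trans ?_
      refine mul_le_mul_of_nonneg_right ?_ (norm_nonneg _)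
      have : 0 ≤ x₀ ^ (-(1 / 2) : ℝ) * ‖β‖ + (x₀ ^ (-(1 / 2) : ℝ)) ^ 2 * ‖ρ‖ := by positivity
      linarith

end Exponent

end Heis

end

noncomputable section

namespace Heis

open MeasureTheory Set Filter Topology
open scoped Matrix.Norms.Operator

set_option linter.unusedSectionVars false

/-! ### Normalized solutions near infinity -/

section Normalized

variable {A : Type*} [NormedCommRing A] [NormedAlgebra ℂ A] [CompleteSpace A] [NormOneClass A]
  {n : ℕ}

/-- The diagonal matrix of the derivatives of the exponents. -/
def diagExpo (p : ℂ) (γ : Fin n → ℂ) (β ρ : Fin n → A) (q : ℂ) : Matrix (Fin n) (Fin n) A :=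
  Matrix.diagonal fun k => dExpo p (γ k) (β k) (ρ k) q

lemma commutator_diagExpo_apply (p : ℂ) (γ : Fin n → ℂ) (β ρ : Fin n → A) (q : ℂ)
    (Y : Matrix (Fin n) (Fin n) A) (i j : Fin n) :
    (diagExpo p γ β ρ q * Y - Y * diagExpo p γ β ρ q) i j =
      dExpo p (γ i - γ j) (β i - β j) (ρ i - ρ j) q * Y i j := by
  rw [Matrix.sub_apply, diagExpo, Matrix.diagonal_mul, Matrix.mul_diagonal, ← dExpo_sub]
  ring

/-- The commutator with a diagonal matrix acts entrywise, so the matrix equation decouples into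
scalar ones with exponents `Φ_i - Φ_j`; on the diagonal the exponent is zero. -/
lemma eventually_exists_matrix_solution {p : ℂ} (hp : ‖p‖ = 1) {s : ℝ} (hs : 0 < s) (hs1 : s ≤ 1)
    {γ : Fin n → ℂ} (β ρ : Fin n → A)
    (ha : AdmissibleSlope (fun ij : {ij : Fin n × Fin n // ij.1 ≠ ij.2} =>
      p ^ 2 * (γ ij.1.1 - γ ij.1.2) / 2) s) :
    ∀ᶠ x₀ : ℝ in atTop, ∀ (F : ℂ → Matrix (Fin n) (Fin n) A) (M : ℝ),
      DifferentiableOn ℂ F (cone s x₀) → 0 ≤ M →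
      (∀ w ∈ cone s x₀, ‖F w‖ ≤ M * w.re ^ (-(3 / 2) : ℝ)) →
      ∃ V : ℂ → Matrix (Fin n) (Fin n) A, (∀ w ∈ cone s x₀,
        HasDerivAt V (diagExpo p γ β ρ (qMap p w) * V w - V w * diagExpo p γ β ρ (qMap p w) + F w) w) ∧
        ∀ w ∈ cone s x₀, ‖V w‖ ≤ n * (4 * M * x₀ ^ (-(1 / 2) : ℝ)) := by
  have hall : ∀ᶠ x₀ : ℝ in atTop, ∀ ij : Fin n × Fin n, ∀ (f : ℂ → A) (M : ℝ),
      DifferentiableOn ℂ f (cone s x₀) → 0 ≤ M →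
      (∀ w ∈ cone s x₀, ‖f w‖ ≤ M * w.re ^ (-(3 / 2) : ℝ)) →
      ∃ v : ℂ → A, (∀ w ∈ cone s x₀, HasDerivAt v (dExpo p (γ ij.1 - γ ij.2) (β ij.1 - β ij.2)
        (ρ ij.1 - ρ ij.2) (qMap p w) * v w + f w) w) ∧
        ∀ w ∈ cone s x₀, ‖v w‖ ≤ 4 * M * x₀ ^ (-(1 / 2) : ℝ) := by
    refine eventually_all.2 fun ij => eventually_solvable hp hs hs1 ?_
    by_cases h : ij.1 = ij.2
    · exact Or.inl (by simp [h])
    · exact Or.inr (ha ⟨ij, h⟩)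
  filter_upwards [hall, eventually_gt_atTop 0] with x₀ hx hx₀ F M hF hM hFM
  have hFd : ∀ i j, DifferentiableOn ℂ (fun w => F w i j) (cone s x₀) := fun i j w hw =>
    (hasDerivAt_matrix.1 (hF.differentiableAt ((isOpen_cone s x₀).mem_nhds hw)).hasDerivAt i
      j).differentiableAt.differentiableWithinAt
  choose v hv hvM using fun i j => hx (i, j) (fun w => F w i j) M (hFd i j) hM
    fun w hw => (norm_entry_le (F w) i j).trans (hFM w hw)
  refine ⟨fun w => Matrix.of fun i j => v i j w, fun w hw => ?_, fun w hw => ?_⟩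
  · refine hasDerivAt_matrix.2 fun i j => ?_
    rw [Matrix.add_apply, commutator_diagExpo_apply]
    exact hv i j w hw
  · exact norm_matrix_le (by positivity) fun i j => hvM i j w hw

lemma norm_matrix_one_le : ‖(1 : Matrix (Fin n) (Fin n) A)‖ ≤ 1 := by
  rw [← Matrix.diagonal_one, Matrix.linfty_opNorm_diagonal]
  exact (pi_norm_le_iff_of_nonneg zero_le_one).2 fun _ => norm_one.le

lemma exists_seq_of_step {X : Type*} {P : ℕ → X → Prop} {R : X → X → Prop} {x₀ : X} (h₀ : P 0 x₀)
    (h : ∀ m x, P m x → ∃ y, P (m + 1) y ∧ R x y) :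
    ∃ x : ℕ → X, x 0 = x₀ ∧ (∀ m, P m (x m)) ∧ ∀ m, R (x m) (x (m + 1)) := by
  choose! f hf hR using h
  have hP : ∀ m, P m (Nat.rec x₀ (fun m y => f m y) m) := by
    intro m
    induction m with
    | zero => exact h₀
    | succ m ih => exact hf m _ ih
  exact ⟨fun m => Nat.rec x₀ (fun m y => f m y) m, rfl, hP, fun m => hR m _ (hP m)⟩

/-- Serves only to dominate the termwise derivatives of the series of iterates. -/
lemma exists_norm_diagExpo_le (p : ℂ) (γ : Fin n → ℂ) (β ρ : Fin n → A) :
    ∃ C, ∀ q : ℂ, ‖q‖ ≤ 1 → ‖diagExpo p γ β ρ q‖ ≤ C := by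
  have hc : Continuous (diagExpo p γ β ρ) := by
    refine continuous_matrix fun i j => ?_
    by_cases h : i = j
    · subst h
      simp only [diagExpo, Matrix.diagonal_apply_eq, dExpo]
      fun_prop
    · simp only [diagExpo, Matrix.diagonal_apply_ne _ h]
      fun_prop
  obtain ⟨C, hC⟩ := (isCompact_closedBall (0 : ℂ) 1).exists_bound_of_continuousOn hc.continuousOn
  exact ⟨C, fun q hq => hC q (by simpa using hq)⟩

/-- A system which is diagonal up to `O(q³)` has, far out in a cone of admissible slope, solutions
asymptotic to those of the diagonal system. -/
theorem eventually_exists_normalized_solution {p : ℂ} (hp : ‖p‖ = 1) {s : ℝ} (hs : 0 < s)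
    (hs1 : s ≤ 1) {γ : Fin n → ℂ} (β ρ : Fin n → A)
    (ha : AdmissibleSlope (fun ij : {ij : Fin n × Fin n // ij.1 ≠ ij.2} =>
      p ^ 2 * (γ ij.1.1 - γ ij.1.2) / 2) s)
    {Q : ℂ → Matrix (Fin n) (Fin n) A} {r C : ℝ} (hr : 0 < r)
    (hQ : DifferentiableOn ℂ Q (Metric.ball 0 r)) (hQC : ∀ q ∈ Metric.ball (0 : ℂ) r, ‖Q q‖ ≤ C) :
    ∀ᶠ x₀ : ℝ in atTop, ∃ U : ℂ → Matrix (Fin n) (Fin n) A,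
      (∀ w ∈ cone s x₀, HasDerivAt U (diagExpo p γ β ρ (qMap p w) * U w
        - U w * diagExpo p γ β ρ (qMap p w) + qMap p w ^ 3 • (Q (qMap p w) * U w)) w) ∧
      ∀ w ∈ cone s x₀, ‖U w - 1‖ ≤ 1 / 2 := by
  have hp0 : p ≠ 0 := by rintro rfl; simp at hp
  have hC : 0 ≤ C := (norm_nonneg _).trans (hQC 0 (Metric.mem_ball_self hr))
  have h0 := tendsto_rpow_neg_atTop (by norm_num : (0 : ℝ) < 1 / 2)
  have hsmall : Tendsto (fun x₀ : ℝ => n * (4 * C * x₀ ^ (-(1 / 2) : ℝ))) atTop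
      (𝓝 (n * (4 * C * 0))) := (h0.const_mul _).const_mul _
  obtain ⟨CD, hCD⟩ := exists_norm_diagExpo_le p γ β ρ
  filter_upwards [eventually_exists_matrix_solution hp hs hs1 β ρ ha, eventually_gt_atTop 0,
    h0.eventually_lt_const hr, h0.eventually_le_const one_pos,
    hsmall.eventually_le_const (u := 1 / 3) (by norm_num)] with x₀ hsol hx₀ hqr hq1 hθ
  set W := cone s x₀ with hW
  set D : ℂ → Matrix (Fin n) (Fin n) A := fun w => diagExpo p γ β ρ (qMap p w) with hD
  set R : ℂ → Matrix (Fin n) (Fin n) A := fun w => qMap p w ^ 3 • Q (qMap p w) with hR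
  have hqW : ∀ w ∈ W, ‖qMap p w‖ ≤ x₀ ^ (-(1 / 2) : ℝ) := fun w hw =>
    norm_qMap_le hp hx₀ (cone_re hs hw).le
  have hqball : ∀ w ∈ W, qMap p w ∈ Metric.ball (0 : ℂ) r := fun w hw => by
    simpa using (hqW w hw).trans_lt hqr
  have hRd : DifferentiableOn ℂ R W := by
    intro w hw
    have hq : DifferentiableAt ℂ (qMap p) w :=
      (hasDerivAt_qMap hp0 (cone_subset_slitPlane hs hx₀ hw)).differentiableAt
    have hQq : DifferentiableAt ℂ (fun w => Q (qMap p w)) w :=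
      DifferentiableAt.comp (g := Q) w
        (hQ.differentiableAt (Metric.isOpen_ball.mem_nhds (hqball w hw))) hq
    exact ((hq.pow 3).smul hQq).differentiableWithinAt
  have hRn : ∀ w ∈ W, ‖R w‖ ≤ C * w.re ^ (-(3 / 2) : ℝ) := by
    intro w hw
    have h1 := norm_qMap_pow_three_le hp (hx₀.trans (cone_re hs hw))
    rw [hR, norm_smul, norm_pow, mul_comm]
    exact mul_le_mul (hQC _ (hqball w hw)) h1 (by positivity) hC
  have hRn1 : ∀ w ∈ W, ‖R w‖ ≤ C := by
    intro w hw
    rw [hR, norm_smul, norm_pow]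
    have := pow_le_one₀ (n := 3) (norm_nonneg _) ((hqW w hw).trans hq1)
    nlinarith [hQC _ (hqball w hw), norm_nonneg (Q (qMap p w))]
  have hDn : ∀ w ∈ W, ‖D w‖ ≤ CD := fun w hw => hCD _ ((hqW w hw).trans hq1)
  -- Picard iteration `Y_{m+1}' = [D, Y_{m+1}] + R Y_m` from `Y_0 = 1`. Each step gains the factor
  -- `4 n C x₀^{-1/2} ≤ 1/3`, and `∑_{m ≥ 1} 3^{-m} = 1/2` is the final bound.
  obtain ⟨Y, hY0, hYP, hYR⟩ := exists_seq_of_step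
    (P := fun m (Y : ℂ → Matrix (Fin n) (Fin n) A) => DifferentiableOn ℂ Y W ∧
      ∀ w ∈ W, ‖Y w‖ ≤ (1 / 3) ^ m)
    (R := fun Y Y' => ∀ w ∈ W, HasDerivAt Y' (D w * Y' w - Y' w * D w + R w * Y w) w)
    (x₀ := fun _ => 1)
    ⟨differentiableOn_const _, fun w _ => by simpa using norm_matrix_one_le⟩ (by
      rintro m Y ⟨hYd, hYn⟩
      obtain ⟨V, hV, hVn⟩ := hsol (fun w => R w * Y w) (C * (1 / 3) ^ m) (hRd.mul hYd)
        (by positivity) fun w hw => by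
          refine (norm_mul_le _ _).trans ?_
          calc ‖R w‖ * ‖Y w‖ ≤ (C * w.re ^ (-(3 / 2) : ℝ)) * (1 / 3) ^ m :=
                mul_le_mul (hRn w hw) (hYn w hw) (norm_nonneg _)
                  ((norm_nonneg _).trans (hRn w hw))
            _ = _ := by ring
      refine ⟨V, ⟨fun w hw => (hV w hw).differentiableAt.differentiableWithinAt, fun w hw => ?_⟩, hV⟩
      refine (hVn w hw).trans ?_
      calc n * (4 * (C * (1 / 3) ^ m) * x₀ ^ (-(1 / 2) : ℝ))
          = (n * (4 * C * x₀ ^ (-(1 / 2) : ℝ))) * (1 / 3) ^ m := by ring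
        _ ≤ 1 / 3 * (1 / 3) ^ m := by gcongr
        _ = (1 / 3) ^ (m + 1) := by ring)
  have hgeo : Summable fun m : ℕ => (1 / 3 : ℝ) ^ m :=
    summable_geometric_of_lt_one (by norm_num) (by norm_num)
  have hYs : ∀ w ∈ W, Summable fun m => Y (m + 1) w := fun w hw =>
    Summable.of_norm_bounded ((summable_nat_add_iff 1).2 hgeo) fun m => (hYP (m + 1)).2 w hw
  have hYs0 : ∀ w ∈ W, Summable fun m => Y m w := fun w hw =>
    Summable.of_norm_bounded hgeo fun m => (hYP m).2 w hw
  have hU0 : ∀ w ∈ W, (∑' m, Y m w) = 1 + ∑' m, Y (m + 1) w := fun w hw => by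
    rw [(hYs0 w hw).tsum_eq_zero_add, hY0]
  -- The term `Y_0 = 1` commutes with `D`, so the derivative of the remaining sum already carries
  -- the full commutator `[D, U]`.
  refine ⟨fun w => 1 + ∑' m, Y (m + 1) w, fun w hw => ?_, fun w hw => ?_⟩
  · have hder := hasDerivAt_tsum_of_isPreconnected (g := fun m w => Y (m + 1) w)
      (g' := fun m w => D w * Y (m + 1) w - Y (m + 1) w * D w + R w * Y m w)
      (u := fun m => (2 * CD + C) * (1 / 3) ^ m) (t := W) (y₀ := w) (y := w)
      (hgeo.mul_left _) (isOpen_cone s x₀) (convex_cone s x₀).isPreconnected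
      (fun m y hy => hYR m y hy) (fun m y hy => ?_) hw (hYs w hw) hw
    · have h1 := ((hYs w hw).hasSum.mul_left (D w)).sub ((hYs w hw).hasSum.mul_right (D w))
      have h2 := (hYs0 w hw).hasSum.mul_left (R w)
      rw [hU0 w hw] at h2
      convert! hder.const_add 1 using 1
      refine Eq.trans ?_ (h1.add h2).tsum_eq.symm
      simp only [hR, smul_mul_assoc, hD]
      noncomm_ring
    · have hCD0 : 0 ≤ CD := (norm_nonneg _).trans (hDn y hy)
      have e1 : ‖Y (m + 1) y‖ ≤ (1 / 3) ^ m := ((hYP (m + 1)).2 y hy).trans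
        (pow_le_pow_of_le_one (by norm_num) (by norm_num) (Nat.le_succ m))
      calc ‖D y * Y (m + 1) y - Y (m + 1) y * D y + R y * Y m y‖
          ≤ ‖D y‖ * ‖Y (m + 1) y‖ + ‖Y (m + 1) y‖ * ‖D y‖ + ‖R y‖ * ‖Y m y‖ :=
            (norm_add_le _ _).trans (add_le_add ((norm_sub_le _ _).trans
              (add_le_add (norm_mul_le _ _) (norm_mul_le _ _))) (norm_mul_le _ _))
        _ ≤ CD * (1 / 3) ^ m + (1 / 3) ^ m * CD + C * (1 / 3) ^ m := by
            gcongr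
            exacts [hDn y hy, hDn y hy, hRn1 y hy, (hYP m).2 y hy]
        _ = (2 * CD + C) * (1 / 3) ^ m := by ring
  · rw [add_sub_cancel_left]
    have h3 : HasSum (fun m : ℕ => (1 / 3 : ℝ) ^ (m + 1)) (1 / 2) := by
      have := (hasSum_geometric_of_lt_one (r := (1 / 3 : ℝ)) (by norm_num) (by norm_num)).mul_left
        (1 / 3)
      convert! this using 1
      · funext m; ring
      · norm_num
    exact tsum_of_norm_bounded h3 fun m => (hYP (m + 1)).2 w hw

end Normalized

end Heis

end

noncomputable section

namespace Heis

open MeasureTheory Set Filter Topology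
open scoped Matrix.Norms.Operator

set_option linter.unusedSectionVars false

/-! ### Fundamental matrices near infinity -/

section NearInfinity

variable {A : Type*} [NormedCommRing A] [NormedAlgebra ℂ A] [CompleteSpace A] [NormOneClass A]
  {n : ℕ}

open NormedSpace (exp)

/-- The diagonal matrix of the exponentials of the exponents. -/
def expDiag (p : ℂ) (γ : Fin n → ℂ) (β ρ : Fin n → A) (w : ℂ) : Matrix (Fin n) (Fin n) A :=
  Matrix.diagonal fun k => exp (expo p (γ k) (β k) (ρ k) w)

lemma hasDerivAt_expDiag {p : ℂ} (hp : p ≠ 0) (γ : Fin n → ℂ) (β ρ : Fin n → A) {w : ℂ}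
    (hw : w ∈ Complex.slitPlane) :
    HasDerivAt (expDiag p γ β ρ) (diagExpo p γ β ρ (qMap p w) * expDiag p γ β ρ w) w := by
  refine hasDerivAt_matrix.2 fun i j => ?_
  rw [diagExpo, expDiag, Matrix.diagonal_mul_diagonal]
  by_cases h : i = j
  · subst h
    simp only [expDiag, Matrix.diagonal_apply_eq]
    rw [mul_comm]
    exact hasDerivAt_exp_comp (hasDerivAt_expo hp _ _ _ hw)
  · simp only [expDiag, Matrix.diagonal_apply_ne _ h]
    exact hasDerivAt_const _ _

lemma isUnit_expDiag (p : ℂ) (γ : Fin n → ℂ) (β ρ : Fin n → A) (w : ℂ) :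
    IsUnit (expDiag p γ β ρ w) := by
  have h : expDiag p γ β ρ w * Matrix.diagonal (fun k => exp (-expo p (γ k) (β k) (ρ k) w)) = 1 := by
    rw [expDiag, Matrix.diagonal_mul_diagonal, ← Matrix.diagonal_one]
    congr 1
    funext k
    exact exp_mul_exp_neg _
  exact IsUnit.of_mul_eq_one _ h

/-- The matrix of the diagonal system in the variable `q`. -/
def diagForm (γ : Fin n → ℂ) (β ρ : Fin n → A) (q : ℂ) : Matrix (Fin n) (Fin n) A :=
  Matrix.diagonal fun k => algebraMap ℂ A (γ k) + q • β k + q ^ 2 • ρ k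

lemma diagExpo_eq (p : ℂ) (γ : Fin n → ℂ) (β ρ : Fin n → A) (q : ℂ) :
    diagExpo p γ β ρ q = (p ^ 2 / 2) • diagForm γ β ρ q := by
  rw [diagExpo, diagForm, ← Matrix.diagonal_smul]
  rfl

/-- If a gauge transformation `S` diagonalizes the system with matrix `M` up to `O(q³)`, then
the system has a fundamental matrix of the expected size on a cone far out. -/
theorem eventually_exists_fundamental_matrix {p : ℂ} (hp : ‖p‖ = 1) {s : ℝ} (hs : 0 < s)
    (hs1 : s ≤ 1) {γ : Fin n → ℂ} (β ρ : Fin n → A)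
    (ha : AdmissibleSlope (fun ij : {ij : Fin n × Fin n // ij.1 ≠ ij.2} =>
      p ^ 2 * (γ ij.1.1 - γ ij.1.2) / 2) s)
    {M S F : ℂ → Matrix (Fin n) (Fin n) A} (hS : Differentiable ℂ S) (hF : Differentiable ℂ F)
    (hS0 : IsUnit (S 0)) (hMS : ∀ q, M q * S q = S q * diagForm γ β ρ q + q ^ 3 • F q) :
    ∃ C : ℝ, ∀ᶠ x₀ : ℝ in atTop, ∃ T : ℂ → Matrix (Fin n) (Fin n) A, ∀ w ∈ cone s x₀,
      HasDerivAt (fun w => T w * expDiag p γ β ρ w)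
        ((p ^ 2 / 2) • (M (qMap p w) * (T w * expDiag p γ β ρ w))) w ∧
      IsUnit (T w) ∧ ‖T w‖ ≤ C := by
  have hp0 : p ≠ 0 := by rintro rfl; simp at hp
  have hSd : Differentiable ℂ (deriv S) := fun q =>
    ((hS.analyticAt q).deriv).differentiableAt
  -- Substituting `T = S U` in the system gives `U' = [D, U] + q³ Q U` for exactly this `Q`: `F` is
  -- the remainder of the gauge identity and `deriv S` comes from `dq/dw = -(p²/2) q³`.
  set Q : ℂ → Matrix (Fin n) (Fin n) A :=
    fun q => (p ^ 2 / 2) • (Ring.inverse (S q) * (F q + deriv S q)) with hQ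
  have hQd : ∀ q, IsUnit (S q) → DifferentiableAt ℂ Q q := by
    rintro q ⟨u, hu⟩
    have hi : DifferentiableAt ℂ Ring.inverse (S q) := by
      rw [← hu]; exact differentiableAt_inverse u.isUnit
    have h1 : DifferentiableAt ℂ (fun q => Ring.inverse (S q)) q :=
      DifferentiableAt.comp (g := Ring.inverse) q hi (hS q)
    exact (h1.mul ((hF q).add (hSd q))).const_smul (p ^ 2 / 2)
  have hev : ∀ᶠ q in 𝓝 (0 : ℂ), IsUnit (S q) ∧ ‖Q q‖ < ‖Q 0‖ + 1 ∧ ‖S q‖ < ‖S 0‖ + 1 := by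
    refine (hS.continuous.continuousAt.eventually (Units.isOpen.mem_nhds hS0)).and
      (((hQd 0 hS0).continuousAt.norm.eventually_lt_const (lt_add_one _)).and
        (hS.continuous.norm.continuousAt.eventually_lt_const (lt_add_one _)))
  obtain ⟨r, hr, hball⟩ := Metric.eventually_nhds_iff_ball.1 hev
  have h0 := tendsto_rpow_neg_atTop (by norm_num : (0 : ℝ) < 1 / 2)
  refine ⟨(‖S 0‖ + 1) * 2, ?_⟩
  filter_upwards [eventually_exists_normalized_solution hp hs hs1 β ρ ha hr (Q := Q)
    (C := ‖Q 0‖ + 1) (fun q hq => (hQd q (hball q hq).1).differentiableWithinAt)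
    (fun q hq => (hball q hq).2.1.le), eventually_gt_atTop 0, h0.eventually_lt_const hr]
    with x₀ ⟨U, hU, hU1⟩ hx₀ hqr
  refine ⟨fun w => S (qMap p w) * U w, fun w hw => ?_⟩
  have hqw : qMap p w ∈ Metric.ball (0 : ℂ) r := by
    simpa using (norm_qMap_le hp hx₀ (cone_re hs hw).le).trans_lt hqr
  have hslit := cone_subset_slitPlane hs hx₀ hw
  obtain ⟨hSu, -, hSn⟩ := hball _ hqw
  have hUn : ‖U w‖ ≤ 2 := by
    have := norm_add_le (U w - 1) 1
    rw [sub_add_cancel] at this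
    linarith [hU1 w hw, norm_matrix_one_le (A := A) (n := n)]
  have hUu : IsUnit (U w) := by
    have h1 : ‖1 - U w‖ < 1 := by rw [norm_sub_rev]; linarith [hU1 w hw]
    have := (Units.oneSub (1 - U w) h1).isUnit
    simpa using this
  refine ⟨?_, hSu.mul hUu, (norm_mul_le _ _).trans (mul_le_mul hSn.le hUn (norm_nonneg _)
    (by positivity))⟩
  have hSq : HasDerivAt (fun w => S (qMap p w))
      ((-(p ^ 2 / 2) * qMap p w ^ 3) • deriv S (qMap p w)) w :=
    (hS (qMap p w)).hasDerivAt.scomp w (hasDerivAt_qMap hp0 hslit)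
  have h := (hSq.mul (hU w hw)).mul (hasDerivAt_expDiag hp0 γ β ρ hslit)
  convert! h using 1
  have hinv : S (qMap p w) * Q (qMap p w) =
      (p ^ 2 / 2) • (F (qMap p w) + deriv S (qMap p w)) := by
    rw [hQ, mul_smul_comm, ← mul_assoc, Ring.mul_inverse_cancel _ hSu, one_mul]
  have e1 : S (qMap p w) * (qMap p w ^ 3 • (Q (qMap p w) * U w)) =
      qMap p w ^ 3 • ((p ^ 2 / 2) • ((F (qMap p w) + deriv S (qMap p w)) * U w)) := by
    rw [mul_smul_comm, ← mul_assoc, hinv, smul_mul_assoc]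
  rw [mul_add (S (qMap p w)), e1, ← mul_assoc, ← mul_assoc, hMS, diagExpo_eq]
  simp only [mul_sub, smul_mul_assoc, mul_smul_comm, add_mul, sub_mul, smul_add, ← mul_assoc]
  module

end NearInfinity

end Heis

end

noncomputable section

namespace Heis

open Matrix

set_option linter.unusedSectionVars false

/-! ### The first-order systems of the operator -/

section Systems

variable {R : Type*} [CommRing R] [Algebra ℂ R] (n : ℕ) (P : ℕ → NC) (ν : R)

/-- The coefficient of `t^a ∂^j` in `∑ l, ν ^ (n - l) P_l(i∂, t)`. -/
def symCoef (a j : ℕ) : R :=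
  ∑ l ∈ Finset.range (n + 1), ν ^ (n - l) * algebraMap ℂ R (normCoeff (P l) a j)

/-- The coefficient of `t^r` in the companion matrix of the operator. -/
def compMat (r : ℕ) : Matrix (Fin n) (Fin n) R := Matrix.of fun i j =>
  (if r = 0 ∧ (j : ℕ) = i + 1 then 1 else 0) - (if (i : ℕ) + 1 = n then symCoef n P ν r j else 0)

/-- The coefficient of `t^(-r)` in the matrix of the rescaled companion system. -/
def scaledMat (r : ℕ) : Matrix (Fin n) (Fin n) R := Matrix.of fun i j =>
  (if r = 0 ∧ (j : ℕ) = i + 1 then 1 else 0) - (if r = 2 ∧ i = j then ((i : ℕ) : R) else 0)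
    - (if (i : ℕ) + 1 = n ∧ r + j ≤ n then symCoef n P ν (n - r - j) j else 0)

variable {n P ν}

/-- In this lemma and the next three, parity and degree leave only those `P_l` with `l - a - j` even
and nonnegative: none, `P_n`, `P_{n-1}`, or `P_n` together with `P_{n-2}`. -/
lemma symCoef_eq_zero (hP : ∀ l ≤ n, IsHomog l (P l)) {a j : ℕ} (h : n < a + j) :
    symCoef n P ν a j = 0 :=
  Finset.sum_eq_zero fun l hl => by
    have := Finset.mem_range.1 hl
    rw [normCoeff_eq_zero (hP l (by omega)) (by rintro ⟨k, hk⟩; omega), map_zero, mul_zero]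

lemma symCoef_of_add_eq (hP : ∀ l ≤ n, IsHomog l (P l)) {a j : ℕ} (h : a + j = n) :
    symCoef n P ν a j = algebraMap ℂ R (normCoeff (P n) a j) := by
  rw [symCoef, Finset.sum_eq_single n]
  · simp
  · intro l hl hln
    have := Finset.mem_range.1 hl
    rw [normCoeff_eq_zero (hP l (by omega)) (by rintro ⟨k, hk⟩; omega), map_zero, mul_zero]
  · simp

lemma symCoef_of_add_one_eq (hP : ∀ l ≤ n, IsHomog l (P l)) {a j : ℕ} (h : a + j + 1 = n) :
    symCoef n P ν a j = ν * algebraMap ℂ R (normCoeff (P (n - 1)) a j) := by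
  rw [symCoef, Finset.sum_eq_single (n - 1)]
  · rw [show n - (n - 1) = 1 by omega, pow_one]
  · intro l hl hln
    have := Finset.mem_range.1 hl
    rw [normCoeff_eq_zero (hP l (by omega)) (by rintro ⟨k, hk⟩; omega), map_zero, mul_zero]
  · intro h; simp at h

lemma symCoef_of_add_two_eq (hP : ∀ l ≤ n, IsHomog l (P l)) {a j : ℕ} (h : a + j + 2 = n) :
    symCoef n P ν a j = algebraMap ℂ R (normCoeff (P n) a j) +
      ν ^ 2 * algebraMap ℂ R (normCoeff (P (n - 2)) a j) := by
  rw [symCoef, ← Finset.sum_subset (s₁ := {n, n - 2})]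
  · rw [Finset.sum_pair (by omega), show n - (n - 2) = 2 by omega]
    simp
  · intro l hl
    simp only [Finset.mem_insert, Finset.mem_singleton] at hl
    simp only [Finset.mem_range]
    omega
  · intro l hl hln
    simp only [Finset.mem_insert, Finset.mem_singleton, not_or] at hln
    have := Finset.mem_range.1 hl
    rw [normCoeff_eq_zero (hP l (by omega)) (by rintro ⟨k, hk⟩; omega), map_zero, mul_zero]

/-- The rescaling by `diag(t^i)` relates the companion system and the rescaled one. -/
lemma compMat_scaledMat (hn : 2 ≤ n) (hP : ∀ l ≤ n, IsHomog l (P l)) {t q : ℂ} (htq : t * q = 1)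
    (i j : Fin n) :
    t ^ (i : ℕ) • (∑ r ∈ Finset.range (n + 1), q ^ r • scaledMat n P ν r i j)
      + (t ^ (i : ℕ) * q ^ 2) • (if i = j then ((i : ℕ) : R) else 0) =
    (q * t ^ (j : ℕ)) • ∑ r ∈ Finset.range (n + 1), t ^ r • compMat n P ν r i j := by
  have hj := j.2
  have e1 : ∑ r ∈ Finset.range (n + 1), q ^ r • (if r = 0 ∧ (j : ℕ) = i + 1 then (1 : R) else 0) =
      if (j : ℕ) = i + 1 then 1 else 0 := by
    rw [Finset.sum_eq_single 0] <;> simp +contextual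
  have e2 : ∑ r ∈ Finset.range (n + 1), t ^ r • (if r = 0 ∧ (j : ℕ) = i + 1 then (1 : R) else 0) =
      if (j : ℕ) = i + 1 then 1 else 0 := by
    rw [Finset.sum_eq_single 0] <;> simp +contextual
  have e3 : ∑ r ∈ Finset.range (n + 1), q ^ r • (if r = 2 ∧ i = j then ((i : ℕ) : R) else 0) =
      q ^ 2 • (if i = j then ((i : ℕ) : R) else 0) := by
    rw [Finset.sum_eq_single 2]
    · simp
    · simp +contextual
    · intro h; simp at h; omega
  -- The substitution `a = n - j - r` turns powers of `q` into powers of `t`, because `t q = 1`.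
  have e4 : ∑ r ∈ Finset.range (n + 1), q ^ r •
      (if (i : ℕ) + 1 = n ∧ r + j ≤ n then symCoef n P ν (n - r - j) j else 0) =
      if (i : ℕ) + 1 = n then ∑ a ∈ Finset.range (n - j + 1), q ^ (n - j - a) • symCoef n P ν a j
        else 0 := by
    by_cases hi : (i : ℕ) + 1 = n
    · simp only [hi, true_and, if_true]
      rw [← Finset.sum_subset (Finset.range_mono (by omega : n - j + 1 ≤ n + 1)),
        ← Finset.sum_flip (n := n - j)]
      · refine Finset.sum_congr rfl fun r hr => ?_
        have := Finset.mem_range.1 hr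
        rw [if_pos (by omega), show n - (n - j - r) - j = r by omega]
      · intro r _ hr
        have := mt Finset.mem_range.2 hr
        rw [if_neg (by omega), smul_zero]
    · simp [hi]
  have e5 : ∑ r ∈ Finset.range (n + 1), t ^ r •
      (if (i : ℕ) + 1 = n then symCoef n P ν r j else 0) =
      if (i : ℕ) + 1 = n then ∑ a ∈ Finset.range (n - j + 1), t ^ a • symCoef n P ν a j else 0 := by
    by_cases hi : (i : ℕ) + 1 = n
    · simp only [hi, if_true]
      rw [← Finset.sum_subset (Finset.range_mono (by omega : n - j + 1 ≤ n + 1))]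
      intro r _ hr
      have := mt Finset.mem_range.2 hr
      rw [symCoef_eq_zero hP (by omega), smul_zero]
    · simp [hi]
  simp only [scaledMat, compMat, Matrix.of_apply, smul_sub, Finset.sum_sub_distrib, e1, e2, e3, e4,
    e5]
  have f1 : t ^ (i : ℕ) • (if (j : ℕ) = i + 1 then (1 : R) else 0) =
      (q * t ^ (j : ℕ)) • (if (j : ℕ) = i + 1 then (1 : R) else 0) := by
    by_cases h : (j : ℕ) = i + 1
    · rw [h, show q * t ^ ((i : ℕ) + 1) = t ^ (i : ℕ) by
        rw [pow_succ]; linear_combination t ^ (i : ℕ) * htq]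
    · simp [h]
  have f2 : t ^ (i : ℕ) • (if (i : ℕ) + 1 = n then
        ∑ a ∈ Finset.range (n - j + 1), q ^ (n - j - a) • symCoef n P ν a j else 0) =
      (q * t ^ (j : ℕ)) • (if (i : ℕ) + 1 = n then
        ∑ a ∈ Finset.range (n - j + 1), t ^ a • symCoef n P ν a j else 0) := by
    by_cases h : (i : ℕ) + 1 = n
    · simp only [h, if_true, Finset.smul_sum, smul_smul]
      refine Finset.sum_congr rfl fun a ha => ?_
      have := Finset.mem_range.1 ha
      congr 1
      have hi : t ^ (i : ℕ) = q * t ^ (j : ℕ) * t ^ a * t ^ (n - j - a) := by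
        have : t ^ (j : ℕ) * t ^ a * t ^ (n - j - a) = t ^ (i : ℕ) * t := by
          rw [← pow_add, ← pow_add, ← pow_succ]; congr 1; omega
        calc t ^ (i : ℕ) = t ^ (i : ℕ) * (t * q) := by rw [htq, mul_one]
          _ = q * (t ^ (j : ℕ) * t ^ a * t ^ (n - j - a)) := by rw [this]; ring
          _ = _ := by ring
      rw [hi, mul_assoc, ← mul_pow, htq, one_pow, mul_one]
    · simp [h]
  rw [f1, f2, smul_smul]
  abel

end Systems

end Heis

end

noncomputable section

namespace Heis

open Matrix

set_option linter.unusedSectionVars false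

/-! ### Formal diagonalization -/

section NormalForm

variable {R : Type*} [CommRing R] [Algebra ℂ R] {n : ℕ} (P : ℕ → NC) (ν : R) (γ : Fin n → ℂ)

/-- The solution `B`, with zero diagonal, of `[B, Γ] = H` off the diagonal. -/
def offSolve (H : Matrix (Fin n) (Fin n) R) : Matrix (Fin n) (Fin n) R := Matrix.of fun i j =>
  if i = j then 0 else algebraMap ℂ R (γ j - γ i)⁻¹ * H i j

/-- `𝓓₁` over a commutative algebra. -/
def nf1 : Matrix (Fin n) (Fin n) R :=
  (S0 γ)⁻¹.map (algebraMap ℂ R) * scaledMat n P ν 1 * (S0 γ).map (algebraMap ℂ R)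

/-- `t (𝓓₂ - S₀⁻¹ S₀')` over a commutative algebra. -/
def nf2 : Matrix (Fin n) (Fin n) R :=
  (S0 γ)⁻¹.map (algebraMap ℂ R) * scaledMat n P ν 2 * (S0 γ).map (algebraMap ℂ R)

/-- `β` over a commutative algebra. -/
def nfBeta (k : Fin n) : R := nf1 P ν γ k k

/-- The second-order term after the first step of the diagonalization. -/
def nfH : Matrix (Fin n) (Fin n) R :=
  nf2 P ν γ + nf1 P ν γ * offSolve γ (nf1 P ν γ)
    - offSolve γ (nf1 P ν γ) * diagonal (nfBeta P ν γ)

/-- `ρ` over a commutative algebra. -/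
def nfRho (k : Fin n) : R := nfH P ν γ k k

variable {P ν γ}

lemma offSolve_comm (hγ : Function.Injective γ) (H : Matrix (Fin n) (Fin n) R) :
    offSolve γ H * diagonal (fun k => algebraMap ℂ R (γ k))
      - diagonal (fun k => algebraMap ℂ R (γ k)) * offSolve γ H = H - diagonal fun k => H k k := by
  ext i j
  simp only [Matrix.sub_apply, Matrix.mul_diagonal, Matrix.diagonal_mul]
  by_cases h : i = j
  · subst h
    simp [offSolve]
  · have h0 : γ j - γ i ≠ 0 := sub_ne_zero.2 fun e => h (hγ e.symm)
    have h1 : algebraMap ℂ R (γ j - γ i)⁻¹ * (algebraMap ℂ R (γ j) - algebraMap ℂ R (γ i)) = 1 := by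
      rw [← map_sub, ← map_mul, inv_mul_cancel₀ h0, map_one]
    simp only [offSolve, Matrix.of_apply, if_neg h, Matrix.diagonal_apply_ne _ h]
    linear_combination H i j * h1

lemma isUnit_S0 (hγ : Function.Injective γ) : IsUnit (S0 γ) := by
  rw [Matrix.isUnit_iff_isUnit_det, S0, Matrix.det_transpose, isUnit_iff_ne_zero]
  exact Matrix.det_vandermonde_ne_zero_iff.2 hγ

lemma map_S0_mul_inv (hγ : Function.Injective γ) :
    (S0 γ).map (algebraMap ℂ R) * (S0 γ)⁻¹.map (algebraMap ℂ R) = 1 := by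
  rw [← Matrix.map_mul, Matrix.mul_nonsing_inv _ ((Matrix.isUnit_iff_isUnit_det _).1 (isUnit_S0 hγ)),
    Matrix.map_one _ (map_zero _) (map_one _)]

lemma IsGeneric.leading_eq_one (hP : IsGeneric n P γ) : normCoeff (P n) 0 n = 1 := by
  have h := congrArg (fun p : Polynomial ℂ => p.coeff n) hP.monic
  rw [charPoly_eq_sum (hP.homog n le_rfl)] at h
  simp only [Polynomial.finsetSum_coeff, Polynomial.coeff_C_mul, Polynomial.coeff_X_pow] at h
  rw [Finset.sum_eq_single n] at h
  · simpa using h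
  · intro j _ hj
    rw [if_neg (Ne.symm hj), mul_zero]
  · simp

lemma IsGeneric.sum_eq_zero (hP : IsGeneric n P γ) (k : Fin n) :
    ∑ j ∈ Finset.range n, normCoeff (P n) (n - j) j * γ k ^ j = -γ k ^ n := by
  have h := hP.root k
  rw [charPoly_eq_sum (hP.homog n le_rfl), Finset.sum_range_succ] at h
  simp only [Polynomial.eval_add, Polynomial.eval_finsetSum, Polynomial.eval_mul,
    Polynomial.eval_C, Polynomial.eval_pow, Polynomial.eval_X, one_pow, mul_one, Nat.sub_self,
    hP.leading_eq_one, one_mul] at h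
  exact eq_neg_of_add_eq_zero_left h

/-- `scaledMat n P ν 0` is the companion matrix of `P_n(iz, 1)`, and the vectors `(γ_k^i)_i` are its
eigenvectors. -/
lemma scaledMat_zero_mul (hP : IsGeneric n P γ) :
    scaledMat n P ν 0 * (S0 γ).map (algebraMap ℂ R) =
      (S0 γ).map (algebraMap ℂ R) * diagonal (fun k => algebraMap ℂ R (γ k)) := by
  ext i k
  rw [Matrix.mul_apply, Matrix.mul_diagonal]
  simp only [Matrix.map_apply, S0, Matrix.transpose_apply, Matrix.vandermonde_apply, scaledMat,
    Matrix.of_apply, sub_mul, Finset.sum_sub_distrib, true_and]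
  have h2 : ∑ j : Fin n, (if (0 : ℕ) = 2 ∧ i = j then ((i : ℕ) : R) else 0) *
      algebraMap ℂ R (γ k ^ (j : ℕ)) = 0 := by simp
  rw [h2, sub_zero, ← map_mul, ← pow_succ]
  by_cases hi : (i : ℕ) + 1 = n
  · have h1 : ∑ j : Fin n, (if (j : ℕ) = i + 1 then (1 : R) else 0) *
        algebraMap ℂ R (γ k ^ (j : ℕ)) = 0 := Finset.sum_eq_zero fun j _ => by
      have := j.2
      rw [if_neg (by omega), zero_mul]
    have h3 : ∑ j : Fin n, (if (i : ℕ) + 1 = n ∧ 0 + (j : ℕ) ≤ n then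
        symCoef n P ν (n - 0 - j) j else 0) * algebraMap ℂ R (γ k ^ (j : ℕ)) =
        algebraMap ℂ R (-γ k ^ n) := by
      rw [← hP.sum_eq_zero k, Finset.sum_range, map_sum]
      refine Finset.sum_congr rfl fun j _ => ?_
      have := j.2
      rw [if_pos ⟨hi, by omega⟩, symCoef_of_add_eq hP.homog (by omega), Nat.sub_zero, map_mul]
    rw [h1, h3, hi, map_neg]
    ring
  · have hi' : (i : ℕ) + 1 < n := by have := i.2; omega
    rw [Finset.sum_eq_single (⟨i + 1, hi'⟩ : Fin n)]
    · simp [hi]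
    · intro j _ hj
      rw [if_neg fun h => hj (Fin.ext h), zero_mul]
    · simp

/-- The second-order formal diagonalization of the rescaled system. -/
lemma normalForm_identities (hP : IsGeneric n P γ) :
    let V := (S0 γ).map (algebraMap ℂ R)
    let Γ := diagonal (fun k => algebraMap ℂ R (γ k))
    let A₁ := offSolve γ (nf1 P ν γ)
    let A₂ := offSolve γ (nfH P ν γ)
    scaledMat n P ν 0 * V = V * Γ ∧
    scaledMat n P ν 1 * V + scaledMat n P ν 0 * (V * A₁) =
      V * A₁ * Γ + V * diagonal (nfBeta P ν γ) ∧
    scaledMat n P ν 2 * V + scaledMat n P ν 1 * (V * A₁) + scaledMat n P ν 0 * (V * A₂) =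
      V * A₂ * Γ + V * A₁ * diagonal (nfBeta P ν γ) + V * diagonal (nfRho P ν γ) := by
  intro V Γ A₁ A₂
  have h0 : scaledMat n P ν 0 * V = V * Γ := scaledMat_zero_mul hP
  have hV : ∀ X : Matrix (Fin n) (Fin n) R, V * ((S0 γ)⁻¹.map (algebraMap ℂ R) * X * V) = X * V := by
    intro X
    rw [← mul_assoc, ← mul_assoc, map_S0_mul_inv hP.injective, one_mul]
  have h1 : scaledMat n P ν 1 * V = V * nf1 P ν γ := (hV _).symm
  have h2 : scaledMat n P ν 2 * V = V * nf2 P ν γ := (hV _).symm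
  have c1 : A₁ * Γ - Γ * A₁ = nf1 P ν γ - diagonal (nfBeta P ν γ) :=
    offSolve_comm hP.injective _
  have c2 : A₂ * Γ - Γ * A₂ = nfH P ν γ - diagonal (nfRho P ν γ) :=
    offSolve_comm hP.injective _
  refine ⟨h0, ?_, ?_⟩
  · rw [h1, ← mul_assoc, h0]
    have : V * (A₁ * Γ - Γ * A₁) = V * (nf1 P ν γ - diagonal (nfBeta P ν γ)) := by rw [c1]
    simp only [mul_sub, ← mul_assoc] at this
    rw [sub_eq_sub_iff_add_eq_add] at this
    rw [← this]
  · rw [h2, ← mul_assoc, h1, ← mul_assoc, h0]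
    have : V * (A₂ * Γ - Γ * A₂) = V * (nfH P ν γ - diagonal (nfRho P ν γ)) := by rw [c2]
    simp only [mul_sub, mul_add, ← mul_assoc, nfH] at this
    have e : V * nf2 P ν γ + V * nf1 P ν γ * A₁ = (V * nf2 P ν γ + V * nf1 P ν γ * A₁
      - V * A₁ * diagonal (nfBeta P ν γ) - V * diagonal (nfRho P ν γ))
      + V * A₁ * diagonal (nfBeta P ν γ) + V * diagonal (nfRho P ν γ) := by abel
    rw [e, ← this]
    abel

/-! ### Specialization -/

lemma scaledMat_one_map (hP : ∀ l ≤ n, IsHomog l (P l)) (f : R →ₐ[ℂ] ℂ) {μ : ℂ}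
    (hf : f ν = μ⁻¹) : (scaledMat n P ν 1).map f = E1 P μ := by
  ext i k
  have hk := k.2
  simp only [Matrix.map_apply, scaledMat, E1, Matrix.of_apply]
  by_cases hi : (i : ℕ) + 1 = n
  · rw [if_neg (by omega), if_neg (by omega), if_pos ⟨hi, by omega⟩, if_pos hi,
      symCoef_of_add_one_eq hP (by omega), dCoef, if_pos (by omega)]
    simp [hf, div_eq_inv_mul]
  · simp [hi]

/-- The extra diagonal comes from differentiating `diag(t^i)`; conjugated by the Vandermonde matrix
it is the term `-V⁻¹V'` of `ρ`. -/
lemma scaledMat_two_map (hn : 2 ≤ n) (hP : ∀ l ≤ n, IsHomog l (P l)) (f : R →ₐ[ℂ] ℂ) {μ : ℂ}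
    (hf : f ν = μ⁻¹) :
    (scaledMat n P ν 2).map f = E2 P μ - diagonal (fun k : Fin n => ((k : ℕ) : ℂ)) := by
  ext i k
  have hk := k.2
  simp only [Matrix.map_apply, scaledMat, E2, Matrix.of_apply, Matrix.sub_apply,
    Matrix.diagonal_apply]
  have e : (if (i : ℕ) + 1 = n ∧ 2 + (k : ℕ) ≤ n then symCoef n P ν (n - 2 - k) k else 0) =
      if (i : ℕ) + 1 = n then (if 2 + (k : ℕ) ≤ n then symCoef n P ν (n - 2 - k) k else 0) else 0 := by
    rw [ite_and]
  have e2 : f (if 2 + (k : ℕ) ≤ n then symCoef n P ν (n - 2 - k) k else 0) =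
      eCoef P n k + dCoef P (n - 2) k / μ ^ 2 := by
    by_cases h : 2 + (k : ℕ) ≤ n
    · rw [if_pos h, symCoef_of_add_two_eq hP (by omega), eCoef, if_pos (by omega), dCoef,
        if_pos (by omega), show n - k - 2 = n - 2 - k by omega]
      simp [hf, div_eq_inv_mul]
    · rw [if_neg h, eCoef, if_neg (by omega)]
      by_cases h' : (k : ℕ) ≤ n - 2
      · omega
      · rw [dCoef, if_neg h']
        simp
  rw [e, map_sub, map_sub]
  by_cases hi : (i : ℕ) + 1 = n
  · simp only [hi, if_true, e2]
    by_cases h : i = k <;> simp [h]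
    ring
  · by_cases h : i = k <;> simp [h, hi]
    subst h
    simp [hi]

lemma map_algebraMap_map (f : R →ₐ[ℂ] ℂ) (M : Matrix (Fin n) (Fin n) ℂ) :
    (M.map (algebraMap ℂ R)).map f = M := by
  ext i j
  simp

lemma nf1_map (hP : ∀ l ≤ n, IsHomog l (P l)) (f : R →ₐ[ℂ] ℂ) {μ : ℂ} (hf : f ν = μ⁻¹) :
    (nf1 P ν γ).map f = D1 P γ μ := by
  rw [nf1, Matrix.map_mul, Matrix.map_mul, map_algebraMap_map, map_algebraMap_map,
    scaledMat_one_map hP f hf, D1]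

lemma offSolve_nf1_map (hP : ∀ l ≤ n, IsHomog l (P l)) (f : R →ₐ[ℂ] ℂ) {μ : ℂ} (hf : f ν = μ⁻¹) :
    (offSolve γ (nf1 P ν γ)).map f = matA P γ μ := by
  ext i j
  have := congrFun (congrFun (nf1_map (γ := γ) hP f hf) i) j
  rw [Matrix.map_apply] at this
  by_cases h : i = j
  · simp [offSolve, matA, h]
  · simp only [Matrix.map_apply, offSolve, matA, Matrix.of_apply, if_neg h, map_mul, this,
      AlgHom.commutes, Algebra.algebraMap_self, RingHom.id_apply]
    rw [div_eq_inv_mul]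

lemma nfBeta_map (hP : ∀ l ≤ n, IsHomog l (P l)) (f : R →ₐ[ℂ] ℂ) {μ : ℂ} (hf : f ν = μ⁻¹)
    (k : Fin n) : f (nfBeta P ν γ k) = beta P γ μ k :=
  congrFun (congrFun (nf1_map (γ := γ) hP f hf) k) k

/-- The elimination produces `D₁A - A diag(β)`. Since `[A, Γ] = D₁ - diag(β)`, this equals `[D₁, A]
+ A[A, Γ]`, the form in the definition of `ρ`. -/
lemma nfRho_map (hn : 2 ≤ n) (hP : IsGeneric n P γ) (f : R →ₐ[ℂ] ℂ) {μ : ℂ} (hf : f ν = μ⁻¹)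
    (k : Fin n) : f (nfRho P ν γ k) = rho P γ μ k := by
  have hd : (diagonal (nfBeta P ν γ)).map f = D1 P γ μ -
      (matA P γ μ * diagonal γ - diagonal γ * matA P γ μ) := by
    have h := congrArg (fun M => M.map f) (offSolve_comm (R := R) hP.injective (nf1 P ν γ))
    simp only [Matrix.map_sub f (map_sub f), Matrix.map_mul, offSolve_nf1_map hP.homog f hf,
      nf1_map hP.homog f hf] at h
    have e : (diagonal fun k => algebraMap ℂ R (γ k)).map f = diagonal γ := by
      rw [Matrix.diagonal_map (map_zero f)]
      simp
    rw [e] at h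
    rw [h, sub_sub_cancel]
    rfl
  have h2 : (nf2 P ν γ).map f = D2 P γ μ - (S0 γ)⁻¹ * dS0 γ := by
    have e : dS0 γ = diagonal (fun k : Fin n => ((k : ℕ) : ℂ)) * S0 γ := by
      ext i j
      simp [dS0, S0, Matrix.diagonal_mul]
    rw [nf2, Matrix.map_mul, Matrix.map_mul, map_algebraMap_map, map_algebraMap_map,
      scaledMat_two_map hn hP.homog f hf, D2, e, mul_sub, sub_mul, mul_assoc, mul_assoc]
  have h : (nfH P ν γ).map f = D2 P γ μ + (D1 P γ μ * matA P γ μ - matA P γ μ * D1 P γ μ)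
      + matA P γ μ * (matA P γ μ * diagonal γ - diagonal γ * matA P γ μ) - (S0 γ)⁻¹ * dS0 γ := by
    rw [nfH, Matrix.map_sub f (map_sub f), Matrix.map_add f (map_add f), Matrix.map_mul,
      Matrix.map_mul, offSolve_nf1_map hP.homog f hf, nf1_map hP.homog f hf, hd, h2, mul_sub]
    abel
  exact congrFun (congrFun h k) k

end NormalForm

/-! ### The gauge transformation and its cubic remainder -/

section Gauge

open scoped Matrix.Norms.Operator

variable {A : Type*} [NormedCommRing A] [NormedAlgebra ℂ A] [CompleteSpace A] [NormOneClass A]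
  {n : ℕ} {P : ℕ → NC} {ν : A} {γ : Fin n → ℂ}

/-- The gauge transformation diagonalizing the rescaled system up to third order. -/
def gauge (P : ℕ → NC) (ν : A) (γ : Fin n → ℂ) (q : ℂ) : Matrix (Fin n) (Fin n) A :=
  (S0 γ).map (algebraMap ℂ A) *
    (1 + q • offSolve γ (nf1 P ν γ) + q ^ 2 • offSolve γ (nfH P ν γ))

/-- The matrix of the rescaled companion system. -/
def scaledSystem (n : ℕ) (P : ℕ → NC) (ν : A) (q : ℂ) : Matrix (Fin n) (Fin n) A :=
  ∑ r ∈ Finset.range (n + 1), q ^ r • scaledMat n P ν r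

lemma differentiable_gauge : Differentiable ℂ (gauge P ν γ) := by
  unfold gauge
  fun_prop

lemma isUnit_gauge_zero (hγ : Function.Injective γ) : IsUnit (gauge P ν γ 0) := by
  have := map_S0_mul_inv (R := A) hγ
  simpa [gauge] using IsUnit.of_mul_eq_one _ this

lemma diagForm_eq (β ρ : Fin n → A) (q : ℂ) : diagForm γ β ρ q =
    diagonal (fun k => algebraMap ℂ A (γ k)) + q • diagonal β + q ^ 2 • diagonal ρ := by
  rw [← Matrix.diagonal_smul, ← Matrix.diagonal_smul, Matrix.diagonal_add, Matrix.diagonal_add]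
  rfl

/-- The three normal form identities cancel the coefficients of `1`, `q` and `q²`; what is left is a
polynomial in `q` divisible by `q³`. -/
lemma exists_gauge_remainder (hn : 2 ≤ n) (hP : IsGeneric n P γ) :
    ∃ F : ℂ → Matrix (Fin n) (Fin n) A, Differentiable ℂ F ∧ ∀ q,
      scaledSystem n P ν q * gauge P ν γ q =
        gauge P ν γ q * diagForm γ (nfBeta P ν γ) (nfRho P ν γ) q + q ^ 3 • F q := by
  -- With `n + 1 = m + 3` the terms `r = 0, 1, 2` can be split off the sum over `r`.
  obtain ⟨m, rfl⟩ : ∃ m, n = m + 2 := ⟨n - 2, by omega⟩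
  obtain ⟨h0, h1, h2⟩ := normalForm_identities (ν := ν) hP
  set V := (S0 γ).map (algebraMap ℂ A)
  set Γ := diagonal (fun k => algebraMap ℂ A (γ k))
  set A₁ := offSolve γ (nf1 P ν γ)
  set A₂ := offSolve γ (nfH P ν γ)
  set b := diagonal (nfBeta P ν γ)
  set c := diagonal (nfRho P ν γ)
  set M₀ := scaledMat (m + 2) P ν 0
  set M₁ := scaledMat (m + 2) P ν 1
  set M₂ := scaledMat (m + 2) P ν 2
  set M₃ : ℂ → Matrix (Fin (m + 2)) (Fin (m + 2)) A :=
    fun q => ∑ r ∈ Finset.range m, q ^ r • scaledMat (m + 2) P ν (r + 3) with hM₃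
  refine ⟨fun q => M₃ q * (V * (1 + q • A₁ + q ^ 2 • A₂)) + (M₁ * (V * A₂) + M₂ * (V * A₁)
    - V * A₁ * c - V * A₂ * b) + q • (M₂ * (V * A₂) - V * A₂ * c), ?_, fun q => ?_⟩
  · fun_prop
  · have hS : scaledSystem (m + 2) P ν q = M₀ + q • M₁ + q ^ 2 • M₂ + q ^ 3 • M₃ q := by
      rw [scaledSystem, Finset.sum_range_succ', Finset.sum_range_succ', Finset.sum_range_succ', hM₃,
        Finset.smul_sum]
      simp only [zero_add, pow_zero, one_smul, pow_one, smul_smul, ← pow_add]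
      rw [Finset.sum_congr rfl fun r _ => by rw [show r + 1 + 1 + 1 = 3 + r by omega]]
      rw [Finset.sum_congr rfl (g := fun r => q ^ (3 + r) • scaledMat (m + 2) P ν (r + 3))
        fun r _ => by rw [add_comm r 3]]
      abel
    have hg : gauge P ν γ q = V + q • (V * A₁) + q ^ 2 • (V * A₂) := by
      simp only [gauge, mul_add, mul_one, mul_smul_comm]
      rfl
    have hg' : V * (1 + q • A₁ + q ^ 2 • A₂) = V + q • (V * A₁) + q ^ 2 • (V * A₂) := hg
    beta_reduce
    rw [hS, hg', hg, diagForm_eq]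
    have k0 : M₀ * V - V * Γ = 0 := sub_eq_zero.2 h0
    have k1 : M₁ * V + M₀ * (V * A₁) - (V * A₁ * Γ + V * b) = 0 := sub_eq_zero.2 h1
    have k2 : M₂ * V + M₁ * (V * A₁) + M₀ * (V * A₂) - (V * A₂ * Γ + V * A₁ * b + V * c) = 0 :=
      sub_eq_zero.2 h2
    rw [← sub_eq_zero]
    have key : (M₀ + q • M₁ + q ^ 2 • M₂ + q ^ 3 • M₃ q) * (V + q • (V * A₁) + q ^ 2 • (V * A₂)) -
      ((V + q • (V * A₁) + q ^ 2 • (V * A₂)) * (Γ + q • b + q ^ 2 • c) + q ^ 3 •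
      (M₃ q * (V + q • (V * A₁) + q ^ 2 • (V * A₂)) + (M₁ * (V * A₂) + M₂ * (V * A₁)
    - V * A₁ * c - V * A₂ * b) + q • (M₂ * (V * A₂) - V * A₂ * c))) =
      (M₀ * V - V * Γ) + q • (M₁ * V + M₀ * (V * A₁) - (V * A₁ * Γ + V * b)) +
      q ^ 2 • (M₂ * V + M₁ * (V * A₁) + M₀ * (V * A₂) - (V * A₂ * Γ + V * A₁ * b + V * c)) := by
      simp only [mul_add, add_mul, smul_add, smul_mul_assoc, mul_smul_comm, smul_smul, smul_sub]
      module
    rw [key, k0, k1, k2]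
    simp

end Gauge

end Heis

end

noncomputable section

namespace Heis

open Matrix Filter Set Topology
open scoped Matrix.Norms.Operator

set_option linter.unusedSectionVars false

/-! ### Entire fundamental matrices with prescribed asymptotics -/

section EntireFundamental

variable {A : Type*} [NormedCommRing A] [NormedAlgebra ℂ A] [CompleteSpace A] [NormOneClass A]
  {n : ℕ} {P : ℕ → NC} {γ : Fin n → ℂ}

open NormedSpace (exp)

/-- The companion matrix of the operator. -/
def compSystem (n : ℕ) (P : ℕ → NC) (ν : A) (t : ℂ) : Matrix (Fin n) (Fin n) A :=
  ∑ r ∈ Finset.range (n + 1), t ^ r • compMat n P ν r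

/-- The matrix `diag(t^i)`. -/
def powDiag (A : Type*) [NormedCommRing A] [NormedAlgebra ℂ A] (n : ℕ) (t : ℂ) :
    Matrix (Fin n) (Fin n) A :=
  diagonal fun i => algebraMap ℂ A (t ^ (i : ℕ))

lemma isUnit_powDiag {t : ℂ} (ht : t ≠ 0) : IsUnit (powDiag A n t) := by
  have h : powDiag A n t * powDiag A n t⁻¹ = 1 := by
    rw [powDiag, powDiag, diagonal_mul_diagonal, ← diagonal_one]
    congr 1
    funext i
    rw [← map_mul, ← mul_pow, mul_inv_cancel₀ ht, one_pow, map_one]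
  exact IsUnit.of_mul_eq_one _ h

lemma hasDerivAt_powDiag {p : ℂ} (hp : p ≠ 0) {w : ℂ} (hw : w ∈ Complex.slitPlane) :
    HasDerivAt (fun w => powDiag A n (tMap p w)) ((p ^ 2 / 2) • diagonal fun i : Fin n =>
      (tMap p w ^ (i : ℕ) * qMap p w ^ 2) • (((i : ℕ) : A))) w := by
  refine hasDerivAt_matrix.2 fun i j => ?_
  by_cases h : i = j
  · subst h
    simp only [powDiag, diagonal_apply_eq, Matrix.smul_apply, Algebra.algebraMap_eq_smul_one]
    have := ((hasDerivAt_tMap hp hw).pow (i : ℕ)).smul_const (1 : A)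
    convert! this using 1
    have e : (tMap p w ^ (i : ℕ) * qMap p w ^ 2) * (i : ℕ) =
        (i : ℕ) * tMap p w ^ ((i : ℕ) - 1) * qMap p w := by
      rcases (i : ℕ) with _ | m
      · simp
      · rw [Nat.add_sub_cancel, pow_succ]
        linear_combination (tMap p w ^ m * qMap p w * ((m + 1 : ℕ) : ℂ)) * tMap_mul_qMap (w := w) hp
    rw [← nsmul_one, ← Nat.cast_smul_eq_nsmul ℂ, smul_smul, smul_smul]
    congr 1
    linear_combination (p ^ 2 / 2) * e
  · simp only [powDiag, diagonal_apply_ne _ h, Matrix.smul_apply, smul_zero]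
    exact hasDerivAt_const _ _

/-- The gauge relation for `diag(t^i)`; the factor `q` on the right matches `dt/dw = (p²/2) q`. -/
lemma powDiag_mul_scaledSystem (hn : 2 ≤ n) (hP : ∀ l ≤ n, IsHomog l (P l)) (ν : A) {t q : ℂ}
    (htq : t * q = 1) :
    (diagonal fun i : Fin n => (t ^ (i : ℕ) * q ^ 2) • (((i : ℕ) : A)))
      + powDiag A n t * scaledSystem n P ν q = q • (compSystem n P ν t * powDiag A n t) := by
  ext i j
  have h := compMat_scaledMat (ν := ν) hn hP htq i j
  rw [Matrix.add_apply, powDiag, diagonal_mul, Matrix.smul_apply, mul_diagonal, scaledSystem,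
    compSystem, Matrix.sum_apply, Matrix.sum_apply, ← Algebra.smul_def, mul_comm, ← Algebra.smul_def,
    smul_smul]
  simp only [Matrix.smul_apply]
  rw [← h, add_comm]
  congr 1
  by_cases e : i = j <;> simp [e]

/-- An entire fundamental matrix of the companion system whose first row has the prescribed size
on a cone far out. -/
theorem exists_entire_fundamental_matrix (hn : 2 ≤ n) (hP : IsGeneric n P γ) (ν : A) {p : ℂ}
    (hp : ‖p‖ = 1) {s : ℝ} (hs : 0 < s) (hs1 : s ≤ 1)
    (ha : AdmissibleSlope (fun ij : {ij : Fin n × Fin n // ij.1 ≠ ij.2} =>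
      p ^ 2 * (γ ij.1.1 - γ ij.1.2) / 2) s) :
    ∃ Y Z : ℂ → Matrix (Fin n) (Fin n) A,
      (∀ t, HasDerivAt Y (compSystem n P ν t * Y t) t) ∧
      (∀ t, HasDerivAt Z (-(Z t * compSystem n P ν t)) t) ∧
      (∀ t, Y t * Z t = 1 ∧ Z t * Y t = 1) ∧
      ∃ C x₀ : ℝ, 0 < x₀ ∧ ∀ w ∈ cone s x₀, ∀ k, ∃ a : A, ‖a‖ ≤ C ∧
        Y (tMap p w) ⟨0, by omega⟩ k =
          a * exp (expo p (γ k) (nfBeta P ν γ k) (nfRho P ν γ k) w) := by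
  have hp0 : p ≠ 0 := by rintro rfl; simp at hp
  obtain ⟨F, hF, hMS⟩ := exists_gauge_remainder (ν := ν) hn hP
  obtain ⟨C, hC⟩ := eventually_exists_fundamental_matrix hp hs hs1 (nfBeta P ν γ) (nfRho P ν γ) ha
    differentiable_gauge hF (isUnit_gauge_zero hP.injective) hMS
  obtain ⟨x₀, ⟨T, hT⟩, hx₀⟩ := (hC.and (eventually_gt_atTop 0)).exists
  have hcomp : ∀ r, n + 1 ≤ r → compMat n P ν r = 0 := by
    intro r hr
    ext i j
    rw [compMat, Matrix.of_apply, if_neg (by omega), symCoef_eq_zero hP.homog (by omega)]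
    simp
  obtain ⟨Y, Z, hY, hZ, hYZ⟩ := exists_fundamental_matrix hcomp
  set y : ℂ → Matrix (Fin n) (Fin n) A := fun w => powDiag A n (tMap p w) *
    (T w * expDiag p γ (nfBeta P ν γ) (nfRho P ν γ) w) with hy
  have hyd : ∀ w ∈ cone s x₀, HasDerivAt y
      ((p ^ 2 / 2 * qMap p w) • (compSystem n P ν (tMap p w) * y w)) w := by
    intro w hw
    have h := (hasDerivAt_powDiag (A := A) (n := n) hp0
      (cone_subset_slitPlane hs hx₀ hw)).mul (hT w hw).1
    convert! h using 1
    rw [mul_smul_comm, smul_mul_assoc, ← smul_add, ← mul_assoc (powDiag A n (tMap p w)), ← add_mul,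
      powDiag_mul_scaledSystem hn hP.homog ν (tMap_mul_qMap hp0), smul_mul_assoc, smul_smul,
      mul_assoc]
  -- The cone solution and the entire `Y` solve the same system, so `Y⁻¹ y` is a constant `c`. Then
  -- `Y c` is entire and extends the cone solution.
  have hconst : ∃ c, ∀ w ∈ cone s x₀, Z (tMap p w) * y w = c := by
    have hd : ∀ w ∈ cone s x₀, HasDerivAt (fun w => Z (tMap p w) * y w) 0 w := by
      intro w hw
      have h1 := (hZ (tMap p w)).scomp w (hasDerivAt_tMap hp0 (cone_subset_slitPlane hs hx₀ hw))
      have h := h1.mul (hyd w hw)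
      convert! h using 1
      simp only [Function.comp_apply, compSystem, smul_neg, neg_mul, smul_mul_assoc, mul_smul_comm,
        mul_assoc, neg_add_cancel]
    exact (isOpen_cone s x₀).exists_is_const_of_deriv_eq_zero (convex_cone s x₀).isPreconnected
      (fun w hw => (hd w hw).differentiableAt.differentiableWithinAt) fun w hw => (hd w hw).deriv
  obtain ⟨c, hc⟩ := hconst
  -- A single point of the cone suffices to see that the constant is invertible.
  have hne : ((x₀ + 1 : ℝ) : ℂ) ∈ cone s x₀ := by
    simp [cone, hs]
  have hcu : IsUnit c := by
    rw [← hc _ hne]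
    exact (IsUnit.of_mul_eq_one _ (hYZ _).2).mul ((isUnit_powDiag (tMap_ne_zero hp0)).mul
      ((hT _ hne).2.1.mul (isUnit_expDiag _ _ _ _ _)))
  obtain ⟨u, rfl⟩ := hcu
  refine ⟨fun t => Y t * u, fun t => (u⁻¹ : (Matrix (Fin n) (Fin n) A)ˣ) * Z t, fun t => ?_,
    fun t => ?_, fun t => ⟨?_, ?_⟩, C, x₀, hx₀, fun w hw k => ⟨T w ⟨0, by omega⟩ k,
      (norm_entry_le _ _ _).trans (hT w hw).2.2, ?_⟩⟩
  · convert! (hY t).mul_const (u : Matrix (Fin n) (Fin n) A) using 1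
    rw [mul_assoc]
    rfl
  · convert! (hZ t).const_mul ((u⁻¹ : (Matrix (Fin n) (Fin n) A)ˣ) : Matrix (Fin n) (Fin n) A)
      using 1
    rw [mul_neg, mul_assoc]
    rfl
  · rw [mul_assoc, ← mul_assoc (u : Matrix (Fin n) (Fin n) A), Units.mul_inv, one_mul, (hYZ t).1]
  · rw [mul_assoc, ← mul_assoc (Z t), (hYZ t).2, one_mul, Units.inv_mul]
  · beta_reduce
    -- In row `0` the rescaling factor is `t^0 = 1`, so the entry carries no power of `t` besides
    -- the one in the exponent.
    rw [← hc w hw, ← mul_assoc, (hYZ _).1, one_mul, hy]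
    simp only [powDiag, expDiag, diagonal_mul, mul_diagonal]
    simp

end EntireFundamental

end Heis

end

noncomputable section

namespace Heis

open Filter Set Topology
open scoped NNReal

/-! ### An algebra of holomorphic functions on a disc -/

section DiscAlgebra

/-- Uniform limits of polynomials on the closed disc of radius `B`. -/
def discAlgebra (B : ℝ≥0) : Subalgebra ℂ C(Metric.closedBall (0 : ℂ) B, ℂ) :=
  (polynomialFunctions (Metric.closedBall (0 : ℂ) B)).topologicalClosure

variable (B : ℝ≥0)

instance : NormedCommRing (discAlgebra B) := inferInstance

instance : NormedAlgebra ℂ (discAlgebra B) := inferInstance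

instance : CompleteSpace (discAlgebra B) :=
  (Subalgebra.isClosed_topologicalClosure _).completeSpace_coe

instance : NormOneClass (discAlgebra B) where
  norm_one := by
    have : Nonempty (Metric.closedBall (0 : ℂ) B) := ⟨⟨0, by simp⟩⟩
    exact (norm_one : ‖(1 : C(Metric.closedBall (0 : ℂ) B, ℂ))‖ = 1)

/-- The coordinate function. -/
def discCoord : discAlgebra B :=
  ⟨Polynomial.toContinuousMapOn Polynomial.X _, Subalgebra.le_topologicalClosure _
    ⟨Polynomial.X, trivial, rfl⟩⟩

variable {B}

/-- Evaluation at a point of the disc. -/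
def discEval (z : Metric.closedBall (0 : ℂ) B) : discAlgebra B →ₐ[ℂ] ℂ :=
  (ContinuousMap.evalAlgHom ℂ ℂ z).comp (discAlgebra B).val

lemma discEval_coord (z : Metric.closedBall (0 : ℂ) B) : discEval z (discCoord B) = z := by
  simp [discEval, discCoord]

lemma norm_discEval_le (z : Metric.closedBall (0 : ℂ) B) (a : discAlgebra B) :
    ‖discEval z a‖ ≤ ‖a‖ :=
  ContinuousMap.norm_coe_le_norm (a : C(Metric.closedBall (0 : ℂ) B, ℂ)) z

/-- Evaluation as a continuous linear map. -/
def discEvalL (z : Metric.closedBall (0 : ℂ) B) : discAlgebra B →L[ℂ] ℂ :=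
  LinearMap.mkContinuous (discEval z).toLinearMap 1 fun a =>
    (norm_discEval_le z a).trans_eq (one_mul _).symm

/-- Evaluation is a continuous algebra homomorphism, hence commutes with `exp`: the exponential
factor in the algebra specializes to the one for each `μ`. -/
lemma discEval_exp (z : Metric.closedBall (0 : ℂ) B) (a : discAlgebra B) :
    discEval z (NormedSpace.exp a) = Complex.exp (discEval z a) := by
  let _ : NormedAlgebra ℚ (discAlgebra B) := NormedAlgebra.restrictScalars ℚ ℂ _
  rw [Complex.exp_eq_exp_ℂ]
  exact NormedSpace.map_exp (discEval z) (discEvalL z).continuous a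

open Classical in
/-- Evaluation, extended by zero outside of the disc. -/
def discFun (a : discAlgebra B) (z : ℂ) : ℂ :=
  if h : z ∈ Metric.closedBall (0 : ℂ) B then discEval ⟨z, h⟩ a else 0

lemma discFun_of_mem (a : discAlgebra B) {z : ℂ} (h : z ∈ Metric.closedBall (0 : ℂ) B) :
    discFun a z = discEval ⟨z, h⟩ a := dif_pos h

/-- Elements of the algebra are holomorphic inside the disc. -/
lemma differentiableOn_discFun (a : discAlgebra B) :
    DifferentiableOn ℂ (discFun a) (Metric.ball 0 B) := by
  obtain ⟨u, hu, hlim⟩ := mem_closure_iff_seq_limit.1 (show (a : C(Metric.closedBall (0 : ℂ) B, ℂ)) ∈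
    closure (polynomialFunctions (Metric.closedBall (0 : ℂ) B) :
      Set C(Metric.closedBall (0 : ℂ) B, ℂ)) from a.2)
  choose q _ hq using hu
  have hunif := ContinuousMap.tendsto_iff_tendstoUniformly.1 hlim
  have h : TendstoUniformlyOn (fun m z => (q m).eval z) (discFun a) atTop (Metric.ball 0 B) := by
    rw [Metric.tendstoUniformlyOn_iff]
    intro ε hε
    filter_upwards [Metric.tendstoUniformly_iff.1 hunif ε hε] with m hm z hz
    have hz' := Metric.ball_subset_closedBall hz
    rw [discFun_of_mem a hz']
    convert! hm ⟨z, hz'⟩ using 2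
    rw [← hq m]
    simp
  exact h.tendstoLocallyUniformlyOn.differentiableOn
    (Eventually.of_forall fun m => (q m).differentiable.differentiableOn) Metric.isOpen_ball

end DiscAlgebra

end Heis

end

noncomputable section

namespace Heis

open Matrix Filter Set Topology
open scoped Matrix.Norms.Operator

set_option linter.unusedSectionVars false

/-! ### The kernel of the operator -/

section Kernel

variable {n : ℕ} {P : ℕ → NC}

lemma tOp_pow_apply (a : ℕ) (f : Entire) (t : ℂ) : ((tOp ^ a) f).1 t = t ^ a * f.1 t := by
  induction a with
  | zero => simp
  | succ a ih =>
    rw [pow_succ', Module.End.mul_apply, pow_succ', mul_assoc, ← ih]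
    rfl

lemma hasDerivAt_dOp_pow (b : ℕ) (f : Entire) (t : ℂ) :
    HasDerivAt ((dOp ^ b) f).1 (((dOp ^ (b + 1)) f).1 t) t := by
  rw [pow_succ', Module.End.mul_apply]
  exact (((dOp ^ b) f).2 t).hasDerivAt

lemma entire_sum_apply {ι : Type*} (s : Finset ι) (f : ι → Entire) (t : ℂ) :
    (∑ i ∈ s, f i).1 t = ∑ i ∈ s, (f i).1 t := by
  rw [show (∑ i ∈ s, f i).1 = ∑ i ∈ s, (f i).1 from Submodule.coe_sum _ _ _, Finset.sum_apply]

/-- In degree `n` the only term with `∂^n` is `∂^n` itself, with coefficient `1`, so the equation is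
monic and has no singular points. -/
lemma opL_apply (hP : ∀ l ≤ n, IsHomog l (P l)) (h1 : normCoeff (P n) 0 n = 1) (μ : ℂ)
    (f : Entire) (t : ℂ) : (opL n P μ f).1 t = ((dOp ^ n) f).1 t +
      ∑ b ∈ Finset.range n, (∑ a ∈ Finset.range (n + 1), t ^ a * symCoef n P μ⁻¹ a b) *
        ((dOp ^ b) f).1 t := by
  have h2 : opL n P μ f = ∑ b ∈ Finset.range (n + 1), ∑ a ∈ Finset.range (n + 1),
      symCoef n P μ⁻¹ a b • ((tOp ^ a) ((dOp ^ b) f)) := by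
    have e : opL n P μ = ∑ l ∈ Finset.range (n + 1), ∑ b ∈ Finset.range (n + 1),
        ∑ a ∈ Finset.range (n + 1),
        (μ⁻¹ ^ (n - l) * normCoeff (P l) a b) • (tOp ^ a * dOp ^ b) := by
      refine Finset.sum_congr rfl fun l hl => ?_
      have hl := Finset.mem_range.1 hl
      rw [opOf_eq_sum (by omega : l ≤ n) (hP l (by omega))]
      simp only [Finset.smul_sum, smul_smul, inv_pow]
    rw [e, Finset.sum_comm]
    simp only [LinearMap.sum_apply, LinearMap.smul_apply, Module.End.mul_apply]
    refine Finset.sum_congr rfl fun b _ => ?_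
    rw [Finset.sum_comm]
    refine Finset.sum_congr rfl fun a _ => ?_
    rw [← Finset.sum_smul]
    rfl
  have h3 : (opL n P μ f).1 t = ∑ b ∈ Finset.range (n + 1),
      (∑ a ∈ Finset.range (n + 1), t ^ a * symCoef n P μ⁻¹ a b) * ((dOp ^ b) f).1 t := by
    rw [h2, entire_sum_apply]
    refine Finset.sum_congr rfl fun b _ => ?_
    rw [entire_sum_apply, Finset.sum_mul]
    refine Finset.sum_congr rfl fun a _ => ?_
    change symCoef n P μ⁻¹ a b * ((tOp ^ a) ((dOp ^ b) f)).1 t = _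
    rw [tOp_pow_apply]
    ring
  rw [h3, Finset.sum_range_succ, add_comm]
  congr 1
  rw [Finset.sum_eq_single 0]
  · rw [symCoef_of_add_eq hP (zero_add n), h1]
    simp
  · intro a _ ha
    rw [symCoef_eq_zero hP (by omega), mul_zero]
  · simp

/-- The matrix all of whose columns consist of the derivatives of `f`. -/
def jet (n : ℕ) (f : Entire) (t : ℂ) : Matrix (Fin n) (Fin n) ℂ :=
  Matrix.of fun i _ => ((dOp ^ (i : ℕ)) f).1 t

lemma compSystem_apply (ν t : ℂ) (i j : Fin n) : compSystem n P ν t i j =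
    (if (j : ℕ) = i + 1 then 1 else 0) - (if (i : ℕ) + 1 = n then
      ∑ a ∈ Finset.range (n + 1), t ^ a * symCoef n P ν a j else 0) := by
  simp only [compSystem, Matrix.sum_apply, Matrix.smul_apply, compMat, Matrix.of_apply, smul_eq_mul,
    mul_sub, Finset.sum_sub_distrib]
  congr 1
  · rw [Finset.sum_eq_single 0] <;> simp +contextual
  · by_cases h : (i : ℕ) + 1 = n <;> simp [h]

lemma compSystem_mul_apply (ν t : ℂ) (X : Matrix (Fin n) (Fin n) ℂ) (i k : Fin n) :
    (compSystem n P ν t * X) i k = if h : (i : ℕ) + 1 < n then X ⟨i + 1, h⟩ k else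
      -∑ j : Fin n, (∑ a ∈ Finset.range (n + 1), t ^ a * symCoef n P ν a j) * X j k := by
  rw [Matrix.mul_apply]
  by_cases h : (i : ℕ) + 1 < n
  · rw [dif_pos h, Finset.sum_eq_single (⟨i + 1, h⟩ : Fin n)]
    · rw [compSystem_apply, if_pos rfl, if_neg (by omega), sub_zero, one_mul]
    · intro j _ hj
      rw [compSystem_apply, if_neg fun e => hj (Fin.ext e), if_neg (by omega), sub_zero, zero_mul]
    · simp
  · rw [dif_neg h, ← Finset.sum_neg_distrib]
    refine Finset.sum_congr rfl fun j _ => ?_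
    have hi := i.2
    have hj := j.2
    rw [compSystem_apply, if_neg (by omega), if_pos (by omega), zero_sub, neg_mul]

/-- All rows but the last hold automatically by definition of the jet; the last row is the equation.
Repeating the jet in every column lets the square inverse `Z` act within one matrix ring. -/
lemma mem_ker_iff (hP : ∀ l ≤ n, IsHomog l (P l)) (h1 : normCoeff (P n) 0 n = 1) (hn : 2 ≤ n)
    (μ : ℂ) (f : Entire) : f ∈ LinearMap.ker (opL n P μ) ↔
      ∀ t, HasDerivAt (jet n f) (compSystem n P μ⁻¹ t * jet n f t) t := by
  have hL : f ∈ LinearMap.ker (opL n P μ) ↔ ∀ t, (opL n P μ f).1 t = 0 := by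
    rw [LinearMap.mem_ker]
    exact ⟨fun h t => by rw [h]; rfl, fun h => Subtype.ext (funext h)⟩
  rw [hL]
  refine forall_congr' fun t => ?_
  rw [opL_apply hP h1, hasDerivAt_matrix, Finset.sum_range]
  constructor
  · intro h i k
    have hd := hasDerivAt_dOp_pow i f t
    rw [compSystem_mul_apply]
    by_cases hi : (i : ℕ) + 1 < n
    · rw [dif_pos hi]
      exact hd
    · rw [dif_neg hi]
      convert! hd using 1
      have hi' : (i : ℕ) + 1 = n := by have := i.2; omega
      rw [hi']
      exact (eq_neg_of_add_eq_zero_left h).symm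
  · intro h
    have hd := h ⟨n - 1, by omega⟩ ⟨n - 1, by omega⟩
    rw [compSystem_mul_apply, dif_neg (by simp; omega)] at hd
    have hd' := hasDerivAt_dOp_pow (n - 1) f t
    rw [Nat.sub_add_cancel (by omega)] at hd'
    rw [hd'.unique hd]
    simp [jet]

/-- The first row of a fundamental matrix of the companion system gives a basis of the kernel. -/
theorem kernel_basis (hP : ∀ l ≤ n, IsHomog l (P l)) (h1 : normCoeff (P n) 0 n = 1) (hn : 2 ≤ n)
    (μ : ℂ) {Y Z : ℂ → Matrix (Fin n) (Fin n) ℂ}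
    (hY : ∀ t, HasDerivAt Y (compSystem n P μ⁻¹ t * Y t) t)
    (hZ : ∀ t, HasDerivAt Z (-(Z t * compSystem n P μ⁻¹ t)) t)
    (hYZ : ∀ t, Y t * Z t = 1 ∧ Z t * Y t = 1) {φ : Fin n → Entire}
    (hφ : ∀ k t, (φ k).1 t = Y t ⟨0, by omega⟩ k) :
    LinearIndependent ℂ φ ∧ Submodule.span ℂ (Set.range φ) = LinearMap.ker (opL n P μ) := by
  have hjet : ∀ k t (i : ℕ) (hi : i < n), ((dOp ^ i) (φ k)).1 t = Y t ⟨i, hi⟩ k := by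
    intro k t i
    induction i generalizing t with
    | zero => intro hi; rw [pow_zero]; exact hφ k t
    | succ i ih =>
      intro hi
      have h2 := hasDerivAt_matrix.1 (hY t) ⟨i, by omega⟩ k
      rw [compSystem_mul_apply, dif_pos hi] at h2
      have h3 := hasDerivAt_dOp_pow i (φ k) t
      have e : ((dOp ^ i) (φ k)).1 = fun t => Y t ⟨i, by omega⟩ k := funext fun t => ih t (by omega)
      rw [e] at h3
      exact h3.unique h2
  have hker : ∀ k, φ k ∈ LinearMap.ker (opL n P μ) := by
    intro k
    rw [mem_ker_iff hP h1 hn]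
    intro t
    refine hasDerivAt_matrix.2 fun i j => ?_
    have h2 := hasDerivAt_matrix.1 (hY t) i k
    have e : (fun t => jet n (φ k) t i j) = fun t => Y t i k := funext fun t => hjet k t i i.2
    rw [e]
    convert! h2 using 1
    rw [Matrix.mul_apply, Matrix.mul_apply]
    exact Finset.sum_congr rfl fun m _ => congrArg _ (hjet k t m m.2)
  refine ⟨?_, le_antisymm (Submodule.span_le.2 ?_) fun f hf => ?_⟩
  · rw [Fintype.linearIndependent_iff]
    intro g hg
    have h2 : Y 0 *ᵥ g = 0 := by
      funext i
      have h3 := congrArg (fun f : Entire => ((dOp ^ (i : ℕ)) f).1 0) hg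
      simp only [map_sum, map_smul, map_zero] at h3
      rw [entire_sum_apply] at h3
      rw [Matrix.mulVec, dotProduct, Pi.zero_apply]
      refine Eq.trans (Finset.sum_congr rfl fun k _ => ?_) h3
      rw [← hjet k 0 i i.2, mul_comm]
      rfl
    have h4 : g = 0 := by
      calc g = (Z 0 * Y 0) *ᵥ g := by rw [(hYZ 0).2, one_mulVec]
        _ = 0 := by rw [← mulVec_mulVec, h2, mulVec_zero]
    exact fun i => congrFun h4 i
  · rintro _ ⟨k, rfl⟩
    exact hker k
  · rw [mem_ker_iff hP h1 hn] at hf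
    -- Hence the jet is `Y` times a constant matrix, and its corner entry expresses `f` in the `φ
    -- k`.
    have hd : ∀ t, HasDerivAt (fun t => Z t * jet n f t) 0 t := fun t => by
      convert! (hZ t).mul (hf t) using 1
      noncomm_ring
    have hc := fun t => is_const_of_deriv_eq_zero (fun t => (hd t).differentiableAt)
      (fun t => (hd t).deriv) t 0
    have hj : ∀ t, jet n f t = Y t * (Z 0 * jet n f 0) := fun t => by
      rw [← hc t, ← mul_assoc, (hYZ t).1, one_mul]
    have hf' : f = ∑ k, (Z 0 * jet n f 0) k ⟨0, by omega⟩ • φ k := by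
      refine Subtype.ext (funext fun t => ?_)
      rw [entire_sum_apply]
      have h5 := congrFun (congrFun (hj t) ⟨0, by omega⟩) ⟨0, by omega⟩
      rw [Matrix.mul_apply] at h5
      refine (show f.1 t = _ from h5).trans (Finset.sum_congr rfl fun k _ => ?_)
      rw [← hφ k t, mul_comm]
      rfl
    rw [hf']
    exact Submodule.sum_mem _ fun k _ => Submodule.smul_mem _ _ (Submodule.subset_span ⟨k, rfl⟩)

end Kernel

end Heis

end

noncomputable section

namespace Heis

open Matrix Filter Set Topology
open scoped NNReal Matrix.Norms.Operator

/-! ### Geometry of the sectors -/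

section Sector

/-- Division by `p = ε e^{-iα}` turns the axis of the sector into the positive real direction. The
centre of the disc goes to `εi`, and `r = εs`, `φ = θ - α`. -/
lemma exists_of_mem_sector {α υ ε : ℝ} (hε : ε = 1 ∨ ε = -1) {t : ℂ}
    (ht : t ∈ sector (Metric.closedBall (Complex.exp (-(Complex.I * α)) * Complex.I) (1 / 4))
      α (-υ) υ ε) : ∃ r φ : ℝ, 0 < r ∧ |φ| < υ ∧
      ‖t / (ε * Complex.exp (-(Complex.I * α))) - ⟨r * Real.cos φ, ε - r * Real.sin φ⟩‖ ≤ 1 / 4 := by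
  obtain ⟨z, hz, s, θ, hs, h1, h2, rfl⟩ := ht
  refine ⟨ε * s, θ - α, hs, abs_lt.2 ⟨h1, h2⟩, ?_⟩
  have hε2 : (ε : ℂ) * ε = 1 := by rcases hε with rfl | rfl <;> norm_num
  have hε0 : (ε : ℂ) ≠ 0 := by rintro h; simp [h] at hε2
  have e1 := Complex.exp_ne_zero (-(Complex.I * α))
  have e2 : (⟨ε * s * Real.cos (θ - α), ε - ε * s * Real.sin (θ - α)⟩ : ℂ) =
      ε * Complex.I + ε * s * Complex.exp (-(Complex.I * (θ - α))) := by
    have : Complex.exp (-(Complex.I * (θ - α))) =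
        Real.cos (θ - α) - Real.sin (θ - α) * Complex.I := by
      rw [show -(Complex.I * ((θ : ℂ) - α)) = ((-(θ - α) : ℝ) : ℂ) * Complex.I by push_cast; ring,
        Complex.exp_mul_I, ← Complex.ofReal_cos, ← Complex.ofReal_sin, Real.cos_neg, Real.sin_neg]
      push_cast; ring
    rw [this]
    apply Complex.ext <;> simp [-Complex.ofReal_cos, -Complex.ofReal_sin]
    ring
  have e3 : Complex.exp (-(Complex.I * θ)) =
      Complex.exp (-(Complex.I * (θ - α))) * Complex.exp (-(Complex.I * α)) := by
    rw [← Complex.exp_add]; ring_nf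
  have e4 : (z + s * Complex.exp (-(Complex.I * θ))) / (ε * Complex.exp (-(Complex.I * α))) -
      (ε * Complex.I + ε * s * Complex.exp (-(Complex.I * (θ - α)))) =
      (z - Complex.exp (-(Complex.I * α)) * Complex.I) / (ε * Complex.exp (-(Complex.I * α))) := by
    rw [e3]
    field_simp
    linear_combination (-(Complex.exp (-(Complex.I * α)) * Complex.I) - s *
      Complex.exp (-(Complex.I * (θ - α))) * Complex.exp (-(Complex.I * α))) * hε2
  have n1 : ‖Complex.exp (-(Complex.I * α))‖ = 1 := by simp [Complex.norm_exp]
  have n2 : ‖(ε : ℂ)‖ = 1 := by rcases hε with rfl | rfl <;> simp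
  rw [e2, e4, norm_div, norm_mul, n1, n2, mul_one, div_one]
  exact mem_closedBall_iff_norm.1 hz

/-- For `Re(z/p) > 0` the argument is below `π/2`, so doubling it stays in the principal branch. -/
lemma tMap_div_sq {p z : ℂ} (hp : p ≠ 0) (hz : 0 < (z / p).re) : tMap p ((z / p) ^ 2) = z := by
  have h0 : z / p ≠ 0 := by rintro h; simp [h] at hz
  have harg := abs_lt.1 (Complex.abs_arg_lt_pi_div_two_iff.2 (Or.inl hz))
  have h : Complex.log ((z / p) ^ 2) = 2 * Complex.log (z / p) := by
    have e : (z / p) ^ 2 = Complex.exp (2 * Complex.log (z / p)) := by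
      rw [two_mul, Complex.exp_add, Complex.exp_log h0, sq]
    have him : (2 * Complex.log (z / p)).im = 2 * Complex.arg (z / p) := by
      simp [Complex.log_im]
    rw [e, Complex.log_exp] <;> rw [him] <;> linarith
  rw [tMap, h, mul_div_cancel_left₀ _ two_ne_zero, Complex.exp_log h0, mul_div_cancel₀ _ hp]

lemma sq_mem_cone {s x₀ : ℝ} (hs : 0 < s) (hs1 : s ≤ 1) {u : ℂ} (hy : |u.im| ≤ s / 8 * u.re)
    (hx : 0 < u.re) (hx₀ : 2 * x₀ < u.re ^ 2) : u ^ 2 ∈ cone s x₀ := by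
  have e1 : (u ^ 2).re = u.re ^ 2 - u.im ^ 2 := by rw [sq, Complex.mul_re]; ring
  have e2 : (u ^ 2).im = 2 * u.re * u.im := by rw [sq, Complex.mul_im]; ring
  simp only [cone, mem_ofPred_eq]
  rw [e1, e2, abs_mul, abs_of_pos (by linarith : 0 < 2 * u.re)]
  have hy2 : u.im ^ 2 ≤ u.re ^ 2 / 64 := by
    have : |u.im| ≤ u.re / 8 := hy.trans (by nlinarith)
    rw [← sq_abs]
    nlinarith [abs_nonneg u.im]
  calc 2 * u.re * |u.im| ≤ 2 * u.re * (s / 8 * u.re) := by gcongr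
    _ = s * (u.re ^ 2 / 4) := by ring
    _ < s * (u.re ^ 2 - u.im ^ 2 - x₀) := by
      refine mul_lt_mul_of_pos_left ?_ hs
      linarith [sq_nonneg u.re, pow_pos hx 2]

/-- The unit disc around `t`, and not only `t`, must lie in the image of the cone so that Cauchy's
estimate applies. The bound `1/2 ≤ ‖t‖` keeps `ln|t|` under control. -/
lemma sector_geometry {s x₀ : ℝ} (hs : 0 < s) (hs1 : s ≤ 1) (hx₀ : 0 < x₀) :
    ∃ R : ℝ, 2 ≤ R ∧ ∀ α ε : ℝ, (ε = 1 ∨ ε = -1) →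
      ∀ t ∈ sector (Metric.closedBall (Complex.exp (-(Complex.I * α)) * Complex.I) (1 / 4))
        α (-(s / 32)) (s / 32) ε,
      1 / 2 ≤ ‖t‖ ∧ (R ≤ ‖t‖ → ∀ z ∈ Metric.closedBall t 1,
        ∃ w ∈ cone s x₀, tMap (ε * Complex.exp (-(Complex.I * α))) w = z) := by
  have hs0 : 0 < 40 / s := by positivity
  have hs40 : 40 / s * s = 40 := div_mul_cancel₀ _ hs.ne'
  -- The term `40 / s` makes the imaginary offset `1 + 5/4` small against `s r`, and `2 (x₀ + 1)`
  -- puts the square of the point beyond the apex.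
  refine ⟨40 / s + 6 + 2 * (x₀ + 1), by linarith, fun α ε hε t ht => ?_⟩
  obtain ⟨r, φ, hr, hφ, hd⟩ := exists_of_mem_sector hε ht
  set p : ℂ := ε * Complex.exp (-(Complex.I * α)) with hp
  have hε2 : ε ^ 2 = 1 := by rcases hε with rfl | rfl <;> norm_num
  have hεabs : |ε| = 1 := by rcases hε with rfl | rfl <;> norm_num
  have hpn : ‖p‖ = 1 := by
    rw [hp, norm_mul, Complex.norm_real, Real.norm_eq_abs, hεabs]
    simp [Complex.norm_exp]
  have hp0 : p ≠ 0 := by rintro h; simp [h] at hpn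
  have htn : ‖t / p‖ = ‖t‖ := by rw [norm_div, hpn, div_one]
  have hsin : |Real.sin φ| ≤ s / 32 := Real.abs_sin_le_abs.trans hφ.le
  have hcos : 15 / 16 ≤ Real.cos φ := by
    have h1 := Real.one_sub_sq_div_two_le_cos (x := φ)
    have h2 : φ ^ 2 ≤ (1 / 32) ^ 2 := sq_le_sq' (by linarith [(abs_lt.1 hφ).1])
      (by linarith [(abs_lt.1 hφ).2])
    linarith
  have hcos1 := Real.cos_le_one φ
  set q : ℂ := ⟨r * Real.cos φ, ε - r * Real.sin φ⟩ with hq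
  have hqsq : ‖q‖ ^ 2 = r ^ 2 + 1 - 2 * r * (ε * Real.sin φ) := by
    rw [Complex.sq_norm, Complex.normSq_mk]
    linear_combination r ^ 2 * Real.sin_sq_add_cos_sq φ + hε2
  have hes : |ε * Real.sin φ| ≤ 1 / 32 := by
    rw [abs_mul, hεabs, one_mul]; linarith
  have hes' := abs_le.1 hes
  have htri : ‖q‖ - ‖t / p‖ ≤ 1 / 4 := by
    refine (norm_sub_norm_le _ _).trans ?_
    rwa [norm_sub_rev]
  have htri' : ‖t / p‖ - ‖q‖ ≤ 1 / 4 := (norm_sub_norm_le _ _).trans hd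
  rw [htn] at htri htri'
  constructor
  -- Directions near the axis starting at `εi` miss `0`: `‖q‖² ≥ r² + 1 - r/16`, and the radius
  -- `1/4` of the disc costs the rest.
  · have : (3 / 4) ^ 2 ≤ ‖q‖ ^ 2 := by
      rw [hqsq]
      have := mul_le_mul_of_nonneg_left hes'.2 hr.le
      linarith [sq_nonneg (r - 1 / 32)]
    have := le_of_sq_le_sq this (norm_nonneg _)
    linarith
  · intro hR z hz
    have hqr : ‖q‖ ≤ r + 1 := by
      refine abs_le_of_sq_le_sq' ?_ (by linarith) |>.2
      rw [hqsq]
      have := mul_le_mul_of_nonneg_left hes'.1 hr.le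
      linarith
    have hrlarge : 40 / s + 4 + 2 * (x₀ + 1) ≤ r := by linarith
    have hdz : ‖z / p - q‖ ≤ 5 / 4 := by
      have e : z / p - q = (z - t) / p + (t / p - q) := by ring
      rw [e]
      refine (norm_add_le _ _).trans ?_
      rw [norm_div, hpn, div_one]
      have := mem_closedBall_iff_norm.1 hz
      linarith
    have hre := abs_le.1 ((Complex.abs_re_le_norm _).trans hdz)
    have him := abs_le.1 ((Complex.abs_im_le_norm _).trans hdz)
    rw [Complex.sub_re] at hre
    rw [Complex.sub_im] at him
    simp only [hq] at hre him
    set x := (z / p).re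
    set y := (z / p).im
    have hx : r * (15 / 16) - 5 / 4 ≤ x := by
      have : r * (15 / 16) ≤ r * Real.cos φ := by gcongr
      linarith [hre.1]
    have hsr : |r * Real.sin φ| ≤ r * (s / 32) := by
      rw [abs_mul, abs_of_pos hr]; gcongr
    have hsr' := abs_le.1 hsr
    have hε' := abs_le.1 hεabs.le
    have hy : |y| ≤ s / 8 * x := by
      have h1 : s * (40 / s) ≤ s * r := by gcongr; linarith
      have h2 : s / 8 * (r * (15 / 16) - 5 / 4) ≤ s / 8 * x := by gcongr
      have h3 : s * (40 / s) = 40 := by rw [mul_comm, hs40]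
      rw [abs_le]
      constructor
      · linarith [him.1, hsr'.2, hε'.1]
      · linarith [him.2, hsr'.1, hε'.2]
    have hx0 : 0 < x := by linarith
    have hxsq : 2 * x₀ < x ^ 2 := by
      have : x₀ + 1 ≤ x := by linarith
      nlinarith
    exact ⟨(z / p) ^ 2, sq_mem_cone hs hs1 hy hx0 hxsq, tMap_div_sq hp0 hx0⟩

end Sector

/-! ### Estimates of derivatives -/

section Estimates

/-- The exponent with given coefficients. -/
def phase (γ β ρ t : ℂ) : ℂ := γ * (t ^ 2 / 2) + β * t + ρ * (Real.log ‖t‖ : ℂ)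

/-- The exponent uses `log √w`, and `Φ` uses `ln|t|`. They differ by `i (arg w)/2`, of modulus at
most `2`, which contributes a bounded factor. -/
lemma norm_exp_expo_le {p γ β ρ w : ℂ} (hp : ‖p‖ = 1) (hw : w ≠ 0) :
    ‖Complex.exp (expo p γ β ρ w)‖ ≤
      Real.exp (2 * ‖ρ‖) * ‖Complex.exp (phase γ β ρ (tMap p w))‖ := by
  have h1 : Real.log ‖w‖ = 2 * Real.log ‖tMap p w‖ := by
    rw [← norm_tMap_sq hp hw, Real.log_pow]; norm_num
  have h2 : expo p γ β ρ w = phase γ β ρ (tMap p w) + ρ * (Complex.arg w / 2 * Complex.I) := by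
    have h3 : Complex.log w = Real.log ‖w‖ + Complex.arg w * Complex.I := rfl
    rw [expo, phase, tMap_sq hw, h3, h1, Algebra.algebraMap_self_apply, smul_eq_mul, smul_eq_mul]
    push_cast
    ring
  rw [h2, Complex.exp_add, norm_mul, mul_comm]
  refine mul_le_mul_of_nonneg_right ?_ (norm_nonneg _)
  rw [Complex.norm_exp, Real.exp_le_exp]
  refine (Complex.re_le_norm _).trans ?_
  have h4 : ‖(Complex.arg w / 2 * Complex.I : ℂ)‖ ≤ 2 := by
    have := Complex.abs_arg_le_pi w
    have := Real.pi_lt_four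
    simp
    linarith
  rw [norm_mul, mul_comm]
  gcongr

/-- The phase has derivative of order `|t|`, so it moves by `O(1)` over a distance `1/(1+|t|)`; this
is the source of the factor `(1+|t|)^j`. -/
lemma norm_phase_sub_le {γ β ρ t z : ℂ} (ht : 2 ≤ ‖t‖) (hz : ‖z - t‖ ≤ (1 + ‖t‖)⁻¹) :
    ‖phase γ β ρ z - phase γ β ρ t‖ ≤ ‖γ‖ + ‖β‖ + ‖ρ‖ := by
  have h0 : (1 + ‖t‖)⁻¹ ≤ 1 := inv_le_one_of_one_le₀ (by linarith)
  have h1 := norm_sub_norm_le t z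
  rw [norm_sub_rev] at h1
  have h2 := norm_sub_norm_le z t
  have hsq : ‖z ^ 2 / 2 - t ^ 2 / 2‖ ≤ 1 := by
    have e : z ^ 2 / 2 - t ^ 2 / 2 = (z - t) * (z + t) / 2 := by ring
    have h3 : ‖z + t‖ ≤ 2 * (1 + ‖t‖) := (norm_add_le _ _).trans (by linarith)
    rw [e, norm_div, norm_mul]
    have h4 : ‖z - t‖ * ‖z + t‖ ≤ (1 + ‖t‖)⁻¹ * (2 * (1 + ‖t‖)) := by gcongr
    have h5 : (1 + ‖t‖)⁻¹ * (2 * (1 + ‖t‖)) = 2 := by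
      have : 1 + ‖t‖ ≠ 0 := by positivity
      field_simp
    rw [Complex.norm_ofNat]
    linarith
  have hlog : ‖((Real.log ‖z‖ : ℝ) : ℂ) - (Real.log ‖t‖ : ℝ)‖ ≤ 1 := by
    have pz : 0 < ‖z‖ := by linarith
    have pt : 0 < ‖t‖ := by linarith
    rw [← Complex.ofReal_sub, Complex.norm_real, Real.norm_eq_abs, abs_le]
    constructor
    · have := Real.log_le_sub_one_of_pos (div_pos pt pz)
      rw [Real.log_div pt.ne' pz.ne'] at this
      have h6 : ‖t‖ / ‖z‖ ≤ 2 := by rw [div_le_iff₀ pz]; linarith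
      linarith
    · have := Real.log_le_sub_one_of_pos (div_pos pz pt)
      rw [Real.log_div pz.ne' pt.ne'] at this
      have h6 : ‖z‖ / ‖t‖ ≤ 2 := by rw [div_le_iff₀ pt]; linarith
      linarith
  have e : phase γ β ρ z - phase γ β ρ t = γ * (z ^ 2 / 2 - t ^ 2 / 2) + β * (z - t) +
      ρ * ((Real.log ‖z‖ : ℝ) - (Real.log ‖t‖ : ℝ)) := by rw [phase, phase]; ring
  rw [e]
  refine norm_add₃_le.trans ?_
  rw [norm_mul, norm_mul, norm_mul]
  have := hz.trans h0
  gcongr <;> exact mul_le_of_le_one_right (norm_nonneg _) ‹_›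

/-- On `1/2 ≤ |t| ≤ R` this bounds `|e^Φ|` from below, so boundedness of the solution is enough
there. -/
lemma norm_phase_le {γ β ρ t : ℂ} {R : ℝ} (h1 : 1 / 2 ≤ ‖t‖) (h2 : ‖t‖ ≤ R) :
    ‖phase γ β ρ t‖ ≤ ‖γ‖ * R ^ 2 + ‖β‖ * R + ‖ρ‖ * (R + 1) := by
  have pt : 0 < ‖t‖ := by linarith
  have hlog : ‖((Real.log ‖t‖ : ℝ) : ℂ)‖ ≤ R + 1 := by
    rw [Complex.norm_real, Real.norm_eq_abs, abs_le]
    constructor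
    · have := Real.log_le_sub_one_of_pos (inv_pos.2 pt)
      rw [Real.log_inv] at this
      have h6 : ‖t‖⁻¹ ≤ 2 := by rw [inv_le_comm₀ pt two_pos]; linarith
      linarith
    · have := Real.log_le_sub_one_of_pos pt
      linarith
  refine norm_add₃_le.trans ?_
  rw [norm_mul, norm_mul, norm_mul, norm_div, norm_pow, Complex.norm_ofNat]
  have : ‖t‖ ^ 2 / 2 ≤ R ^ 2 := by
    have : ‖t‖ ^ 2 ≤ R ^ 2 := by gcongr
    nlinarith [sq_nonneg R]
  gcongr

/-- Cauchy's estimate with radius `1/(1+|t|)` for `|t| ≥ R` and radius `1` otherwise. `C` precedes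
`f`, `β`, `ρ` and `t`, which gives uniformity in `μ`. -/
lemma exists_norm_iteratedDeriv_le (γ : ℂ) {b r R C₀ N : ℝ} (hR : 2 ≤ R) (hC₀ : 0 ≤ C₀)
    (hN : 0 ≤ N) (j : ℕ) : ∃ C : ℝ, 0 < C ∧ ∀ (f : ℂ → ℂ) (β ρ t : ℂ),
      Differentiable ℂ f → ‖β‖ ≤ b → ‖ρ‖ ≤ r → 1 / 2 ≤ ‖t‖ →
      (R ≤ ‖t‖ → ∀ z ∈ Metric.closedBall t 1, ‖f z‖ ≤ C₀ * ‖Complex.exp (phase γ β ρ z)‖) →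
      (∀ z ∈ Metric.closedBall (0 : ℂ) (R + 1), ‖f z‖ ≤ N) →
      ‖iteratedDeriv j f t‖ ≤ C * (1 + ‖t‖) ^ j * ‖Complex.exp (phase γ β ρ t)‖ := by
  set D : ℝ := ‖γ‖ + b + r
  set E : ℝ := ‖γ‖ * R ^ 2 + b * R + r * (R + 1)
  refine ⟨j.factorial * (C₀ * Real.exp D) + j.factorial * (N * Real.exp E) + 1, by positivity,
    fun f β ρ t hf hβ hρ ht hfar hnear => ?_⟩
  have hone : 1 ≤ (1 + ‖t‖) ^ j := one_le_pow₀ (by linarith)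
  have hexp : ∀ z, ‖Complex.exp z‖ = Real.exp z.re := Complex.norm_exp
  have p1 : 0 ≤ (j.factorial : ℝ) * (C₀ * Real.exp D) := by positivity
  have p2 : 0 ≤ (j.factorial : ℝ) * (N * Real.exp E) := by positivity
  have p3 : 0 ≤ (1 + ‖t‖) ^ j * ‖Complex.exp (phase γ β ρ t)‖ := by positivity
  rw [mul_assoc]
  rcases le_total R ‖t‖ with h | h
  · have hpos : 0 < (1 + ‖t‖)⁻¹ := by positivity
    have h0 : (1 + ‖t‖)⁻¹ ≤ 1 := inv_le_one_of_one_le₀ (by linarith)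
    have hs : ∀ z ∈ Metric.sphere t (1 + ‖t‖)⁻¹,
        ‖f z‖ ≤ C₀ * Real.exp D * ‖Complex.exp (phase γ β ρ t)‖ := by
      intro z hz
      rw [mem_sphere_iff_norm] at hz
      refine (hfar h z (mem_closedBall_iff_norm.2 (hz.le.trans h0))).trans ?_
      rw [mul_assoc]
      refine mul_le_mul_of_nonneg_left ?_ hC₀
      rw [hexp, hexp, ← Real.exp_add, Real.exp_le_exp]
      have h1 := norm_phase_sub_le (γ := γ) (β := β) (ρ := ρ) (hR.trans h) hz.le
      have h2 := (Complex.re_le_norm _).trans h1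
      rw [Complex.sub_re] at h2
      simp only [D]
      linarith
    have := Complex.norm_iteratedDeriv_le_of_forall_mem_sphere_norm_le j hpos hf.diffContOnCl hs
    refine this.trans ?_
    rw [inv_pow, div_inv_eq_mul]
    calc _ = (j.factorial * (C₀ * Real.exp D)) *
          ((1 + ‖t‖) ^ j * ‖Complex.exp (phase γ β ρ t)‖) := by ring
      _ ≤ _ := by gcongr; linarith
  · have hs : ∀ z ∈ Metric.sphere t 1, ‖f z‖ ≤ N := by
      intro z hz
      rw [mem_sphere_iff_norm] at hz
      refine hnear z (mem_closedBall_zero_iff.2 ?_)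
      have := norm_sub_norm_le z t
      linarith
    have := Complex.norm_iteratedDeriv_le_of_forall_mem_sphere_norm_le j one_pos hf.diffContOnCl hs
    refine this.trans ?_
    rw [one_pow, div_one]
    have h1 : 1 ≤ Real.exp E * ‖Complex.exp (phase γ β ρ t)‖ := by
      rw [hexp, ← Real.exp_add, Real.one_le_exp_iff]
      have h2 := norm_phase_le (γ := γ) (β := β) (ρ := ρ) ht h
      have h3 := (abs_le.1 ((Complex.abs_re_le_norm _).trans h2)).1
      have h4 : ‖γ‖ * R ^ 2 + ‖β‖ * R + ‖ρ‖ * (R + 1) ≤ E := by simp only [E]; gcongr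
      linarith
    calc (j.factorial : ℝ) * N ≤ j.factorial * N * ((1 + ‖t‖) ^ j *
          (Real.exp E * ‖Complex.exp (phase γ β ρ t)‖)) :=
          le_mul_of_one_le_right (by positivity) (one_le_mul_of_one_le_of_one_le hone h1)
      _ = (j.factorial * (N * Real.exp E)) *
          ((1 + ‖t‖) ^ j * ‖Complex.exp (phase γ β ρ t)‖) := by ring
      _ ≤ _ := by gcongr; linarith

end Estimates

end Heis

end

noncomputable section

namespace Heis

open Matrix Filter Set Topology
open scoped NNReal Matrix.Norms.Operator

/-! ### Specialization of the parameter -/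

section Specialization

variable {n : ℕ} {P : ℕ → NC} {B : ℝ≥0}

lemma compSystem_map (ν : discAlgebra B) (z : Metric.closedBall (0 : ℂ) B) (t : ℂ) :
    (compSystem n P ν t).map (discEval z) = compSystem n P (discEval z ν) t := by
  ext i j
  simp only [compSystem, compMat, symCoef, Matrix.map_apply, Matrix.sum_apply, Matrix.smul_apply,
    Matrix.of_apply, map_sum, map_smul, map_sub]
  refine Finset.sum_congr rfl fun r _ => ?_
  congr 2
  · split_ifs <;> simp
  · split_ifs <;> simp [map_sum, map_mul, map_pow, AlgHom.commutes]

lemma hasDerivAt_map_discEval (z : Metric.closedBall (0 : ℂ) B)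
    {Y : ℂ → Matrix (Fin n) (Fin n) (discAlgebra B)} {Y' : Matrix (Fin n) (Fin n) (discAlgebra B)}
    {t : ℂ} (h : HasDerivAt Y Y' t) :
    HasDerivAt (fun t => (Y t).map (discEval z)) (Y'.map (discEval z)) t :=
  hasDerivAt_matrix.2 fun i j => (discEvalL z).hasFDerivAt.comp_hasDerivAt t
    (hasDerivAt_matrix.1 h i j)

lemma discEval_expo (z : Metric.closedBall (0 : ℂ) B) (p γ : ℂ) (β ρ : discAlgebra B) (w : ℂ) :
    discEval z (expo p γ β ρ w) = expo p γ (discEval z β) (discEval z ρ) w := by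
  simp only [expo, map_add, map_smul, AlgHom.commutes]

end Specialization

/-- A basis of the kernel, holomorphic in the parameter and controlled on a sector. -/
theorem exists_kernel_basis {n : ℕ} (hn : 2 ≤ n) {P : ℕ → NC} {γ : Fin n → ℂ}
    (hP : IsGeneric n P γ) {p : ℂ} (hp : ‖p‖ = 1) {s : ℝ} (hs : 0 < s) (hs1 : s ≤ 1)
    (ha : AdmissibleSlope (fun ij : {ij : Fin n × Fin n // ij.1 ≠ ij.2} =>
      p ^ 2 * (γ ij.1.1 - γ ij.1.2) / 2) s) {Ω : Set ℂ} {B : ℝ≥0}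
    (hΩ : ∀ μ ∈ Ω, μ ≠ 0 ∧ ‖μ⁻¹‖ < B) :
    ∃ ψ : Fin n → ℂ → Entire,
      (∀ μ ∈ Ω, LinearIndependent ℂ (fun k => ψ k μ) ∧
        Submodule.span ℂ (Set.range fun k => ψ k μ) = LinearMap.ker (opL n P μ)) ∧
      (∀ k t, AnalyticOnNhd ℂ (fun μ => (ψ k μ : ℂ → ℂ) t) Ω) ∧
      ∃ C x₀ b r : ℝ, 0 ≤ C ∧ 0 < x₀ ∧ (∀ μ ∈ Ω, ∀ k, ‖beta P γ μ k‖ ≤ b ∧ ‖rho P γ μ k‖ ≤ r ∧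
        ∀ w ∈ cone s x₀, ‖(ψ k μ : ℂ → ℂ) (tMap p w)‖ ≤
          C * ‖Complex.exp (phase (γ k) (beta P γ μ k) (rho P γ μ k) (tMap p w))‖) ∧
      ∀ R : ℝ, ∃ N : ℝ, 0 ≤ N ∧ ∀ μ ∈ Ω, ∀ k, ∀ t ∈ Metric.closedBall (0 : ℂ) R,
        ‖(ψ k μ : ℂ → ℂ) t‖ ≤ N := by
  -- One fundamental matrix, with `ν = μ⁻¹` as the coordinate of the disc, serves all parameters;
  -- `μ` enters below only through evaluation.
  obtain ⟨Y, Z, hY, hZ, hYZ, C, x₀, hx₀, hC⟩ :=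
    exists_entire_fundamental_matrix hn hP (discCoord B) hp hs hs1 ha
  set i₀ : Fin n := ⟨0, by omega⟩
  have hmem : ∀ μ ∈ Ω, μ⁻¹ ∈ Metric.closedBall (0 : ℂ) B := fun μ hμ =>
    mem_closedBall_zero_iff.2 (hΩ μ hμ).2.le
  have hYd : ∀ k t, HasDerivAt (fun t => Y t i₀ k) ((compSystem n P (discCoord B) t * Y t) i₀ k) t :=
    fun k t => hasDerivAt_matrix.1 (hY t) i₀ k
  have hdiff : ∀ k μ, Differentiable ℂ fun t => discFun (Y t i₀ k) μ⁻¹ := by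
    intro k μ
    by_cases h : μ⁻¹ ∈ Metric.closedBall (0 : ℂ) B
    · simp only [discFun_of_mem _ h]
      exact fun t => ((discEvalL ⟨_, h⟩).hasFDerivAt.comp_hasDerivAt t (hYd k t)).differentiableAt
    · have : (fun t => discFun (Y t i₀ k) μ⁻¹) = fun _ => 0 := funext fun t => dif_neg h
      rw [this]
      exact differentiable_const _
  refine ⟨fun k μ => ⟨_, hdiff k μ⟩, fun μ hμ => ?_, fun k t μ hμ => ?_, ?_⟩
  · set z : Metric.closedBall (0 : ℂ) B := ⟨μ⁻¹, hmem μ hμ⟩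
    have hz : discEval z (discCoord B) = μ⁻¹ := discEval_coord z
    refine kernel_basis hP.homog hP.leading_eq_one hn μ (Y := fun t => (Y t).map (discEval z))
      (Z := fun t => (Z t).map (discEval z)) (fun t => ?_) (fun t => ?_) (fun t => ?_)
      (φ := fun k => ⟨_, hdiff k μ⟩) fun k t => discFun_of_mem _ (hmem μ hμ)
    · rw [← hz, ← compSystem_map, ← Matrix.map_mul]
      exact hasDerivAt_map_discEval z (hY t)
    · have := hasDerivAt_map_discEval z (hZ t)
      rw [Matrix.map_neg _ (map_neg (discEval z)), Matrix.map_mul, compSystem_map, hz] at this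
      exact this
    · rw [← Matrix.map_mul, ← Matrix.map_mul, (hYZ t).1, (hYZ t).2]
      simp
  · have hopen : IsOpen {μ : ℂ | μ ≠ 0 ∧ ‖μ⁻¹‖ < B} := by
      have h : ContinuousOn (fun μ : ℂ => ‖μ⁻¹‖) {0}ᶜ := (continuousOn_inv₀).norm
      exact h.isOpen_inter_preimage isOpen_compl_singleton isOpen_Iio
    have hd : DifferentiableOn ℂ (fun μ => discFun (Y t i₀ k) μ⁻¹) {μ : ℂ | μ ≠ 0 ∧ ‖μ⁻¹‖ < B} :=
      (differentiableOn_discFun (Y t i₀ k)).comp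
        (fun μ hμ => (differentiableAt_inv hμ.1).differentiableWithinAt)
        fun μ hμ => mem_ball_zero_iff.2 hμ.2
    exact hd.analyticAt (hopen.mem_nhds (hΩ μ hμ))
  · set b : ℝ := ∑ k, ‖nfBeta P (discCoord B) γ k‖
    set r : ℝ := ∑ k, ‖nfRho P (discCoord B) γ k‖
    refine ⟨|C| * Real.exp (2 * r), x₀, b, r, by positivity, hx₀, fun μ hμ k => ?_, fun R => ?_⟩
    · set z : Metric.closedBall (0 : ℂ) B := ⟨μ⁻¹, hmem μ hμ⟩
      have hz : discEval z (discCoord B) = μ⁻¹ := discEval_coord z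
      have hβ := nfBeta_map (γ := γ) hP.homog (discEval z) hz k
      have hρ := nfRho_map hn hP (discEval z) hz k
      have hr : ‖rho P γ μ k‖ ≤ r := by
        rw [← hρ]
        exact (norm_discEval_le z _).trans (Finset.single_le_sum
          (f := fun k => ‖nfRho P (discCoord B) γ k‖) (fun _ _ => norm_nonneg _) (Finset.mem_univ k))
      refine ⟨?_, hr, fun w hw => ?_⟩
      · rw [← hβ]
        exact (norm_discEval_le z _).trans (Finset.single_le_sum
          (f := fun k => ‖nfBeta P (discCoord B) γ k‖) (fun _ _ => norm_nonneg _) (Finset.mem_univ k))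
      · obtain ⟨a, ha, hYa⟩ := hC w hw k
        change ‖discFun (Y (tMap p w) i₀ k) μ⁻¹‖ ≤ _
        rw [discFun_of_mem _ (hmem μ hμ), hYa, map_mul, discEval_exp, discEval_expo, hβ, hρ, norm_mul,
          mul_assoc]
        refine mul_le_mul ((norm_discEval_le z a).trans (ha.trans (le_abs_self C))) ?_
          (norm_nonneg _) (abs_nonneg C)
        refine (norm_exp_expo_le hp (cone_ne_zero hs hx₀ hw)).trans ?_
        gcongr
    · have hcont : ∀ k, Continuous fun t => Y t i₀ k := fun k =>
        continuous_iff_continuousAt.2 fun t => (hYd k t).continuousAt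
      obtain ⟨N, hN⟩ := (isCompact_closedBall (0 : ℂ) R).bddAbove_image
        (f := fun t => ∑ k, ‖Y t i₀ k‖) (by fun_prop)
      refine ⟨|N|, abs_nonneg N, fun μ hμ k t ht => ?_⟩
      change ‖discFun (Y t i₀ k) μ⁻¹‖ ≤ _
      rw [discFun_of_mem _ (hmem μ hμ)]
      exact (norm_discEval_le _ _).trans ((Finset.single_le_sum (f := fun k => ‖Y t i₀ k‖)
        (fun _ _ => norm_nonneg _) (Finset.mem_univ k)).trans
        ((hN (Set.mem_image_of_mem _ ht)).trans (le_abs_self N)))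

end Heis

end

/-! ### Assembly: choice of the sector and of the disc of parameters -/

theorem mainTheorem7 (n : ℕ) (hn : 2 ≤ n) (P : ℕ → Heis.NC) (γ : Fin n → ℂ)
    (hP : Heis.IsGeneric n P γ) (α : ℝ) (hα₀ : 0 ≤ α) (hα₁ : α ≤ Real.pi / 2) :
    ∃ υ₁ υ₂ : ℝ, υ₁ < 0 ∧ 0 < υ₂ ∧
      ∀ Ω : Set ℂ, IsCompact Ω → IsSimplyConnected Ω → 0 < Metric.infDist 0 Ω →
        ∃ K : Set ℂ, IsCompact K ∧ (interior K).Nonempty ∧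
          ∀ ε : ℝ, ε = 1 ∨ ε = -1 →
            ∃ ψ : Fin n → ℂ → Heis.Entire,
              (∀ μ ∈ Ω, LinearIndependent ℂ (fun k => ψ k μ) ∧
                Submodule.span ℂ (Set.range fun k => ψ k μ)
                  = LinearMap.ker (Heis.opL n P μ)) ∧
              (∀ k t, AnalyticOnNhd ℂ (fun μ => (ψ k μ : ℂ → ℂ) t) Ω) ∧
              ∀ k : Fin n, ∀ j : ℕ, ∃ C : ℝ, 0 < C ∧
                ∀ μ ∈ Ω, ∀ t ∈ Heis.sector K α υ₁ υ₂ ε,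
                  ‖iteratedDeriv j (ψ k μ : ℂ → ℂ) t‖ ≤
                    C * (1 + ‖t‖) ^ j * ‖Complex.exp (Heis.Phi P γ μ k t)‖ := by
  set c : ℂ := Complex.exp (-(Complex.I * α)) with hc
  have hc0 : c ≠ 0 := Complex.exp_ne_zero _
  have hcn : ‖c‖ = 1 := by simp [hc, Complex.norm_exp]
  -- The condition involves the direction only through its square, so one slope, depending on `α`
  -- and the `γ_k` alone, serves both signs and every `Ω`.
  obtain ⟨s, hs, hs1, ha⟩ := Heis.exists_admissibleSlope
    (a := fun ij : {ij : Fin n × Fin n // ij.1 ≠ ij.2} => c ^ 2 * (γ ij.1.1 - γ ij.1.2) / 2)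
    fun ij => div_ne_zero (mul_ne_zero (pow_ne_zero 2 hc0)
      (sub_ne_zero.2 fun h => ij.2 (hP.injective h))) two_ne_zero
  refine ⟨-(s / 32), s / 32, by linarith, by linarith, fun Ω _ _ hΩ => ?_⟩
  set δ : ℝ := Metric.infDist 0 Ω
  -- The added `1` puts `μ⁻¹` in the open disc, where elements of the algebra are holomorphic.
  have hmem : ∀ μ ∈ Ω, μ ≠ 0 ∧ ‖μ⁻¹‖ < (Real.toNNReal (δ⁻¹ + 1) : ℝ) := by
    intro μ hμ
    have h : δ ≤ ‖μ‖ := (Metric.infDist_le_dist_of_mem hμ).trans_eq (dist_zero_left μ)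
    refine ⟨norm_pos_iff.1 (hΩ.trans_le h), ?_⟩
    rw [norm_inv, Real.coe_toNNReal _ (by positivity)]
    linarith [inv_anti₀ hΩ h]
  -- Centred off the axis of the sector, so that neither half of the sector comes near `t = 0`.
  refine ⟨Metric.closedBall (c * Complex.I) (1 / 4), isCompact_closedBall _ _,
    ⟨c * Complex.I, Metric.ball_subset_interior_closedBall (Metric.mem_ball_self (by norm_num))⟩,
    fun ε hε => ?_⟩
  have hp : ‖(ε : ℂ) * c‖ = 1 := by rcases hε with rfl | rfl <;> simp [hcn]
  have hp2 : ((ε : ℂ) * c) ^ 2 = c ^ 2 := by rcases hε with rfl | rfl <;> simp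
  obtain ⟨ψ, hbasis, hanal, C, x₀, b, r, hC, hx₀, hfar, hnear⟩ :=
    Heis.exists_kernel_basis hn hP hp hs hs1 (by rw [hp2]; exact ha) hmem
  refine ⟨ψ, hbasis, hanal, fun k j => ?_⟩
  obtain ⟨R, hR, hgeom⟩ := Heis.sector_geometry hs hs1 hx₀
  obtain ⟨N, hN, hnear⟩ := hnear (R + 1)
  obtain ⟨C', hC', h⟩ := Heis.exists_norm_iteratedDeriv_le (γ k) (b := b) (r := r) hR hC hN j
  refine ⟨C', hC', fun μ hμ t ht => ?_⟩
  obtain ⟨hb, hr, hw⟩ := hfar μ hμ k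
  obtain ⟨h1, h2⟩ := hgeom α ε hε t ht
  refine h _ _ _ t (ψ k μ).2 hb hr h1 (fun hRt z hz => ?_) (hnear μ hμ k)
  obtain ⟨w, hwc, rfl⟩ := h2 hRt z hz
  exact hw w hwc
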